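/- Let $G$ be a locally compact Hausdorff group with left Haar measure $dg$, let $B$ be a $C^*$-algebra with a strongly continuous action $\beta$ of $G$ by $*$-automorphisms, and let $E$ be a Hilbert $(B,G)$-module: a right Hilbert $B$-module with a strongly continuous linear action $\gamma$ of $G$ satisfying $\gamma_g(\xi b)=\gamma_g(\xi)\beta_g(b)$ and $\langle\gamma_g\xi|\gamma_g\eta\rangle=\beta_g(\langle\xi|\eta\rangle)$. *Notation.* Let $L^2(G,B)$ be the completion of $C_c(G,B)$ for the inner product $\langle f_1|f_2\rangle=\int_G f_1(g)^*f_2(g)\,dg$. A continuous bounded function $f:G\to B$ is said to belong to $L^2(G,B)$ if $\chi f$ converges in $L^2(G,B)$ when the continuous compactly supported functions $\chi:G\to[0,1]$ converge to $1$ uniformly on compact subsets; $f$ is then identified with the limit. For $K\in C_c(G,B)$ let $\rho_K$ be the bounded operator on $L^2(G,B)$ with $(\rho_Kf)(g)=\int_G\beta_g(K(g^{-1}g_2))f(g_2)\,dg_2$ for $f\in C_c(G,B)$; the reduced crossed product $C^*_r(G,B)$ is the operator norm closure of $\{\rho_K: K\in C_c(G,B)\}$. For $\xi,\eta\in E$ put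 $(\langle\!\langle\xi|\eta)(g)=\langle\gamma_g\xi|\eta\rangle$, and let $E_{si}$ be the set of all $\xi\in E$ with $\langle\!\langle\xi|\eta\in L^2(G,B)$ for all $\eta\in E$. If $\xi\in E_{si}$, let $|\xi\rangle\!\rangle:L^2(G,B)\to E$ be the bounded operator that extends $f\mapsto\int_G\gamma_g(\xi)f(g)\,dg$, $f\in C_c(G,B)$; for $\xi,\eta\in E_{si}$ let $\langle\!\langle\xi|\eta\rangle\!\rangle=\langle\!\langle\xi|\circ|\eta\rangle\!\rangle$, an operator on $L^2(G,B)$, and let $\|\xi\|_{si}=\|\xi\|+\||\xi\rangle\!\rangle\|$. The module $E$ is *square-integrable* if $E_{si}$ is dense in $E$. A subset $R\subseteq E$ is *relatively continuous* if $R\subseteq E_{si}$ and $\langle\!\langle\xi|\eta\rangle\!\rangle\in C^*_r(G,B)$ for all $\xi,\eta\in R$. A linear subspace $R\subseteq E_{si}$ is *complete* if it is closed in $E_{si}$ for $\|\cdot\|_{si}$ and $\int_G\gamma_g(\xi K(g^{-1}))\,dg\in R$ for all $\xi\in R$, $K\in C_c(G,B)$. The *completion* of a subset of $E_{si}$ is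 the smallest complete subspace that contains it. Let $P$ be the primitive ideal space of $B$ with the Jacobson topology and the $G$-action $g\cdot p=\beta_g(p)$. Call $B$ *spectrally proper* if all $x,y\in P$ have neighbourhoods $U_x,U_y$ such that $\{g\in G: gU_x\cap U_y\neq\emptyset\}$ is relatively compact in $G$. Let $B_{cs}$ be the union of the ideals $B_U=\bigcap_{p\in P\setminus U}p$ over all open $U\subseteq P$ that are contained in a quasi-compact subset of $P$, and let $E_{cs}=E\cdot B_{cs}=\{\xi b:\xi\in E,\ b\in B_{cs}\}$. **Theorem.** Assume that $B$ is spectrally proper. Then: 1. $E_{cs}$ is a dense, relatively continuous linear subspace of $E$, and $\langle\!\langle E_{cs}|E_{cs}\rangle\!\rangle\subseteq C_c(G,B)$: for all $\xi,\eta\in E_{cs}$ the function $K(g)=\langle\xi|\gamma_g\eta\rangle$ belongs to $C_c(G,B)$ and $\langle\!\langle\xi|\eta\rangle\!\rangle=\rho_K$. In particular, $E$ is square-integrable. 2. The completion $R_0$ of $E_{cs}$ is the only dense, complete, relatively continuous subspace of $E$. 3. For $\xi\in E$, one has $\xi\in R_0$ if and only if $\xi\in E_{si}$ and $\langle\!\langle\xi|\xi\rangle\!\rangle\in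 C^*_r(G,B)$. 4. Every relatively continuous subset of $E$ is contained in $R_0$. -/

import Mathlib

open MeasureTheory Filter Topology
open scoped CompactlySupported RightActions

/-! ## The primitive ideal space of a C⋆-algebra -/

/-- A `⋆`-representation on a Hilbert space is irreducible if it is nonzero and has no closed
invariant subspaces besides `0` and the whole space. -/
def IsIrreducibleRep {B H : Type*} [NonUnitalCStarAlgebra B] [NormedAddCommGroup H]
    [InnerProductSpace ℂ H] [CompleteSpace H] (π : B →⋆ₙₐ[ℂ] (H →L[ℂ] H)) : Prop :=
  π ≠ 0 ∧ ∀ M : Submodule ℂ H, IsClosed (M : Set H) → (∀ b, ∀ x ∈ M, π b x ∈ M) → M = ⊥ ∨ M = ⊤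

/-- Primitive ideals are the kernels of irreducible representations.  The Hilbert space may be taken
in the universe of `B`, because an irreducible representation is cyclic. -/
def IsPrimitiveIdeal.{u} {B : Type u} [NonUnitalCStarAlgebra B] (p : TwoSidedIdeal B) : Prop :=
  ∃ (H : Type u) (_ : NormedAddCommGroup H) (_ : InnerProductSpace ℂ H) (_ : CompleteSpace H)
    (π : B →⋆ₙₐ[ℂ] (H →L[ℂ] H)), IsIrreducibleRep π ∧ p = TwoSidedIdeal.ker π

theorem IsPrimitiveIdeal.exists_notMem {B : Type*} [NonUnitalCStarAlgebra B] {p : TwoSidedIdeal B}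
    (hp : IsPrimitiveIdeal p) : ∃ b, b ∉ p := by
  obtain ⟨H, _, _, _, π, ⟨h0, -⟩, rfl⟩ := hp
  by_contra! h
  exact h0 (by ext b : 1; exact (TwoSidedIdeal.mem_ker π).1 (h b))

theorem IsPrimitiveIdeal.prime {B : Type*} [NonUnitalCStarAlgebra B] {p : TwoSidedIdeal B}
    (hp : IsPrimitiveIdeal p) {s t : B} (h : ∀ b, s * b * t ∈ p) : s ∈ p ∨ t ∈ p := by
  obtain ⟨H, _, _, _, π, ⟨h0, hirr⟩, rfl⟩ := hp
  simp only [TwoSidedIdeal.mem_ker, map_mul] at h ⊢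
  by_contra! hst
  obtain ⟨hs, ht⟩ := hst
  -- the vectors killed by `π(s) π(B)`
  let M : Submodule ℂ H := ⨅ b, LinearMap.ker ((π s * π b : H →L[ℂ] H) : H →ₗ[ℂ] H)
  have hM : ∀ x, x ∈ M ↔ ∀ b, π s (π b x) = 0 := fun x => by
    simp [M, Submodule.mem_iInf]
  have hMc : IsClosed (M : Set H) := by
    have : (M : Set H) = ⋂ b, {x | π s (π b x) = 0} := by
      ext x; simp [hM]
    rw [this]
    exact isClosed_iInter fun b => isClosed_eq (by fun_prop) (by fun_prop)
  have hMi : ∀ b, ∀ x ∈ M, π b x ∈ M := fun b x hx => by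
    rw [hM] at hx ⊢
    intro c
    have := hx (c * b)
    simpa using this
  have htM : ∀ y, π t y ∈ M := fun y => by
    rw [hM]; intro b
    simpa using congrArg (fun T : H →L[ℂ] H => T y) (h b)
  rcases hirr M hMc hMi with hbot | htop
  · refine ht (ContinuousLinearMap.ext fun y => ?_)
    have := htM y
    rw [hbot] at this
    simpa using this
  · -- now `π(s)` kills the essential subspace
    let N : Submodule ℂ H := ⨅ b, LinearMap.ker ((π b : H →L[ℂ] H) : H →ₗ[ℂ] H)
    have hN : ∀ x, x ∈ N ↔ ∀ b, π b x = 0 := fun x => by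
      simp [N, Submodule.mem_iInf]
    have hNc : IsClosed (N : Set H) := by
      have : (N : Set H) = ⋂ b, {x | π b x = 0} := by
        ext x; simp [hN]
      rw [this]
      exact isClosed_iInter fun b => isClosed_eq (by fun_prop) (by fun_prop)
    have hNi : ∀ b, ∀ x ∈ N, π b x ∈ N := fun b x hx => by
      rw [hN] at hx ⊢
      intro c
      rw [hx b, map_zero]
    rcases hirr N hNc hNi with hb | ht'
    · -- the range of `π(s)⋆` is killed by `π(B)`
      have h3 : ∀ x, π (star s) x = 0 := by
        intro x
        have : π (star s) x ∈ N := by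
          rw [hN]
          intro b
          have h1 : π s * π (star b) = 0 := by
            ext y
            have : y ∈ M := htop ▸ Submodule.mem_top
            simpa using (hM y).1 this (star b)
          have h2 := congrArg star h1
          rw [star_mul, star_zero, ← map_star, ← map_star, star_star] at h2
          simpa using congrArg (fun T : H →L[ℂ] H => T x) h2
        rw [hb] at this
        simpa using this
      have h4 : π (star s) = 0 := ContinuousLinearMap.ext h3
      exact hs (by rw [← star_star s, map_star, h4, star_zero])
    · refine h0 ?_
      ext b x
      have : x ∈ N := ht' ▸ Submodule.mem_top
      simpa using (hN x).1 this b

theorem IsPrimitiveIdeal.comap {B : Type*} [NonUnitalCStarAlgebra B] {p : TwoSidedIdeal B}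
    (hp : IsPrimitiveIdeal p) (e : B ≃⋆ₐ[ℂ] B) : IsPrimitiveIdeal (TwoSidedIdeal.comap e p) := by
  obtain ⟨H, i1, i2, i3, π, ⟨h0, hirr⟩, rfl⟩ := hp
  refine ⟨H, i1, i2, i3, π.comp (e : B →⋆ₙₐ[ℂ] B), ⟨fun h => h0 ?_, fun M hM hMi => ?_⟩, ?_⟩
  · ext b : 1
    have := DFunLike.congr_fun h (e.symm b)
    simpa using this
  · refine hirr M hM fun b x hx => ?_
    have := hMi (e.symm b) x hx
    simpa using this
  · ext b
    simp [TwoSidedIdeal.mem_comap, TwoSidedIdeal.mem_ker]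

/-- The primitive ideal space. -/
def PrimSpace (B : Type*) [NonUnitalCStarAlgebra B] : Type _ :=
  {p : TwoSidedIdeal B // IsPrimitiveIdeal p}

/-- The Jacobson (hull-kernel) topology: the closed sets are the sets `{p | S ⊆ p}`. -/
instance {B : Type*} [NonUnitalCStarAlgebra B] : TopologicalSpace (PrimSpace B) where
  IsOpen U := ∃ S : Set B, U = {p | ¬ S ⊆ {b | b ∈ p.1}}
  isOpen_univ := ⟨Set.univ, by
    ext p
    obtain ⟨b, hb⟩ := p.2.exists_notMem
    simp only [Set.mem_univ, Set.mem_ofPred_eq, Set.not_subset, true_and, true_iff]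
    exact ⟨b, hb⟩⟩
  isOpen_inter := by
    rintro _ _ ⟨S, rfl⟩ ⟨T, rfl⟩
    refine ⟨{x | ∃ s ∈ S, ∃ t ∈ T, ∃ b, x = s * b * t}, ?_⟩
    ext p
    simp only [Set.mem_inter_iff, Set.mem_ofPred_eq, Set.not_subset]
    constructor
    · rintro ⟨⟨s, hs, hsp⟩, ⟨t, ht, htp⟩⟩
      by_contra hcon
      push Not at hcon
      rcases p.2.prime (s := s) (t := t) fun b => hcon _ ⟨s, hs, t, ht, b, rfl⟩ with h | h
      · exact hsp h
      · exact htp h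
    · rintro ⟨_, ⟨s, hs, t, ht, b, rfl⟩, hx⟩
      exact ⟨⟨s, hs, fun h => hx (p.1.mul_mem_right _ _ (p.1.mul_mem_right _ _ h))⟩,
        ⟨t, ht, fun h => hx (p.1.mul_mem_left _ _ h)⟩⟩
  isOpen_sUnion := by
    intro s hs
    choose! S hS using hs
    refine ⟨⋃ U ∈ s, S U, ?_⟩
    ext p
    simp only [Set.mem_sUnion, Set.mem_ofPred_eq, Set.iUnion_subset_iff, not_forall]
    constructor
    · rintro ⟨U, hU, hp⟩
      rw [hS U hU] at hp
      exact ⟨U, hU, hp⟩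
    · rintro ⟨U, hU, hp⟩
      refine ⟨U, hU, ?_⟩
      rw [hS U hU]
      exact hp

/-- A set contained in a quasi-compact set. -/
def IsRelQuasiCompact {X : Type*} [TopologicalSpace X] (S : Set X) : Prop :=
  ∃ K, IsCompact K ∧ S ⊆ K

/-- Properness of an action on a not necessarily Hausdorff space. -/
def IsProperGSpace (G X : Type*) [Group G] [TopologicalSpace G] [TopologicalSpace X]
    [MulAction G X] : Prop :=
  ∀ x y : X, ∃ U ∈ 𝓝 x, ∃ V ∈ 𝓝 y,
    IsRelQuasiCompact {g : G | (((fun z : X => g • z) '' U) ∩ V).Nonempty}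

/-- The ideal `B_U` of elements that vanish in `B / p` for all `p ∉ U`. -/
def idealOf {B : Type*} [NonUnitalCStarAlgebra B] (U : Set (PrimSpace B)) : Set B :=
  {b | ∀ p : PrimSpace B, p ∉ U → b ∈ p.1}

/-- `B_cs`, the union of the ideals `B_U` over all open relatively quasi-compact `U`. -/
def compactPart (B : Type*) [NonUnitalCStarAlgebra B] : Set B :=
  {b | ∃ U : Set (PrimSpace B), IsOpen U ∧ IsRelQuasiCompact U ∧ b ∈ idealOf U}

/-! ## Group actions on C⋆-algebras and Hilbert modules -/

/-- A strongly continuous action of `G` on the C⋆-algebra `B` by `⋆`-automorphisms. -/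
structure GCStarAction (G B : Type*) [Group G] [TopologicalSpace G]
    [NonUnitalCStarAlgebra B] where
  toHom : G →* (B ≃⋆ₐ[ℂ] B)
  continuous_apply : ∀ b, Continuous fun g => toHom g b

instance {G B : Type*} [Group G] [TopologicalSpace G] [NonUnitalCStarAlgebra B] :
    CoeFun (GCStarAction G B) (fun _ => G → (B ≃⋆ₐ[ℂ] B)) := ⟨fun β => β.toHom⟩

namespace GCStarAction

variable {G B : Type*} [Group G] [TopologicalSpace G] [NonUnitalCStarAlgebra B]

/-- The induced action on the primitive ideal space, `g • p = β_g(p)`. -/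
@[reducible] def primAction (β : GCStarAction G B) : MulAction G (PrimSpace B) where
  smul g p := ⟨TwoSidedIdeal.comap (β g⁻¹) p.1, p.2.comap _⟩
  one_smul p := Subtype.ext <| by
    ext b
    change b ∈ TwoSidedIdeal.comap (β 1⁻¹) p.1 ↔ _
    simp [TwoSidedIdeal.mem_comap]
  mul_smul g h p := Subtype.ext <| by
    ext b
    change b ∈ TwoSidedIdeal.comap (β (g * h)⁻¹) p.1 ↔
      b ∈ TwoSidedIdeal.comap (β g⁻¹) (TwoSidedIdeal.comap (β h⁻¹) p.1)
    simp [TwoSidedIdeal.mem_comap]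

/-- The primitive ideal space is a proper `G`-space. -/
def IsSpectrallyProper (β : GCStarAction G B) : Prop :=
  @IsProperGSpace G (PrimSpace B) _ _ _ β.primAction

theorem continuous_uncurry (β : GCStarAction G B) : Continuous fun x : G × B => β x.1 x.2 := by
  rw [continuous_iff_continuousAt]
  rintro ⟨g, b⟩
  rw [ContinuousAt, tendsto_iff_norm_sub_tendsto_zero]
  have h1 : Tendsto (fun x : G × B => ‖x.2 - b‖ + ‖β x.1 b - β g b‖) (𝓝 (g, b)) (𝓝 0) := by
    have : Continuous fun x : G × B => ‖x.2 - b‖ + ‖β x.1 b - β g b‖ := by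
      have := (β.continuous_apply b).comp (continuous_fst (X := G) (Y := B))
      have h' : Continuous fun x : G × B => β x.1 b := this
      fun_prop
    simpa using this.tendsto (g, b)
  refine squeeze_zero (fun _ => norm_nonneg _) (fun x => ?_) h1
  calc ‖β x.1 x.2 - β g b‖ = ‖β x.1 (x.2 - b) + (β x.1 b - β g b)‖ := by
        rw [map_sub]; congr 1; abel
    _ ≤ ‖β x.1 (x.2 - b)‖ + ‖β x.1 b - β g b‖ := norm_add_le _ _
    _ = _ := by rw [NonUnitalStarAlgHom.norm_map (β x.1) (β x.1).injective]
end GCStarAction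

/-- The `B`-valued inner product on a right Hilbert `B`-module, conjugate linear in the first and
linear in the second variable, with `⟨x|y·b⟩ = ⟨x|y⟩ b`.  In `CStarModule A E` the inner product
satisfies `⟨x|a•y⟩ = a⟨x|y⟩`, so that right Hilbert `B`-modules are modules over `Bᵐᵒᵖ`. -/
def hinner (B : Type*) {E : Type*} [Inner Bᵐᵒᵖ E] (x y : E) : B :=
  (inner Bᵐᵒᵖ x y).unop

/-- A strongly continuous action of `G` on a Hilbert `B`-module compatible with the action `β`
on `B`, turning it into a Hilbert `(B, G)`-module. -/
structure HilbertGAction {G B : Type*} [Group G] [TopologicalSpace G] [NonUnitalCStarAlgebra B]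
    [PartialOrder B] (β : GCStarAction G B) (E : Type*) [NormedAddCommGroup E] [NormedSpace ℂ E]
    [SMul Bᵐᵒᵖ E] [CStarModule Bᵐᵒᵖ E] where
  toHom : G →* Module.End ℂ E
  map_smul_right : ∀ g (x : E) (b : B), toHom g (x <• b) = toHom g x <• β g b
  hinner_map : ∀ g (x y : E), hinner B (toHom g x) (toHom g y) = β g (hinner B x y)
  continuous_apply : ∀ x, Continuous fun g => toHom g x

instance {G B : Type*} [Group G] [TopologicalSpace G] [NonUnitalCStarAlgebra B]
    [PartialOrder B] (β : GCStarAction G B) (E : Type*) [NormedAddCommGroup E] [NormedSpace ℂ E]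
    [SMul Bᵐᵒᵖ E] [CStarModule Bᵐᵒᵖ E] :
    CoeFun (HilbertGAction β E) (fun _ => G → Module.End ℂ E) := ⟨fun γ => γ.toHom⟩

/-! ## The Hilbert module `L²(G, B)` -/

section L2

variable {G : Type*} [Group G] [TopologicalSpace G] [IsTopologicalGroup G]
  [MeasurableSpace G] [BorelSpace G]

/-- `C_c(G, B)`, to be equipped with the inner product `⟨f₁|f₂⟩ = ∫ f₁(g)⋆ f₂(g) dg`. -/
def PreL2 (_ : Measure G) (B : Type*) [NonUnitalCStarAlgebra B] : Type _ := C_c(G, B)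

variable (μ : Measure G) (B : Type*) [NonUnitalCStarAlgebra B]

noncomputable section

instance : AddCommGroup (PreL2 μ B) := inferInstanceAs (AddCommGroup C_c(G, B))

instance : Module ℂ (PreL2 μ B) := inferInstanceAs (Module ℂ C_c(G, B))

/-- Pointwise right multiplication, `(f·b)(g) = f(g) b`. -/
instance : SMul Bᵐᵒᵖ (PreL2 μ B) where
  smul b f := (⟨⟨fun g => (show C_c(G, B) from f) g * b.unop, by fun_prop⟩,
    (show C_c(G, B) from f).hasCompactSupport.mul_right⟩ : C_c(G, B))

instance : Inner Bᵐᵒᵖ (PreL2 μ B) where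
  inner f₁ f₂ := .op (∫ g, star ((show C_c(G, B) from f₁) g) * (show C_c(G, B) from f₂) g ∂μ)

instance : Norm (PreL2 μ B) := CStarModule.norm Bᵐᵒᵖ

theorem PreL2.integrable_star_mul {X B : Type*} [TopologicalSpace X] [MeasurableSpace X]
    [BorelSpace X] [NonUnitalCStarAlgebra B] (μ : Measure X) [IsFiniteMeasureOnCompacts μ]
    (f₁ f₂ : C_c(X, B)) :
    Integrable (fun g => star (f₁ g) * f₂ g) μ :=
  Continuous.integrable_of_hasCompactSupport (by fun_prop) f₂.hasCompactSupport.mul_left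

theorem PreL2.eq_zero_of_integral {X B : Type*} [TopologicalSpace X] [MeasurableSpace X]
    [BorelSpace X] [NonUnitalCStarAlgebra B] [PartialOrder B] [StarOrderedRing B] (μ : Measure X)
    [IsFiniteMeasureOnCompacts μ] [μ.IsOpenPosMeasure] (f : C_c(X, B)) (h : ∫ g, star (f g) * f g ∂μ = 0) : f = 0 := by
  ext g₀
  set F : X → B := fun g => star (f g) * f g with hF
  have hFc : Continuous F := by fun_prop
  have hF0 : ∀ g, 0 ≤ F g := fun g => star_mul_self_nonneg _
  have hFi : Integrable F μ := PreL2.integrable_star_mul μ f f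
  have key : ∀ ε > 0, ‖F g₀‖ ≤ ε := by
    intro ε hε
    let U : Set X := {g | ‖F g - F g₀‖ < ε} ∩ {g | F g ≠ 0}
    by_cases hz : F g₀ = 0
    · simp [hz, hε.le]
    have hU : IsOpen U := (isOpen_lt (by fun_prop) continuous_const).inter
      (isOpen_ne_fun hFc continuous_const)
    have hg₀ : g₀ ∈ U := ⟨by simpa using hε, hz⟩
    have hUpos : 0 < μ U := hU.measure_pos μ ⟨g₀, hg₀⟩
    have hUfin : μ U < ⊤ := by
      refine lt_of_le_of_lt (measure_mono ?_) (f.hasCompactSupport.isCompact.measure_lt_top (μ := μ))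
      rintro g ⟨-, hg⟩
      refine subset_tsupport _ fun h => hg ?_
      simp [hF, h]
    have hint : ∫ g in U, F g ∂μ = 0 := by
      refine le_antisymm ?_ (integral_nonneg hF0)
      rw [← h]
      exact setIntegral_le_integral hFi (Eventually.of_forall hF0)
    have h1 : ‖∫ g in U, (F g - F g₀) ∂μ‖ ≤ ε * μ.real U :=
      norm_setIntegral_le_of_norm_le_const hUfin fun g hg => hg.1.le
    rw [integral_sub hFi.integrableOn (integrableOn_const hUfin.ne), hint, setIntegral_const,
      zero_sub, norm_neg, norm_smul, Real.norm_of_nonneg measureReal_nonneg, mul_comm] at h1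
    exact le_of_mul_le_mul_right h1 (ENNReal.toReal_pos hUpos.ne' hUfin.ne)
  have : F g₀ = 0 := norm_le_zero_iff.1 (le_of_forall_pos_le_add (by simpa using key))
  simpa [hF, CStarRing.star_mul_self_eq_zero_iff] using this

variable [PartialOrder B] [StarOrderedRing B] [μ.IsHaarMeasure]

instance : CStarModule Bᵐᵒᵖ (PreL2 μ B) where
  inner_add_right {x y z} := by
    apply MulOpposite.unop_injective
    change ∫ g, star ((show C_c(G, B) from x) g) * ((show C_c(G, B) from y) g +
      (show C_c(G, B) from z) g) ∂μ = _
    simp_rw [mul_add]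
    exact integral_add (PreL2.integrable_star_mul μ (show C_c(G, B) from x) _)
      (PreL2.integrable_star_mul μ (show C_c(G, B) from x) _)
  inner_self_nonneg {x} := by
    change 0 ≤ ∫ g, star ((show C_c(G, B) from x) g) * (show C_c(G, B) from x) g ∂μ
    exact integral_nonneg fun g => star_mul_self_nonneg _
  inner_self {x} := by
    constructor
    · intro h
      exact PreL2.eq_zero_of_integral μ (show C_c(G, B) from x) (congrArg MulOpposite.unop h)
    · rintro rfl
      apply MulOpposite.unop_injective
      change ∫ g, star ((0 : C_c(G, B)) g) * (0 : C_c(G, B)) g ∂μ = 0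
      simp
  inner_op_smul_right {a x y} := by
    apply MulOpposite.unop_injective
    change ∫ g, star ((show C_c(G, B) from x) g) * ((show C_c(G, B) from y) g * a.unop) ∂μ =
      (∫ g, star ((show C_c(G, B) from x) g) * (show C_c(G, B) from y) g ∂μ) * a.unop
    simp_rw [← mul_assoc]
    exact (((ContinuousLinearMap.mul ℂ B).flip a.unop).integral_comp_comm
      (PreL2.integrable_star_mul μ (show C_c(G, B) from x) (show C_c(G, B) from y)))
  inner_smul_right_complex {z x y} := by
    apply MulOpposite.unop_injective
    change ∫ g, star ((show C_c(G, B) from x) g) * (z • (show C_c(G, B) from y) g) ∂μ =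
      z • ∫ g, star ((show C_c(G, B) from x) g) * (show C_c(G, B) from y) g ∂μ
    simp_rw [mul_smul_comm]
    exact integral_smul z _
  star_inner x y := by
    apply MulOpposite.unop_injective
    change star (∫ g, star ((show C_c(G, B) from x) g) * (show C_c(G, B) from y) g ∂μ) =
      ∫ g, star ((show C_c(G, B) from y) g) * (show C_c(G, B) from x) g ∂μ
    refine ((starL' ℝ : B ≃L[ℝ] B).integral_comp_comm _).symm.trans (integral_congr_ae ?_)
    exact Eventually.of_forall fun g => by simp
  norm_eq_sqrt_norm_inner_self _ := rfl

instance : NormedAddCommGroup (PreL2 μ B) := CStarModule.normedAddCommGroup Bᵐᵒᵖ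

instance : NormedSpace ℂ (PreL2 μ B) := .ofCore (CStarModule.normedSpaceCore Bᵐᵒᵖ)

/-- `L²(G, B)`, the completion of `C_c(G, B)`. -/
abbrev L2 : Type _ := UniformSpace.Completion (PreL2 μ B)

variable {B}

/-- The inclusion of `C_c(G, B)` in `L²(G, B)`. -/
def toL2 (f : C_c(G, B)) : L2 μ B := ((show PreL2 μ B from f : PreL2 μ B) : L2 μ B)

/-- Pointwise product of a scalar cutoff function and a continuous function. -/
def cutoff (χ : C_c(G, ℝ)) (f : C(G, B)) : C_c(G, B) where
  toFun g := χ g • f g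
  continuous_toFun := by fun_prop
  hasCompactSupport' := χ.hasCompactSupport.smul_right

variable (G) in
/-- The filter of continuous compactly supported functions `χ : G → [0,1]` that converge to `1`
uniformly on compact subsets. -/
def cutoffFilter : Filter C_c(G, ℝ) :=
  comap (fun χ => (χ : C(G, ℝ))) (𝓝 1) ⊓ 𝓟 {χ | ∀ g, χ g ∈ Set.Icc (0 : ℝ) 1}

/-- A continuous function `f : G → B` is square-integrable if `χ·f` converges in `L²(G, B)` as
`χ → 1`. -/
def IsSquareIntegrable (f : C(G, B)) : Prop :=
  ∃ F : L2 μ B, Tendsto (fun χ => toL2 μ (cutoff χ f)) (cutoffFilter G) (𝓝 F)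

/-- The element of `L²(G, B)` defined by a square-integrable continuous function. -/
def l2Limit (f : C(G, B)) : L2 μ B :=
  limUnder (cutoffFilter G) fun χ => toL2 μ (cutoff χ f)

/-! ## The reduced crossed product -/

/-- The function `(ρ_K f)(g) = ∫ β_g(K(g⁻¹ g₂)) f(g₂) dg₂`. -/
def rho (β : GCStarAction G B) (K f : C_c(G, B)) : C_c(G, B) where
  toFun g := ∫ g₂, β g (K (g⁻¹ * g₂)) * f g₂ ∂μ
  continuous_toFun := by
    rw [← continuousOn_univ]
    refine continuousOn_integral_of_compact_support (f := fun g g₂ => β g (K (g⁻¹ * g₂)) * f g₂)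
      f.hasCompactSupport.isCompact ?_ ?_
    · refine Continuous.continuousOn ?_
      have : Continuous fun x : G × G => β x.1 (K (x.1⁻¹ * x.2)) :=
        β.continuous_uncurry.comp (f := fun x : G × G => (x.1, K (x.1⁻¹ * x.2))) (by fun_prop)
      exact this.mul (f.continuous.comp continuous_snd)
    · intro g g₂ _ h
      simp [image_eq_zero_of_notMem_tsupport h]
  hasCompactSupport' := by
    refine HasCompactSupport.intro (((f.hasCompactSupport.isCompact.prod
      K.hasCompactSupport.isCompact).image (f := fun x : G × G => x.1 * x.2⁻¹) (by fun_prop))) ?_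
    intro g hg
    refine integral_eq_zero_of_ae (Eventually.of_forall fun g₂ => ?_)
    by_cases h₂ : g₂ ∈ tsupport f
    · have : g⁻¹ * g₂ ∉ tsupport K := fun h => hg
        ⟨(g₂, g⁻¹ * g₂), ⟨h₂, h⟩, by simp⟩
      simp [image_eq_zero_of_notMem_tsupport this]
    · simp [image_eq_zero_of_notMem_tsupport h₂]

/-- The reduced crossed product, that is, the operator norm closure of the set of bounded operators
on `L²(G, B)` of the form `ρ_K` with `K ∈ C_c(G, B)`. -/
def reducedCrossedProduct (β : GCStarAction G B) : Set (L2 μ B →L[ℂ] L2 μ B) :=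
  closure {T | ∃ K : C_c(G, B), ∀ f : C_c(G, B), T (toL2 μ f) = toL2 μ (rho μ β K f)}

end

end L2

/-! ## Square-integrable elements and relatively continuous subsets -/

namespace HilbertGAction

variable {G B E : Type*} [Group G] [TopologicalSpace G] [IsTopologicalGroup G]
  [MeasurableSpace G] [BorelSpace G] [NonUnitalCStarAlgebra B] [PartialOrder B]
  [StarOrderedRing B] [NormedAddCommGroup E] [NormedSpace ℂ E] [SMul Bᵐᵒᵖ E] [CStarModule Bᵐᵒᵖ E]
  {β : GCStarAction G B} (γ : HilbertGAction β E)

/-- The continuous function `⟨⟨ξ| η : g ↦ ⟨γ_g ξ|η⟩`. -/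
def bra (ξ η : E) : C(G, B) where
  toFun g := hinner B (γ g ξ) η
  continuous_toFun := by
    have h : Continuous fun g => ((γ g ξ, η) : E × E) := (γ.continuous_apply ξ).prodMk continuous_const
    exact MulOpposite.continuous_unop.comp ((CStarModule.continuous_inner (A := Bᵐᵒᵖ)).comp h)

/-- The function `g ↦ ⟨ξ|γ_g η⟩`, the symbol of the operator `⟨⟨ξ|η⟩⟩`. -/
def symbol (ξ η : E) (g : G) : B := hinner B ξ (γ g η)

variable (μ : Measure G)

noncomputable section

/-- `|ξ⟩⟩ f = ∫ γ_g(ξ) · f(g) dg` for `f ∈ C_c(G, B)`. -/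
def ket (ξ : E) (f : C_c(G, B)) : E := ∫ g, γ g ξ <• f g ∂μ

/-- The right module structure `ξ ∗ K = ∫ γ_g(ξ · K(g⁻¹)) dg` over `C_c(G, B)`. -/
def conv (ξ : E) (K : C_c(G, B)) : E := ∫ g, γ g (ξ <• K g⁻¹) ∂μ

variable [μ.IsHaarMeasure]

/-- `E_si`, the set of all `ξ` such that `⟨⟨ξ| η ∈ L²(G, B)` for all `η ∈ E`. -/
def squareIntegrable : Set E := {ξ | ∀ η, IsSquareIntegrable μ (γ.bra ξ η)}

open Classical in
/-- The bounded operator `|ξ⟩⟩ : L²(G, B) → E` that extends `γ.ket μ ξ`.  It exists for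
`ξ ∈ E_si`; it is unique because `C_c(G, B)` is dense in `L²(G, B)`. -/
def ketOp (ξ : E) : L2 μ B →L[ℂ] E :=
  if h : ∃ T : L2 μ B →L[ℂ] E, ∀ f : C_c(G, B), T (toL2 μ f) = γ.ket μ ξ f then h.choose else 0

/-- The operator `⟨⟨ξ| : E → L²(G, B)` for `ξ ∈ E_si`. -/
def braOp (ξ η : E) : L2 μ B := l2Limit μ (γ.bra ξ η)

/-- The operator `⟨⟨ξ|η⟩⟩ = ⟨⟨ξ| ∘ |η⟩⟩` on `L²(G, B)` for `ξ, η ∈ E_si`. -/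
def braket (ξ η : E) (F : L2 μ B) : L2 μ B := γ.braOp μ ξ (γ.ketOp μ η F)

/-- `⟨⟨ξ|η⟩⟩ ∈ C⋆_r(G, B)`. -/
def BraketMemReduced (ξ η : E) : Prop :=
  ∃ T ∈ reducedCrossedProduct μ β, ∀ F, T F = γ.braket μ ξ η F

/-- Relatively continuous subsets of `E`. -/
def IsRelativelyContinuous (R : Set E) : Prop :=
  R ⊆ γ.squareIntegrable μ ∧ ∀ ξ ∈ R, ∀ η ∈ R, γ.BraketMemReduced μ ξ η

/-- The norm `‖ξ‖_si = ‖ξ‖ + ‖|ξ⟩⟩‖` on `E_si`. -/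
def siNorm (ξ : E) : ℝ := ‖ξ‖ + ‖γ.ketOp μ ξ‖

/-- A linear subspace of `E_si` is complete if it is closed in `E_si` for `‖·‖_si` and invariant
under the right action of `C_c(G, B)`. -/
def IsCompleteSubspace (R : Submodule ℂ E) : Prop :=
  (R : Set E) ⊆ γ.squareIntegrable μ ∧
  (∀ ξ ∈ γ.squareIntegrable μ, (∀ ε > 0, ∃ η ∈ R, γ.siNorm μ (ξ - η) < ε) → ξ ∈ R) ∧
  ∀ ξ ∈ R, ∀ K : C_c(G, B), γ.conv μ ξ K ∈ R

/-- The completion of a subset of `E_si`, the smallest complete subspace that contains it. -/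
def completion (R : Set E) : Submodule ℂ E :=
  sInf {S | γ.IsCompleteSubspace μ S ∧ R ⊆ (S : Set E)}

end

end HilbertGAction

/-- `E_cs = E · B_cs`, the set of all products `ξ · b` with `ξ ∈ E` and `b ∈ B_cs`. -/
def moduleCompactPart (B E : Type*) [NonUnitalCStarAlgebra B] [SMul Bᵐᵒᵖ E] : Set E :=
  {x | ∃ ξ : E, ∃ b ∈ compactPart B, x = ξ <• b}

/-! Spectral properness enters through one observation. If ξ ∈ E·B_U and η ∈ E·B_V, then ⟨ξ|γ_g η⟩
lies in B_U ∩ B_{gV}, and this ideal is zero as soon as U and gV are disjoint. For relatively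
quasi-compact U and V this happens for all g outside a compact set that depends only on U and V
(`exists_isCompact_symbol_eq_zero`). So symbols of elements of E_cs have compact support. Schur's
test (`norm_toL2_rho_le`) bounds ρ_K, hence also |ξ⟩⟩, and this makes E_cs square-integrable and
relatively continuous. Because the compact set is uniform, ‖·‖_si is equivalent to the norm of E on
each E·B_U (`exists_siNorm_le`).

Density of E_cs is a statement about B alone. For b ≥ 0 the primitive ideals at which b has norm at
least ε form a quasi-compact set (`isCompact_setOf_le_dist`), so the truncations (b − ε)₊ belong to
B_cs. This compactness needs an irreducible representation that kills a given algebraic ideal and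
keeps b large. It is the GNS representation of an extreme functional found by Hahn–Banach and
Krein–Milman (`exists_irreducibleRep`). Linearity of E_cs comes from the factorization x =
y·⟨x|x⟩^{1/4} (`exists_rmul_eq_of_hinner_self_mem`).

Uniqueness has two halves. Suppose first that T = ⟨⟨ξ|ξ⟩⟩ lies in the reduced crossed product. For K
= φ ⊗ b, with φ a small bump and b ∈ B_cs nearly a unit, Tρ_K is close to T
(`exists_norm_sub_comp_rhoOp_lt`), and then ξ∗K is close to ξ in ‖·‖_si by
`norm_ketOp_sub_conv_sq_le`. But ξ∗K is an average of translates of ξ·b, so it lies in E_cs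
(`exists_conv_mem_moduleCompactPart`). Hence every such ξ lies in the completion of E_cs, and only
the diagonal operator ⟨⟨ξ|ξ⟩⟩ was used.

Conversely, let R be dense and complete. For ξ ∈ R and b ∈ B_cs, the elements ξ∗(φ ⊗ b) of R tend to
ξ·b in norm within a single E·B_W, hence in ‖·‖_si, so ξ·b ∈ R. Density of R, again inside one
E·B_U, yields E_cs ⊆ R (`moduleCompactPart_subset_of_dense`). Finally, completions of relatively
continuous sets stay relatively continuous (`IsRelativelyContinuous.completion`), so the completion
of E_cs has all the required properties. -/

set_option linter.unusedSectionVars false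

/-! ### Positive functionals that vanish on an algebraic ideal: Hahn–Banach and Krein–Milman. -/

section SublinearGauge

variable {B : Type*} [NonUnitalCStarAlgebra B] [PartialOrder B] [StarOrderedRing B]

open scoped ComplexStarModule in
/-- The norms of the positive elements that dominate the real part of `x` modulo `J`. -/
def majorantNorms (J : Submodule ℂ B) (x : B) : Set ℝ :=
  {r | ∃ y : B, 0 ≤ y ∧ ‖y‖ = r ∧ ∃ j ∈ J, IsSelfAdjoint j ∧ (ℜ x : B) ≤ y + j}

/-- The sublinear functional whose linear minorants are the real parts of positive contractive
functionals that vanish on the self-adjoint elements of `J`. -/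
noncomputable def majorantGauge (J : Submodule ℂ B) (x : B) : ℝ := sInf (majorantNorms J x)

theorem majorantNorms_nonneg {J : Submodule ℂ B} {x : B} {r : ℝ} (h : r ∈ majorantNorms J x) :
    0 ≤ r := by
  obtain ⟨y, -, rfl, -⟩ := h
  exact norm_nonneg y

theorem bddBelow_majorantNorms (J : Submodule ℂ B) (x : B) : BddBelow (majorantNorms J x) :=
  ⟨0, fun _ h => majorantNorms_nonneg h⟩

open scoped ComplexStarModule in
theorem norm_posPart_mem_majorantNorms (J : Submodule ℂ B) (x : B) :
    ‖(ℜ x : B)⁺‖ ∈ majorantNorms J x := by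
  refine ⟨_, CFC.posPart_nonneg _, rfl, 0, J.zero_mem, .zero _, ?_⟩
  rw [add_zero]
  have h := CFC.posPart_sub_negPart (ℜ x : B) (ℜ x).2
  have h' := CFC.negPart_nonneg (ℜ x : B)
  calc (ℜ x : B) = (ℜ x : B)⁺ - (ℜ x : B)⁻ := h.symm
    _ ≤ (ℜ x : B)⁺ := sub_le_self _ h'

open scoped ComplexStarModule in
theorem majorantGauge_le_norm (J : Submodule ℂ B) (x : B) : majorantGauge J x ≤ ‖x‖ :=
  (csInf_le (bddBelow_majorantNorms J x) (norm_posPart_mem_majorantNorms J x)).trans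
    ((CStarAlgebra.norm_posPart_le _).trans (realPart.norm_le x))

theorem majorantGauge_smul (J : Submodule ℂ B) (c : ℝ) (hc : 0 < c) (x : B) :
    majorantGauge J (c • x) = c * majorantGauge J x := by
  have key : ∀ (c : ℝ) (_ : 0 < c) (x : B), majorantGauge J (c • x) ≤ c * majorantGauge J x := by
    intro c hc x
    rw [majorantGauge, majorantGauge, ← smul_eq_mul, ← Real.sInf_smul_of_nonneg hc.le]
    refine csInf_le_csInf (bddBelow_majorantNorms J _)
      (Set.Nonempty.smul_set ⟨_, norm_posPart_mem_majorantNorms J x⟩) ?_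
    rintro _ ⟨_, ⟨y, hy, rfl, j, hj, hj', h⟩, rfl⟩
    refine ⟨c • y, smul_nonneg hc.le hy, by simp [norm_smul, abs_of_pos hc], c • j, ?_, ?_, ?_⟩
    · have := J.smul_mem (c : ℂ) hj
      rwa [Complex.coe_smul] at this
    · exact (IsSelfAdjoint.all c).smul hj'
    · rw [← smul_add]
      simpa using smul_le_smul_of_nonneg_left h hc.le
  refine le_antisymm (key c hc x) ?_
  have := key c⁻¹ (inv_pos.2 hc) (c • x)
  rw [smul_smul, inv_mul_cancel₀ hc.ne', one_smul] at this
  calc c * majorantGauge J x ≤ c * (c⁻¹ * majorantGauge J (c • x)) := by gcongr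
    _ = majorantGauge J (c • x) := by field_simp

theorem majorantGauge_add (J : Submodule ℂ B) (x y : B) :
    majorantGauge J (x + y) ≤ majorantGauge J x + majorantGauge J y := by
  have hx : (majorantNorms J x).Nonempty := ⟨_, norm_posPart_mem_majorantNorms J x⟩
  have hy : (majorantNorms J y).Nonempty := ⟨_, norm_posPart_mem_majorantNorms J y⟩
  refine le_of_forall_pos_le_add fun ε hε => ?_
  obtain ⟨_, ⟨a, ha, rfl, j, hj, hj', h⟩, hr⟩ := exists_lt_of_csInf_lt hx
    (lt_add_of_pos_right (majorantGauge J x) (half_pos hε))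
  obtain ⟨_, ⟨b, hb, rfl, k, hk, hk', h'⟩, hs⟩ := exists_lt_of_csInf_lt hy
    (lt_add_of_pos_right (majorantGauge J y) (half_pos hε))
  have : ‖a + b‖ ∈ majorantNorms J (x + y) := by
    refine ⟨_, add_nonneg ha hb, rfl, j + k, J.add_mem hj hk, hj'.add hk', ?_⟩
    rw [map_add, AddSubgroup.coe_add, add_add_add_comm]
    exact add_le_add h h'
  have h1 := csInf_le (bddBelow_majorantNorms J (x + y)) this
  have h2 := norm_add_le a b
  change majorantGauge J (x + y) ≤ _ at h1
  linarith

/-- Modulo small elements, a self-adjoint element of an algebraic ideal is cut off by an element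
`e` of that ideal. -/
theorem exists_cutoff_of_mem_ideal {j : B} (hj : IsSelfAdjoint j) {δ : ℝ} (hδ : 0 < δ) :
    ∃ k : B, IsSelfAdjoint (j * k) ∧ ‖(1 - (j * k : B) : Unitization ℂ B)‖ ≤ 1 ∧
      ‖((1 - (j * k : B)) * j * (1 - (j * k : B)) : Unitization ℂ B)‖ ≤ δ := by
  -- With k = f(j), the element 1 − jk is the function δ²/(δ² + t²) of j. It has values in (0, 1],
  -- and its product with |t| is at most δ. Since jk is a multiple of j, it stays in any algebraic
  -- ideal that contains j.
  set f : ℝ → ℝ := fun t => t / (δ ^ 2 + t ^ 2) with hf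
  have hpos : ∀ t : ℝ, 0 < δ ^ 2 + t ^ 2 := fun t => by positivity
  have hfc : Continuous f := by
    refine continuous_id.div (by fun_prop) fun t => (hpos t).ne'
  have hjB : IsSelfAdjoint (j : Unitization ℂ B) := by
    rw [IsSelfAdjoint, ← Unitization.inr_star, hj.star_eq]
  set k := cfcₙ f j with hk
  have hkB : (k : Unitization ℂ B) = cfc f (j : Unitization ℂ B) :=
    Unitization.real_cfcₙ_eq_cfc_inr j f (by simp [hf])
  have h1 : ((j * k : B) : Unitization ℂ B) = cfc (fun t => t * f t) (j : Unitization ℂ B) := by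
    rw [Unitization.inr_mul, hkB, cfc_mul (fun t => t) f, cfc_id' ℝ (j : Unitization ℂ B)]
  have h2 : (1 - (j * k : B) : Unitization ℂ B) =
      cfc (fun t => 1 - t * f t) (j : Unitization ℂ B) := by
    rw [h1, cfc_sub (fun _ => (1 : ℝ)) (fun t => t * f t), cfc_const_one ℝ (j : Unitization ℂ B)]
  have hg : ∀ t, 1 - t * f t = δ ^ 2 / (δ ^ 2 + t ^ 2) := fun t => by
    have := hpos t
    simp only [hf]; field_simp; ring
  refine ⟨k, ?_, ?_, ?_⟩
  · have hc : Commute j k := by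
      have := cfcₙ_commute_cfcₙ (R := ℝ) id f j
      rwa [cfcₙ_id ℝ j] at this
    exact (hj.commute_iff (cfcₙ_predicate f j)).1 hc
  · rw [h2]
    refine norm_cfc_le zero_le_one fun t _ => ?_
    rw [hg, Real.norm_of_nonneg (by positivity), div_le_one (hpos t)]
    nlinarith [sq_nonneg t]
  · have h3 : ((1 - (j * k : B)) * j * (1 - (j * k : B)) : Unitization ℂ B) =
        cfc (fun t => (1 - t * f t) * t * (1 - t * f t)) (j : Unitization ℂ B) := by
      rw [cfc_mul (fun t => (1 - t * f t) * t) (fun t => 1 - t * f t),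
        cfc_mul (fun t => 1 - t * f t) (fun t => t), cfc_id' ℝ (j : Unitization ℂ B), h2]
    rw [h3]
    refine norm_cfc_le hδ.le fun t _ => ?_
    rw [hg, Real.norm_eq_abs, abs_mul, abs_mul, abs_of_pos (by positivity)]
    have hle : δ ^ 2 / (δ ^ 2 + t ^ 2) ≤ 1 := by
      rw [div_le_one (hpos t)]; nlinarith [sq_nonneg t]
    have h4 : δ ^ 2 / (δ ^ 2 + t ^ 2) * |t| ≤ δ := by
      rw [div_mul_eq_mul_div, div_le_iff₀ (hpos t), ← sq_abs t]
      nlinarith [mul_nonneg hδ.le (sq_nonneg (δ - |t|)),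
        mul_nonneg (mul_pos hδ hδ).le (abs_nonneg t), mul_nonneg hδ.le (sq_nonneg |t|),
        mul_pos hδ (mul_pos hδ hδ)]
    calc _ ≤ δ * 1 := by gcongr
      _ = δ := mul_one δ

/-- If b ≤ y + j, conjugate by u = 1 − e with e ∈ J chosen so that ‖u‖ ≤ 1 and uju is small. Then
ubu is congruent to b modulo J and is dominated by uyu + uju, so its norm is at least ε and at most
‖y‖ + δ. The ideal J need not be closed, which matters when J is a union of ideals. -/
theorem le_majorantGauge {J : Submodule ℂ B} (hl : ∀ a, ∀ x ∈ J, a * x ∈ J)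
    (hr : ∀ a, ∀ x ∈ J, x * a ∈ J) {b : B} (hb : 0 ≤ b) {ε : ℝ} (h : ∀ x ∈ J, ε ≤ ‖b - x‖) :
    ε ≤ majorantGauge J b := by
  refine le_csInf ⟨_, norm_posPart_mem_majorantNorms J b⟩ ?_
  rintro _ ⟨y, hy, rfl, j, hj, hj', hle⟩
  rw [(IsSelfAdjoint.of_nonneg hb).coe_realPart] at hle
  refine le_of_forall_pos_le_add fun δ hδ => ?_
  obtain ⟨k, hk, h1, h2⟩ := exists_cutoff_of_mem_ideal hj' hδ
  set e := j * k with he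
  have heJ : e ∈ J := hr k j hj
  set u : Unitization ℂ B := 1 - (e : Unitization ℂ B) with hu
  have hus : star u = u := by
    rw [hu, star_sub, star_one, ← Unitization.inr_star, hk.star_eq]
  have h3 : u * (b : Unitization ℂ B) * u =
      ((b - (e * b + b * e - e * b * e) : B) : Unitization ℂ B) := by
    simp only [hu, Unitization.inr_sub, Unitization.inr_add, Unitization.inr_mul]
    noncomm_ring
  have hle' : (b : Unitization ℂ B) ≤ ((y + j : B) : Unitization ℂ B) :=
    (Unitization.inr_le_iff _ _ (.of_nonneg hb) ((IsSelfAdjoint.of_nonneg hy).add hj')).2 hle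
  have h4 : u * (b : Unitization ℂ B) * u ≤ u * ((y + j : B) : Unitization ℂ B) * u := by
    have := star_left_conjugate_le_conjugate hle' u
    rwa [hus] at this
  have h5 : 0 ≤ u * (b : Unitization ℂ B) * u := by
    have := star_left_conjugate_nonneg (Unitization.inr_nonneg_iff.2 hb) u
    rwa [hus] at this
  calc ε ≤ ‖b - (e * b + b * e - e * b * e)‖ := h _ (J.sub_mem (J.add_mem (hr _ _ heJ)
        (hl _ _ heJ)) (hr _ _ (hr _ _ heJ)))
    _ = ‖u * (b : Unitization ℂ B) * u‖ := by rw [h3, Unitization.norm_inr]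
    _ ≤ ‖u * ((y + j : B) : Unitization ℂ B) * u‖ :=
        CStarAlgebra.norm_le_norm_of_nonneg_of_le h5 h4
    _ = ‖u * (y : Unitization ℂ B) * u + u * (j : Unitization ℂ B) * u‖ := by
        rw [Unitization.inr_add, mul_add, add_mul]
    _ ≤ 1 * ‖y‖ * 1 + δ := by
        refine (norm_add_le _ _).trans (add_le_add ?_ h2)
        refine (norm_mul_le _ _).trans ?_
        refine mul_le_mul ((norm_mul_le _ _).trans ?_) h1 (norm_nonneg _) (by positivity)
        rw [Unitization.norm_inr]
        gcongr
    _ = ‖y‖ + δ := by ring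

/-- The linear functionals dominated by `majorantGauge J`. -/
def gaugeFunctionals (J : Submodule ℂ B) : Set (B → ℝ) :=
  {g | (∀ x y, g (x + y) = g x + g y) ∧ (∀ (c : ℝ) x, g (c • x) = c * g x) ∧
    ∀ x, g x ≤ majorantGauge J x}

theorem gaugeFunctionals_isClosed (J : Submodule ℂ B) : IsClosed (gaugeFunctionals J) := by
  have : gaugeFunctionals J = (⋂ x, ⋂ y, {g | g (x + y) = g x + g y}) ∩
      ((⋂ c : ℝ, ⋂ x, {g | g (c • x) = c * g x}) ∩ ⋂ x, {g | g x ≤ majorantGauge J x}) := by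
    ext g; simp [gaugeFunctionals]
  rw [this]
  refine (isClosed_iInter fun x => isClosed_iInter fun y => isClosed_eq (by fun_prop)
    (by fun_prop)).inter ((isClosed_iInter fun c => isClosed_iInter fun x =>
    isClosed_eq (by fun_prop) (by fun_prop)).inter (isClosed_iInter fun x =>
    isClosed_le (by fun_prop) (by fun_prop)))

theorem gaugeFunctionals_abs_le {J : Submodule ℂ B} {g : B → ℝ} (hg : g ∈ gaugeFunctionals J)
    (x : B) : |g x| ≤ ‖x‖ := by
  have h : ∀ x, g x ≤ ‖x‖ := fun x => (hg.2.2 x).trans (majorantGauge_le_norm J x)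
  refine abs_le.2 ⟨?_, h x⟩
  have := h (-x)
  rw [norm_neg, ← neg_one_smul ℝ, hg.2.1] at this
  linarith

/-- The Banach–Alaoglu argument in the product topology on B → ℝ. -/
theorem gaugeFunctionals_isCompact (J : Submodule ℂ B) : IsCompact (gaugeFunctionals J) := by
  refine (isCompact_univ_pi fun x : B => isCompact_Icc (a := -‖x‖) (b := ‖x‖)).of_isClosed_subset
    (gaugeFunctionals_isClosed J) fun g hg x _ => ?_
  exact abs_le.1 (gaugeFunctionals_abs_le hg x)

/-- Hahn–Banach extends c·b ↦ c · `majorantGauge J b` from the real line through b. Domination on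
that line is homogeneity for c > 0, and for c ≤ 0 it is automatic because the gauge is nonnegative.
-/
theorem exists_gaugeFunctional_eq (J : Submodule ℂ B) {b : B} (hb : 0 ≤ b) :
    ∃ g ∈ gaugeFunctionals J, g b = majorantGauge J b := by
  by_cases hb0 : b = 0
  · subst hb0
    have hz : majorantGauge J (0 : B) = 0 := by
      refine le_antisymm (by simpa using majorantGauge_le_norm J (0 : B)) ?_
      exact Real.sInf_nonneg fun _ h => majorantNorms_nonneg h
    refine ⟨0, ⟨by simp, by simp, fun x => ?_⟩, by simp [hz]⟩
    exact Real.sInf_nonneg fun _ h => majorantNorms_nonneg h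
  have hz : ∀ c : ℝ, c • b = 0 → (RingHom.id ℝ) c • majorantGauge J b = 0 := fun c hc => by
    rw [(smul_eq_zero.1 hc).resolve_right hb0, map_zero, zero_smul]
  obtain ⟨g, hg, hg'⟩ := exists_extension_of_le_sublinear
    (LinearPMap.mkSpanSingleton (K := ℝ) b (majorantGauge J b) hb0) (majorantGauge J)
    (majorantGauge_smul J) (majorantGauge_add J) (by
      rintro ⟨x, hx⟩
      obtain ⟨c, rfl⟩ := Submodule.mem_span_singleton.1 hx
      have e := LinearPMap.mkSpanSingleton'_apply b (majorantGauge J b)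
        hz c hx
      refine e.trans_le ?_
      rw [smul_eq_mul]
      rcases lt_or_ge 0 c with hc | hc
      · exact (majorantGauge_smul J c hc b).ge
      · exact (mul_nonpos_of_nonpos_of_nonneg hc
          (Real.sInf_nonneg fun _ h => majorantNorms_nonneg h)).trans
          (Real.sInf_nonneg fun _ h => majorantNorms_nonneg h))
  refine ⟨g, ⟨map_add g, fun c x => by simp, hg'⟩, ?_⟩
  have := hg ⟨b, Submodule.mem_span_singleton_self b⟩
  refine this.trans ?_
  have e := LinearPMap.mkSpanSingleton'_apply b (majorantGauge J b)
    hz (1 : ℝ)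
    (by rw [one_smul]; exact Submodule.mem_span_singleton_self b)
  simp only [one_smul] at e
  exact e.trans (one_smul ℝ _)

/-- By Krein and Milman, there is an extreme functional in `gaugeFunctionals J` that attains the
value `majorantGauge J b` at `b`. -/
theorem exists_extreme_gaugeFunctional (J : Submodule ℂ B) {b : B} (hb : 0 ≤ b) :
    ∃ g ∈ Set.extremePoints ℝ (gaugeFunctionals J), g b = majorantGauge J b := by
  have hne := exists_gaugeFunctional_eq J hb
  -- The gauge is the largest value at b, so this set is a face: its extreme points are extreme
  -- among all gauge functionals.
  have hc : IsCompact (gaugeFunctionals J ∩ {g | g b = majorantGauge J b}) :=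
    (gaugeFunctionals_isCompact J).inter_right (isClosed_eq (by fun_prop) (by fun_prop))
  obtain ⟨g, hg⟩ := hc.extremePoints_nonempty hne
  refine ⟨g, ?_, hg.1.2⟩
  refine mem_extremePoints.2 ⟨hg.1.1, fun g₁ h₁ g₂ h₂ hseg => ?_⟩
  have h := hseg
  obtain ⟨s, t, hs, ht, hst, he⟩ := h
  have hgb : g b = majorantGauge J b := hg.1.2
  have e : s * g₁ b + t * g₂ b = majorantGauge J b := by
    rw [← hgb, ← he]; simp
  have i₁ := h₁.2.2 b
  have i₂ := h₂.2.2 b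
  have t₁ : g₁ b = majorantGauge J b := by
    refine le_antisymm i₁ ?_
    by_contra! hlt
    have e' : s * majorantGauge J b + t * majorantGauge J b = majorantGauge J b := by
      rw [← add_mul, hst, one_mul]
    linarith [mul_lt_mul_of_pos_left hlt hs, mul_le_mul_of_nonneg_left i₂ ht.le]
  have t₂ : g₂ b = majorantGauge J b := by
    refine le_antisymm i₂ ?_
    by_contra! hlt
    have e' : s * majorantGauge J b + t * majorantGauge J b = majorantGauge J b := by
      rw [← add_mul, hst, one_mul]
    linarith [mul_lt_mul_of_pos_left hlt ht, mul_le_mul_of_nonneg_left i₁ hs.le]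
  exact (mem_extremePoints.1 hg).2 g₁ ⟨h₁, t₁⟩ g₂ ⟨h₂, t₂⟩ hseg

end SublinearGauge

/-! ### Irreducible representations from extreme functionals. -/

section GNS

open scoped ComplexOrder InnerProductSpace
open UniformSpace

variable {B : Type*} [NonUnitalCStarAlgebra B] [PartialOrder B] [StarOrderedRing B]

/-- Cauchy–Schwarz against an approximate unit e: its GNS seminorm is at most 1 and φ(ex) tends to
φ(x). This is what allows φ itself to descend to the GNS space. -/
theorem PositiveLinearMap.norm_apply_le_norm_toPreGNS (φ : B →ₚ[ℂ] ℂ)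
    (h : ∀ x, 0 ≤ x → (φ x).re ≤ ‖x‖) (x : B) : ‖φ x‖ ≤ ‖φ.toPreGNS x‖ := by
  have hu := CStarAlgebra.increasingApproximateUnit B
  have : (CStarAlgebra.approximateUnit B).NeBot := hu.neBot
  have hφ : Continuous φ := map_continuous φ
  have h1 : Tendsto (fun e => ‖φ (e * x)‖) (CStarAlgebra.approximateUnit B) (𝓝 ‖φ x‖) :=
    (hφ.norm.tendsto x).comp (hu.tendsto_mul_right x)
  refine le_of_tendsto h1 ?_
  filter_upwards [hu.eventually_star_eq, hu.eventually_norm] with e he he1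
  have h2 : ‖φ.toPreGNS e‖ ≤ 1 := by
    rw [PositiveLinearMap.preGNS_norm_def, Real.sqrt_le_iff, one_pow]
    refine ⟨zero_le_one, (h _ (star_mul_self_nonneg _)).trans ?_⟩
    rw [CStarRing.norm_star_mul_self]
    exact mul_le_one₀ he1 (norm_nonneg _) he1
  have h3 := norm_inner_le_norm (𝕜 := ℂ) (φ.toPreGNS e) (φ.toPreGNS x)
  rw [PositiveLinearMap.preGNS_inner_def] at h3
  simp only [PositiveLinearMap.ofPreGNS_toPreGNS, he] at h3
  exact h3.trans (mul_le_of_le_one_left (norm_nonneg _) h2)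

/-- The canonical cyclic vector of the GNS representation of a contractive positive functional. -/
theorem PositiveLinearMap.exists_cyclic_vector (φ : B →ₚ[ℂ] ℂ)
    (h : ∀ x, 0 ≤ x → (φ x).re ≤ ‖x‖) :
    ∃ Ω : φ.GNS, ‖Ω‖ ≤ 1 ∧ (∀ x, φ.gnsNonUnitalStarAlgHom x Ω = (φ.toPreGNS x : φ.GNS)) ∧
      ∀ x, ⟪Ω, φ.gnsNonUnitalStarAlgHom x Ω⟫_ℂ = φ x := by
  let ℓ : φ.PreGNS →L[ℂ] ℂ := (φ.toLinearMap ∘ₗ φ.ofPreGNS.toLinearMap).mkContinuous 1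
    fun x => by
      rw [one_mul]
      exact φ.norm_apply_le_norm_toPreGNS h (φ.ofPreGNS x)
  let L : φ.GNS →L[ℂ] ℂ := ℓ.extend (Completion.toComplL (𝕜 := ℂ) (E := φ.PreGNS))
  have hL : ∀ x : B, L (φ.toPreGNS x : φ.GNS) = φ x := fun x =>
    ContinuousLinearMap.extend_eq ℓ Completion.denseRange_coe
      (Completion.isUniformInducing_coe _) (φ.toPreGNS x)
  -- B need not have a unit, so the cyclic vector is obtained as the Riesz representative of φ.
  let Ω : φ.GNS := (InnerProductSpace.toDual ℂ φ.GNS).symm L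
  have hΩ : ∀ y, ⟪Ω, y⟫_ℂ = L y := fun y => InnerProductSpace.toDual_symm_apply
  have hcyc : ∀ x, φ.gnsNonUnitalStarAlgHom x Ω = (φ.toPreGNS x : φ.GNS) := by
    intro x
    have hd : Dense (Set.range ((↑) : φ.PreGNS → φ.GNS)) := Completion.denseRange_coe
    refine hd.eq_of_inner_right (𝕜 := ℂ) ?_
    rintro _ ⟨y, rfl⟩
    rw [← ContinuousLinearMap.adjoint_inner_left, ← ContinuousLinearMap.star_eq_adjoint,
      ← map_star, φ.gnsNonUnitalStarAlgHom_apply_coe, ← inner_conj_symm, hΩ,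
      Completion.inner_coe, φ.leftMulMapPreGNS_apply, hL, φ.preGNS_inner_def]
    rw [← Complex.star_def, ← map_star φ]
    simp
  refine ⟨Ω, ?_, hcyc, fun x => by rw [hcyc, hΩ, hL]⟩
  rw [show ‖Ω‖ = ‖L‖ from LinearIsometryEquiv.norm_map _ _]
  refine ContinuousLinearMap.opNorm_le_bound _ zero_le_one fun y => ?_
  induction y using Completion.induction_on with
  | hp => exact isClosed_le (by fun_prop) (by fun_prop)
  | ih y =>
    rw [one_mul, Completion.norm_coe]
    exact (congrArg norm (hL (φ.ofPreGNS y))).trans_le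
      (φ.norm_apply_le_norm_toPreGNS h (φ.ofPreGNS y))

/-- Here y = 0 is an admissible majorant. Applied to x and −x, this yields positivity of g and its
vanishing on elements with real part in J. -/
theorem gaugeFunctional_nonpos {J : Submodule ℂ B} {g : B → ℝ} (hg : g ∈ gaugeFunctionals J)
    {x j : B} (hj : j ∈ J) (hj' : IsSelfAdjoint j) (h : (realPart x : B) ≤ j) : g x ≤ 0 := by
  refine (hg.2.2 x).trans (csInf_le (bddBelow_majorantNorms J x)
    ⟨0, le_rfl, norm_zero, j, hj, hj', by rwa [zero_add]⟩)

theorem gaugeFunctional_neg {J : Submodule ℂ B} {g : B → ℝ} (hg : g ∈ gaugeFunctionals J)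
    (x : B) : g (-x) = - g x := by
  rw [← neg_one_smul ℝ, hg.2.1, neg_one_mul]

theorem gaugeFunctional_nonneg {J : Submodule ℂ B} {g : B → ℝ} (hg : g ∈ gaugeFunctionals J)
    {x : B} (hx : 0 ≤ x) : 0 ≤ g x := by
  have := gaugeFunctional_nonpos hg (x := -x) J.zero_mem (.zero _) (by
    rw [map_neg, AddSubgroup.coe_neg, (IsSelfAdjoint.of_nonneg hx).coe_realPart]
    exact neg_nonpos.2 hx)
  rw [gaugeFunctional_neg hg] at this
  linarith

theorem gaugeFunctional_eq_zero {J : Submodule ℂ B} {g : B → ℝ} (hg : g ∈ gaugeFunctionals J)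
    {x : B} (hx : (realPart x : B) ∈ J) : g x = 0 := by
  refine le_antisymm (gaugeFunctional_nonpos hg hx (realPart x).2 le_rfl) ?_
  have := gaugeFunctional_nonpos hg (x := -x) (J.neg_mem hx) (realPart x).2.neg
    (by rw [map_neg, AddSubgroup.coe_neg])
  rw [gaugeFunctional_neg hg] at this
  linarith

/-- The positive functional with real part `g`. -/
noncomputable def complexFunctional {J : Submodule ℂ B} {g : B → ℝ}
    (hg : g ∈ gaugeFunctionals J) : B →ₚ[ℂ] ℂ :=
  PositiveLinearMap.mk₀
    { toFun := fun x => (g x : ℂ) - Complex.I * g (Complex.I • x)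
      map_add' := fun x y => by
        rw [smul_add, hg.1, hg.1]; push_cast; ring
      map_smul' := fun z x => by
        have h1 : ∀ (w : ℂ) (y : B), g (w • y) = w.re * g y + w.im * g (Complex.I • y) := by
          intro w y
          have : w • y = w.re • y + w.im • (Complex.I • y) := by
            rw [← Complex.coe_smul w.re, ← Complex.coe_smul w.im, smul_smul, ← add_smul,
              Complex.re_add_im]
          rw [this, hg.1, hg.2.1, hg.2.1]
        have h2 : g (Complex.I • (Complex.I • x)) = - g x := by
          rw [smul_smul, Complex.I_mul_I, neg_one_smul, gaugeFunctional_neg hg]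
        rw [smul_comm Complex.I z, h1 z x, h1 z (Complex.I • x), h2]
        simp only [RingHom.id_apply, smul_eq_mul]
        push_cast
        conv_rhs => rw [← Complex.re_add_im z]
        ring_nf
        rw [Complex.I_sq]
        ring }
    (fun x hx => by
      have h0 : g (Complex.I • x) = 0 := by
        refine gaugeFunctional_eq_zero hg ?_
        rw [realPart_I_smul, (IsSelfAdjoint.of_nonneg hx).imaginaryPart]
        simp
      simp [h0, gaugeFunctional_nonneg hg hx])

theorem complexFunctional_re {J : Submodule ℂ B} {g : B → ℝ}
    (hg : g ∈ gaugeFunctionals J) (x : B) : (complexFunctional hg x).re = g x := by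
  change ((g x : ℂ) - Complex.I * g (Complex.I • x)).re = _
  simp

/-- Vector functionals of representations that vanish on `J` are dominated by `majorantGauge J`. -/
theorem vectorFunctional_mem {J : Submodule ℂ B} {H : Type*} [NormedAddCommGroup H]
    [InnerProductSpace ℂ H] [CompleteSpace H] (π : B →⋆ₙₐ[ℂ] (H →L[ℂ] H))
    (hπ : ∀ x ∈ J, π x = 0) (v : H) {s : ℝ} (hs : 0 < s) (hv : ‖v‖ ^ 2 ≤ s) :
    (fun x => s⁻¹ * (⟪v, π x v⟫_ℂ).re) ∈ gaugeFunctionals J := by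
  refine ⟨fun x y => ?_, fun c x => ?_, fun x => ?_⟩
  · simp [mul_add]
  · have : π (c • x) v = (c : ℂ) • π x v := by
      rw [← Complex.coe_smul c, map_smul]; rfl
    simp only [this, inner_smul_right, Complex.re_ofReal_mul]
    ring
  · refine le_csInf ⟨_, norm_posPart_mem_majorantNorms J x⟩ ?_
    rintro _ ⟨y, hy, rfl, j, hj, hj', hle⟩
    have hpos : ∀ z : B, 0 ≤ z → 0 ≤ (⟪v, π z v⟫_ℂ).re := by
      intro z hz
      obtain ⟨w, rfl⟩ := CStarAlgebra.nonneg_iff_eq_star_mul_self.1 hz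
      rw [map_mul, map_star, ContinuousLinearMap.star_eq_adjoint, mul_apply_eq_comp,
        ContinuousLinearMap.adjoint_inner_right]
      exact inner_self_nonneg (𝕜 := ℂ)
    have hre : (⟪v, π (realPart x : B) v⟫_ℂ).re = (⟪v, π x v⟫_ℂ).re := by
      rw [realPart_apply_coe, ← Complex.coe_smul, map_smul, map_add, map_star,
        smul_apply, add_apply,
        ContinuousLinearMap.star_eq_adjoint, inner_smul_right, inner_add_right,
        ContinuousLinearMap.adjoint_inner_right, Complex.re_ofReal_mul, Complex.add_re,
        ← inner_conj_symm (π x v) v, Complex.conj_re]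
      ring
    have h1 := hpos _ (sub_nonneg.2 hle)
    rw [map_sub, map_add, hπ j hj, add_zero, sub_apply, inner_sub_right,
      Complex.sub_re, hre] at h1
    have h2 : (⟪v, π y v⟫_ℂ).re ≤ ‖y‖ * s := by
      calc (⟪v, π y v⟫_ℂ).re ≤ ‖⟪v, π y v⟫_ℂ‖ := Complex.re_le_norm _
        _ ≤ ‖v‖ * ‖π y v‖ := norm_inner_le_norm _ _
        _ ≤ ‖v‖ * (‖y‖ * ‖v‖) := by
            gcongr
            exact (ContinuousLinearMap.le_opNorm _ _).trans
              (mul_le_mul_of_nonneg_right (NonUnitalStarAlgHom.norm_apply_le π y) (norm_nonneg _))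
        _ = ‖y‖ * ‖v‖ ^ 2 := by ring
        _ ≤ ‖y‖ * s := by gcongr
    rw [inv_mul_le_iff₀ hs]
    linarith

/-- Invariant subspaces of ⋆-representations are reducing. -/
theorem map_starProjection_eq {H : Type*} [NormedAddCommGroup H]
    [InnerProductSpace ℂ H] [CompleteSpace H] (π : B →⋆ₙₐ[ℂ] (H →L[ℂ] H)) (M : Submodule ℂ H)
    [M.HasOrthogonalProjection] (hM : ∀ b, ∀ x ∈ M, π b x ∈ M) (b : B) (x : H) :
    π b (M.starProjection x) = M.starProjection (π b x) := by
  symm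
  refine Submodule.eq_starProjection_of_mem_of_inner_eq_zero
    (hM _ _ (M.starProjection_apply_mem x)) fun w hw => ?_
  rw [← map_sub, ← ContinuousLinearMap.adjoint_inner_right, ← ContinuousLinearMap.star_eq_adjoint,
    ← map_star]
  exact M.starProjection_inner_eq_zero _ _ (hM _ _ hw)

/-- The GNS representation of an extreme functional is irreducible. -/
theorem exists_irreducibleRep.{u} {B : Type u} [NonUnitalCStarAlgebra B] [PartialOrder B]
    [StarOrderedRing B] {J : Submodule ℂ B} (hl : ∀ a, ∀ x ∈ J, a * x ∈ J)
    (hr : ∀ a, ∀ x ∈ J, x * a ∈ J) {b : B} (hb : 0 ≤ b) {ε : ℝ} (hε : 0 < ε)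
    (h : ∀ x ∈ J, ε ≤ ‖b - x‖) :
    ∃ (H : Type u) (_ : NormedAddCommGroup H) (_ : InnerProductSpace ℂ H) (_ : CompleteSpace H)
      (π : B →⋆ₙₐ[ℂ] (H →L[ℂ] H)), IsIrreducibleRep π ∧ (∀ x ∈ J, π x = 0) ∧ ε ≤ ‖π b‖ := by
  obtain ⟨g, hg, hgb⟩ := exists_extreme_gaugeFunctional J hb
  have hgS := hg.1
  set φ := complexFunctional hgS with hφ
  have hφre : ∀ x, (φ x).re = g x := complexFunctional_re hgS
  obtain ⟨Ω, hΩ1, hcyc, hΩφ⟩ := φ.exists_cyclic_vector (fun x _ => by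
    rw [hφre]; exact (hgS.2.2 x).trans (majorantGauge_le_norm J x))
  set π := φ.gnsNonUnitalStarAlgHom with hπdef
  have hdense : Dense (Set.range fun x => π x Ω) := by
    have : (fun x => π x Ω) = fun x => (φ.toPreGNS x : φ.GNS) := funext hcyc
    rw [this]
    exact Completion.denseRange_coe.comp φ.toPreGNS.surjective.denseRange
      (Completion.continuous_coe _)
  have hgπ : ∀ x, g x = (⟪Ω, π x Ω⟫_ℂ).re := fun x => by rw [hΩφ, hφre]
  have hJ0 : ∀ x ∈ J, π x = 0 := by
    intro x hx
    -- The square of the norm of π(xy)Ω is g((xy)⋆(xy)), and the argument lies in J.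
    have h0 : ∀ y, π x (π y Ω) = 0 := by
      intro y
      have h1 : g (star (x * y) * (x * y)) = 0 := by
        refine gaugeFunctional_eq_zero hgS ?_
        rw [(IsSelfAdjoint.star_mul_self _).coe_realPart]
        exact hl _ _ (hr _ _ hx)
      rw [hgπ, map_mul, map_star, ContinuousLinearMap.star_eq_adjoint,
        mul_apply_eq_comp, ContinuousLinearMap.adjoint_inner_right, map_mul,
        mul_apply_eq_comp] at h1
      exact (inner_self_eq_zero (𝕜 := ℂ)).1 (Complex.ext h1 (inner_self_im (𝕜 := ℂ) _))
    refine ContinuousLinearMap.ext fun v => ?_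
    refine congrFun (Continuous.ext_on hdense (by fun_prop) continuous_const
      (f := fun v => π x v) (g := fun _ => 0) ?_) v
    rintro _ ⟨y, rfl⟩
    exact h0 y
  have hπb : ε ≤ ‖π b‖ := by
    calc ε ≤ majorantGauge J b := le_majorantGauge hl hr hb h
      _ = g b := hgb.symm
      _ = (⟪Ω, π b Ω⟫_ℂ).re := hgπ b
      _ ≤ ‖⟪Ω, π b Ω⟫_ℂ‖ := Complex.re_le_norm _
      _ ≤ ‖Ω‖ * ‖π b Ω‖ := norm_inner_le_norm _ _
      _ ≤ ‖Ω‖ * (‖π b‖ * ‖Ω‖) := by gcongr; exact ContinuousLinearMap.le_opNorm _ _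
      _ ≤ 1 * (‖π b‖ * 1) := by gcongr
      _ = ‖π b‖ := by ring
  refine ⟨φ.GNS, inferInstance, inferInstance, inferInstance, π, ⟨?_, ?_⟩, hJ0, hπb⟩
  · intro h0
    rw [h0] at hπb
    simp at hπb
    linarith
  intro M hMc hM
  have : CompleteSpace M := hMc.completeSpace_coe
  set P := M.starProjection with hP
  set v := P Ω with hv
  set w := Ω - P Ω with hw
  have hcomm : ∀ x y, π x (P y) = P (π x y) := map_starProjection_eq π M hM
  have hvw : ‖v‖ ^ 2 + ‖w‖ ^ 2 ≤ 1 := by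
    have h1 : ⟪v, w⟫_ℂ = 0 := Submodule.inner_right_of_mem_orthogonal
      (M.starProjection_apply_mem Ω) (M.sub_starProjection_mem_orthogonal Ω)
    have h2 := norm_add_sq_eq_norm_sq_add_norm_sq_of_inner_eq_zero v w h1
    have h3 : v + w = Ω := by simp [hv, hw]
    rw [h3] at h2
    nlinarith [norm_nonneg Ω]
  set t := ‖v‖ ^ 2 with ht
  -- With P the projection onto M and t = ‖PΩ‖²: if t = 0, then M is orthogonal to the dense orbit
  -- of Ω; if t ≥ 1, then Ω ∈ M. For 0 < t < 1, g would be a proper convex combination of the vector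
  -- functionals of PΩ and Ω − PΩ.
  rcases eq_or_lt_of_le (show 0 ≤ t by positivity) with ht0 | ht0
  · left
    have hv0 : v = 0 := by
      rw [← norm_eq_zero]; exact pow_eq_zero_iff (two_ne_zero) |>.1 ht0.symm
    rw [eq_bot_iff]
    intro m hm
    rw [Submodule.mem_bot]
    refine hdense.eq_zero_of_inner_right (𝕜 := ℂ) ?_
    rintro _ ⟨x, rfl⟩
    rw [← Submodule.starProjection_eq_self_iff.2 hm, ← Submodule.inner_starProjection_left_eq_right,
      ← hcomm, ← hv, hv0, map_zero, inner_zero_left]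
  rcases le_or_gt 1 t with ht1 | ht1
  · right
    have hw0 : w = 0 := by
      have : ‖w‖ ^ 2 ≤ 0 := by linarith
      rw [← norm_eq_zero]
      exact pow_eq_zero_iff two_ne_zero |>.1 (le_antisymm this (by positivity))
    have hΩM : Ω ∈ M := by
      rw [← Submodule.starProjection_eq_self_iff]
      exact (sub_eq_zero.1 hw0).symm
    rw [eq_top_iff]
    intro m _
    have : m ∈ closure (M : Set φ.GNS) := by
      refine closure_mono ?_ (hdense m)
      rintro _ ⟨x, rfl⟩
      exact hM _ _ hΩM
    rwa [hMc.closure_eq] at this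
  · exfalso
    have g₁ := vectorFunctional_mem π hJ0 v ht0 le_rfl
    -- The normalization is 1 − t and not ‖w‖², because only ‖Ω‖ ≤ 1 is known; the membership needs
    -- no more than ‖w‖² ≤ 1 − t.
    have g₂ := vectorFunctional_mem π hJ0 w (s := 1 - t) (by linarith) (by linarith)
    have hseg : g ∈ openSegment ℝ (fun x => t⁻¹ * (⟪v, π x v⟫_ℂ).re)
        (fun x => (1 - t)⁻¹ * (⟪w, π x w⟫_ℂ).re) := by
      refine ⟨t, 1 - t, ht0, by linarith, by ring, ?_⟩
      ext x
      have h1 : ⟪v, π x w⟫_ℂ = 0 := by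
        rw [hw, map_sub, hcomm]
        exact Submodule.inner_right_of_mem_orthogonal
          (M.starProjection_apply_mem Ω) (M.sub_starProjection_mem_orthogonal _)
      have h2 : ⟪w, π x v⟫_ℂ = 0 := by
        rw [hv, hcomm]
        exact M.starProjection_inner_eq_zero _ _ (M.starProjection_apply_mem _)
      have h3 : ⟪Ω, π x Ω⟫_ℂ = ⟪v, π x v⟫_ℂ + ⟪w, π x w⟫_ℂ := by
        have : Ω = v + w := by simp [hv, hw]
        rw [this, map_add, inner_add_left, inner_add_right, inner_add_right, h1, h2]
        simp
      have ht1' : 1 - t ≠ 0 := by linarith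
      simp only [Pi.add_apply, Pi.smul_apply, smul_eq_mul]
      rw [hgπ, h3, Complex.add_re, mul_inv_cancel_left₀ ht0.ne', mul_inv_cancel_left₀ ht1']
    -- Extremality makes the vector functional of v equal to t times that of Ω. Cyclicity turns this
    -- into v = tΩ; applying P yields v = tv, which is impossible for 0 < t < 1 and v ≠ 0.
    have he := ((mem_extremePoints.1 hg).2 _ g₁ _ g₂ hseg).1
    have hinn : ∀ x, ⟪v, π x v⟫_ℂ = ⟪Ω, π x v⟫_ℂ := by
      intro x
      rw [hv, hcomm, ← Submodule.inner_starProjection_left_eq_right,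
        Submodule.starProjection_eq_self_iff.2 (M.starProjection_apply_mem _),
        Submodule.inner_starProjection_left_eq_right]
    have hre : ∀ x, (⟪Ω, π x (v - (t : ℂ) • Ω)⟫_ℂ).re = 0 := by
      intro x
      have h1 := congrFun he x
      rw [hgπ, hinn, inv_mul_eq_iff_eq_mul₀ ht0.ne'] at h1
      rw [map_sub, map_smul, inner_sub_right, inner_smul_right, Complex.sub_re,
        Complex.re_ofReal_mul, h1, sub_self]
    have hzero : ∀ x, ⟪Ω, π x (v - (t : ℂ) • Ω)⟫_ℂ = 0 := by
      intro x
      refine Complex.ext (hre x) ?_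
      have := hre (Complex.I • x)
      rw [map_smul, smul_apply, inner_smul_right] at this
      simpa using this
    have hvt : v - (t : ℂ) • Ω = 0 := by
      refine hdense.eq_zero_of_inner_right (𝕜 := ℂ) ?_
      rintro _ ⟨x, rfl⟩
      have := hzero (star x)
      rwa [map_star, ContinuousLinearMap.star_eq_adjoint,
        ContinuousLinearMap.adjoint_inner_right] at this
    have hPv : P v = v := Submodule.starProjection_eq_self_iff.2 (M.starProjection_apply_mem _)
    have h4 : v = (t : ℂ) • v := by
      have := congrArg P (sub_eq_zero.1 hvt)
      rwa [hPv, map_smul, ← hv] at this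
    have h5 : ‖v‖ = t * ‖v‖ := by
      have := congrArg norm h4
      rwa [norm_smul, Complex.norm_real, Real.norm_of_nonneg ht0.le] at this
    have h6 : 0 < ‖v‖ := by
      rcases eq_or_lt_of_le (norm_nonneg v) with h7 | h7
      · rw [ht, ← h7] at ht0; norm_num at ht0
      · exact h7
    nlinarith

end GNS

/-! ### Compactness in the primitive ideal space and density of B_cs. -/

section PrimitiveIdealSpace

variable {B : Type*} [NonUnitalCStarAlgebra B]

theorem continuous_starHom {A : Type*} [NonUnitalCStarAlgebra A] (π : B →⋆ₙₐ[ℂ] A) :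
    Continuous π :=
  AddMonoidHomClass.continuous_of_bound π 1 fun x => by
    rw [one_mul]; exact NonUnitalStarAlgHom.norm_apply_le π x

theorem mem_idealOf {U : Set (PrimSpace B)} {b : B} :
    b ∈ idealOf U ↔ ∀ p : PrimSpace B, p ∉ U → b ∈ p.1 := Iff.rfl

theorem IsPrimitiveIdeal.smul_mem {p : TwoSidedIdeal B} (hp : IsPrimitiveIdeal p) (z : ℂ) {b : B}
    (hb : b ∈ p) : z • b ∈ p := by
  obtain ⟨H, _, _, _, π, -, rfl⟩ := hp
  rw [TwoSidedIdeal.mem_ker] at hb ⊢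
  rw [map_smul, hb, smul_zero]

theorem IsPrimitiveIdeal.isClosed {p : TwoSidedIdeal B} (hp : IsPrimitiveIdeal p) :
    IsClosed {b | b ∈ p} := by
  obtain ⟨H, _, _, _, π, -, rfl⟩ := hp
  simp only [TwoSidedIdeal.mem_ker]
  exact isClosed_eq (continuous_starHom π) continuous_const

theorem IsPrimitiveIdeal.star_mem {p : TwoSidedIdeal B} (hp : IsPrimitiveIdeal p) {b : B}
    (hb : b ∈ p) : star b ∈ p := by
  obtain ⟨H, _, _, _, π, -, rfl⟩ := hp
  rw [TwoSidedIdeal.mem_ker] at hb ⊢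
  rw [map_star, hb, star_zero]

theorem IsPrimitiveIdeal.cfcₙ_mem {p : TwoSidedIdeal B} (hp : IsPrimitiveIdeal p) {b : B}
    (hb : b ∈ p) (hb' : IsSelfAdjoint b) (f : ℝ → ℝ) (hf : Continuous f) (hf0 : f 0 = 0) :
    cfcₙ f b ∈ p := by
  obtain ⟨H, _, _, _, π, -, rfl⟩ := hp
  rw [TwoSidedIdeal.mem_ker] at hb ⊢
  rw [NonUnitalStarAlgHomClass.map_cfcₙ (S := ℂ) π f b hf.continuousOn hf0 (continuous_starHom π) hb'
    (hb'.map π), hb]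
  exact cfcₙ_apply_zero

/-- The ideal `B_U` as a linear subspace. -/
def idealOfSubmodule (U : Set (PrimSpace B)) : Submodule ℂ B where
  carrier := idealOf U
  add_mem' hx hy p hp := p.1.add_mem (hx p hp) (hy p hp)
  zero_mem' p _ := p.1.zero_mem
  smul_mem' z _ hx p hp := p.2.smul_mem z (hx p hp)

theorem isClosed_idealOf (U : Set (PrimSpace B)) : IsClosed (idealOf U) := by
  have : idealOf U = ⋂ p : PrimSpace B, ⋂ _ : p ∉ U, {b | b ∈ p.1} := by
    ext b; simp [mem_idealOf]
  rw [this]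
  exact isClosed_iInter fun p => isClosed_iInter fun _ => p.2.isClosed

theorem idealOf_mono {U V : Set (PrimSpace B)} (h : U ⊆ V) : idealOf U ⊆ idealOf V :=
  fun _ hb p hp => hb p fun hpU => hp (h hpU)

theorem mul_mem_idealOf_left {U : Set (PrimSpace B)} (a : B) {b : B} (hb : b ∈ idealOf U) :
    a * b ∈ idealOf U := fun p hp => p.1.mul_mem_left _ _ (hb p hp)

theorem mul_mem_idealOf_right {U : Set (PrimSpace B)} (a : B) {b : B} (hb : b ∈ idealOf U) :
    b * a ∈ idealOf U := fun p hp => p.1.mul_mem_right _ _ (hb p hp)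

theorem star_mem_idealOf {U : Set (PrimSpace B)} {b : B} (hb : b ∈ idealOf U) :
    star b ∈ idealOf U := fun p hp => p.2.star_mem (hb p hp)

theorem cfcₙ_mem_idealOf {U : Set (PrimSpace B)} {b : B} (hb : b ∈ idealOf U)
    (hb' : IsSelfAdjoint b) {f : ℝ → ℝ} (hf : Continuous f) (hf0 : f 0 = 0) :
    cfcₙ f b ∈ idealOf U := fun p hp => p.2.cfcₙ_mem (hb p hp) hb' f hf hf0

theorem isOpen_setOf_notMem (b : B) : IsOpen {p : PrimSpace B | b ∉ p.1} :=
  ⟨{b}, by ext p; simp⟩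

theorem mem_idealOf_setOf_notMem (b : B) : b ∈ idealOf {p : PrimSpace B | b ∉ p.1} :=
  fun p hp => by simpa using hp

theorem exists_mem_idealOf_of_isOpen {U : Set (PrimSpace B)} (hU : IsOpen U) {p : PrimSpace B}
    (hp : p ∈ U) : ∃ b ∈ idealOf U, b ∉ p.1 := by
  obtain ⟨S, rfl⟩ := hU
  obtain ⟨b, hbS, hb⟩ := Set.not_subset.1 hp
  refine ⟨b, fun q hq => ?_, hb⟩
  simp only [Set.mem_ofPred_eq, not_not] at hq
  exact hq hbS

variable [PartialOrder B] [StarOrderedRing B]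

/-- An element that lies in all primitive ideals vanishes. -/
theorem eq_zero_of_forall_mem_primitive {b : B} (h : ∀ p : PrimSpace B, b ∈ p.1) : b = 0 := by
  by_contra hb
  have hb' : 0 < ‖star b * b‖ := by
    rw [norm_pos_iff]; simpa [CStarRing.star_mul_self_eq_zero_iff] using hb
  obtain ⟨H, i1, i2, i3, π, hπ, -, hε⟩ := exists_irreducibleRep (J := (⊥ : Submodule ℂ B))
    (by simp) (by simp) (star_mul_self_nonneg b) hb' (by simp)
  have : π b = 0 := (TwoSidedIdeal.mem_ker π).1 (h ⟨_, H, i1, i2, i3, π, hπ, rfl⟩)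
  rw [map_mul, this, mul_zero, norm_zero] at hε
  exact absurd hε (not_le.2 hb')

theorem eq_zero_of_mem_idealOf_of_disjoint {U V : Set (PrimSpace B)} (h : U ∩ V = ∅) {b : B}
    (hU : b ∈ idealOf U) (hV : b ∈ idealOf V) : b = 0 := by
  refine eq_zero_of_forall_mem_primitive fun p => ?_
  by_cases hp : p ∈ U
  · exact hV p fun hpV => by
      have : p ∈ U ∩ V := ⟨hp, hpV⟩
      rw [h] at this; exact this
  · exact hU p hp

/-- The primitive ideals at which a positive element has norm at least `ε` form a quasi-compact
set. -/
theorem isCompact_setOf_le_dist {b : B} (hb : 0 ≤ b) {ε : ℝ} (hε : 0 < ε) :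
    IsCompact {p : PrimSpace B | ∀ x ∈ p.1, ε ≤ ‖b - x‖} := by
  classical
  refine isCompact_of_finite_subcover fun {ι} U hU hcov => ?_
  let V : Finset ι → Set (PrimSpace B) := fun t => ⋃ i ∈ t, U i
  have hV : ∀ {s t}, s ⊆ t → V s ⊆ V t := fun h => Set.biUnion_subset_biUnion_left h
  -- The directed union of the ideals B_V over finite subunions V, not necessarily closed. If no V
  -- covers the set, each x ∈ J belongs to some ideal p in the set, so ‖b − x‖ ≥ ε throughout J. The
  -- irreducible representation that results has its kernel in the set but outside every U i.
  let J : Submodule ℂ B :=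
    { carrier := {x | ∃ t, x ∈ idealOf (V t)}
      add_mem' := by
        rintro x y ⟨s, hs⟩ ⟨t, ht⟩
        exact ⟨s ∪ t, (idealOfSubmodule _).add_mem (idealOf_mono (hV Finset.subset_union_left) hs)
          (idealOf_mono (hV Finset.subset_union_right) ht)⟩
      zero_mem' := ⟨∅, (idealOfSubmodule _).zero_mem⟩
      smul_mem' := fun z x ⟨t, ht⟩ => ⟨t, (idealOfSubmodule _).smul_mem z ht⟩ }
  by_contra! hcon
  obtain ⟨H, i1, i2, i3, π, hπ, hπJ, hπb⟩ := exists_irreducibleRep (J := J)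
    (fun a x ⟨t, ht⟩ => ⟨t, mul_mem_idealOf_left a ht⟩)
    (fun a x ⟨t, ht⟩ => ⟨t, mul_mem_idealOf_right a ht⟩) hb hε (by
      rintro x ⟨t, ht⟩
      obtain ⟨p, hp, hpt⟩ := Set.not_subset.1 (hcon t)
      exact hp x (ht p hpt))
  let p : PrimSpace B := ⟨_, H, i1, i2, i3, π, hπ, rfl⟩
  have hp : p ∈ {p : PrimSpace B | ∀ x ∈ p.1, ε ≤ ‖b - x‖} := by
    intro x hx
    have hx0 : π x = 0 := (TwoSidedIdeal.mem_ker π).1 hx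
    calc ε ≤ ‖π b‖ := hπb
      _ = ‖π (b - x)‖ := by rw [map_sub, hx0, sub_zero]
      _ ≤ ‖b - x‖ := NonUnitalStarAlgHom.norm_apply_le π _
  obtain ⟨i, hi⟩ := Set.mem_iUnion.1 (hcov hp)
  obtain ⟨c, hc, hcp⟩ := exists_mem_idealOf_of_isOpen (hU i) hi
  refine hcp ((TwoSidedIdeal.mem_ker π).2 (hπJ c ⟨{i}, ?_⟩))
  simpa [V] using hc

/-- The truncation `(b - ε)₊`. -/
noncomputable def truncation (ε : ℝ) (b : B) : B := cfcₙ (fun t : ℝ => max (t - ε) 0) b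

/-- The image of b in the representation with kernel p has norm below ε, and t ↦ max(t − ε, 0)
vanishes on its spectrum. -/
theorem truncation_mem {p : TwoSidedIdeal B} (hp : IsPrimitiveIdeal p) {b x : B} (hb : 0 ≤ b)
    {ε : ℝ} (hε : 0 < ε) (hx : x ∈ p) (h : ‖b - x‖ < ε) : truncation ε b ∈ p := by
  obtain ⟨H, _, _, _, π, -, rfl⟩ := hp
  rw [TwoSidedIdeal.mem_ker] at hx ⊢
  have hb' : IsSelfAdjoint b := .of_nonneg hb
  rw [truncation, NonUnitalStarAlgHomClass.map_cfcₙ (S := ℂ) π _ b (by fun_prop)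
    (by simp [hε.le]) (continuous_starHom π) hb' (hb'.map π)]
  have hn : ‖π b‖ < ε := by
    calc ‖π b‖ = ‖π (b - x)‖ := by rw [map_sub, hx, sub_zero]
      _ ≤ ‖b - x‖ := NonUnitalStarAlgHom.norm_apply_le π _
      _ < ε := h
  rw [← norm_le_zero_iff]
  refine norm_cfcₙ_le fun t ht => ?_
  have : ‖t‖ ≤ ‖π b‖ := by
    have h1 : ‖cfcₙ (id : ℝ → ℝ) (π b)‖ = ‖π b‖ := by rw [cfcₙ_id ℝ (π b) (hb'.map π)]
    rw [← h1]
    exact norm_apply_le_norm_cfcₙ id (π b) ht (by fun_prop) rfl (hb'.map π)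
  have h2 : t - ε ≤ 0 := by
    have := (Real.le_norm_self t).trans this
    linarith
  simp [max_eq_right h2]

theorem norm_sub_truncation_le {b : B} (hb : 0 ≤ b) {ε : ℝ} (hε : 0 < ε) :
    ‖b - truncation ε b‖ ≤ ε := by
  have hb' : IsSelfAdjoint b := .of_nonneg hb
  have h1 : b - truncation ε b = cfcₙ (fun t : ℝ => t - max (t - ε) 0) b := by
    rw [cfcₙ_sub (fun t : ℝ => t) _ b (by fun_prop) (by simp) (by fun_prop) (by simp [hε.le]),
      cfcₙ_id' ℝ b, truncation]
  rw [h1]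
  refine norm_cfcₙ_le fun t ht => ?_
  have ht0 : 0 ≤ t := quasispectrum_nonneg_of_nonneg b hb t ht
  rw [Real.norm_eq_abs, abs_le]
  constructor <;> rcases le_total (t - ε) 0 with h | h <;>
    simp only [max_eq_left, max_eq_right, h] <;> linarith

theorem isRelQuasiCompact_setOf_truncation_notMem {b : B} (hb : 0 ≤ b) {ε : ℝ} (hε : 0 < ε) :
    IsRelQuasiCompact {p : PrimSpace B | truncation ε b ∉ p.1} := by
  refine ⟨_, isCompact_setOf_le_dist hb hε, fun p hp x hx => ?_⟩
  by_contra! h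
  exact hp (truncation_mem p.2 hb hε hx h)

theorem truncation_mem_compactPart {b : B} (hb : 0 ≤ b) {ε : ℝ} (hε : 0 < ε) :
    truncation ε b ∈ compactPart B :=
  ⟨_, isOpen_setOf_notMem _, isRelQuasiCompact_setOf_truncation_notMem hb hε,
    mem_idealOf_setOf_notMem _⟩

theorem IsRelQuasiCompact.union {X : Type*} [TopologicalSpace X] {S T : Set X}
    (hS : IsRelQuasiCompact S) (hT : IsRelQuasiCompact T) : IsRelQuasiCompact (S ∪ T) := by
  obtain ⟨K, hK, hSK⟩ := hS
  obtain ⟨L, hL, hTL⟩ := hT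
  exact ⟨K ∪ L, hK.union hL, Set.union_subset_union hSK hTL⟩

/-- `B_cs` as a linear subspace. -/
def compactPartSubmodule (B : Type*) [NonUnitalCStarAlgebra B] : Submodule ℂ B where
  carrier := compactPart B
  add_mem' := by
    rintro x y ⟨U, hU, hU', hx⟩ ⟨V, hV, hV', hy⟩
    exact ⟨U ∪ V, hU.union hV, hU'.union hV', (idealOfSubmodule _).add_mem
      (idealOf_mono Set.subset_union_left hx) (idealOf_mono Set.subset_union_right hy)⟩
  zero_mem' := ⟨∅, isOpen_empty, ⟨∅, isCompact_empty, le_rfl⟩, (idealOfSubmodule _).zero_mem⟩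
  smul_mem' z x := by
    rintro ⟨U, hU, hU', hx⟩
    exact ⟨U, hU, hU', (idealOfSubmodule _).smul_mem z hx⟩

/-- B_cs is a linear subspace, positive elements span B, and each of them is the limit of its
truncations. -/
theorem dense_compactPart : Dense (compactPart B) := by
  change Dense (compactPartSubmodule B : Set B)
  rw [Submodule.dense_iff_topologicalClosure_eq_top, eq_top_iff, ← CStarAlgebra.span_nonneg,
    Submodule.span_le]
  intro b hb
  change b ∈ closure (compactPart B)
  refine Metric.mem_closure_iff.2 fun ε hε => ⟨truncation (ε / 2) b,
    truncation_mem_compactPart hb (half_pos hε), ?_⟩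
  rw [dist_eq_norm]
  exact (norm_sub_truncation_le hb (half_pos hε)).trans_lt (half_lt_self hε)

end PrimitiveIdealSpace

/-! ### The action of G on the primitive ideal space. -/

section PrimAction

variable {G B : Type*} [Group G] [TopologicalSpace G] [IsTopologicalGroup G]
  [NonUnitalCStarAlgebra B] [PartialOrder B] [StarOrderedRing B] (β : GCStarAction G B)

namespace GCStarAction

/-- The translate of a set of primitive ideals. -/
def translate (g : G) (U : Set (PrimSpace B)) : Set (PrimSpace B) :=
  (fun p => β.primAction.smul g p) '' U

theorem mem_primAction_smul (g : G) (p : PrimSpace B) (b : B) :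
    b ∈ (β.primAction.smul g p).1 ↔ β g⁻¹ b ∈ p.1 := by
  change b ∈ TwoSidedIdeal.comap (β g⁻¹) p.1 ↔ _
  rw [TwoSidedIdeal.mem_comap]

@[simp]
theorem apply_inv_apply (g : G) (b : B) : β g⁻¹ (β g b) = b := by
  have := congrArg (fun e : B ≃⋆ₐ[ℂ] B => e b) (β.toHom.map_mul g⁻¹ g)
  simp only [inv_mul_cancel, map_one] at this
  exact this.symm

theorem apply_apply_inv (g : G) (b : B) : β g (β g⁻¹ b) = b := by
  simpa using β.apply_inv_apply g⁻¹ b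

theorem mul_apply (g h : G) (b : B) : β (g * h) b = β g (β h b) :=
  congrArg (fun e : B ≃⋆ₐ[ℂ] B => e b) (β.toHom.map_mul g h)

theorem norm_apply (g : G) (b : B) : ‖β g b‖ = ‖b‖ :=
  NonUnitalStarAlgHom.norm_map (β g) (β g).injective b

theorem smul_mem_translate_iff {g : G} {U : Set (PrimSpace B)} {p : PrimSpace B} :
    p ∈ β.translate g U ↔ β.primAction.smul g⁻¹ p ∈ U := by
  let _ := β.primAction
  constructor
  · rintro ⟨q, hq, rfl⟩
    change g⁻¹ • (g • q) ∈ U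
    rwa [inv_smul_smul]
  · intro h
    exact ⟨_, h, smul_inv_smul g p⟩

theorem apply_mem_idealOf_translate {U : Set (PrimSpace B)} {b : B} (hb : b ∈ idealOf U) (g : G) :
    β g b ∈ idealOf (β.translate g U) := by
  intro p hp
  rw [smul_mem_translate_iff] at hp
  have := hb _ hp
  rwa [mem_primAction_smul, inv_inv] at this

/-- The action on the primitive ideal space is jointly continuous. -/
theorem continuous_primAction :
    Continuous fun x : G × PrimSpace B => β.primAction.smul x.1 x.2 := by
  rw [continuous_def]
  rintro _ ⟨S, rfl⟩
  rw [isOpen_iff_mem_nhds]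
  rintro ⟨g, p⟩ hgp
  obtain ⟨s, hsS, hs⟩ := Set.not_subset.1 hgp
  change s ∉ (β.primAction.smul g p).1 at hs
  rw [mem_primAction_smul] at hs
  set c := β g⁻¹ s with hc
  set a := star c * c with ha
  have ha0 : 0 ≤ a := star_mul_self_nonneg c
  -- some truncation of `a` is not in `p`
  have hap : a ∉ p.1 := by
    intro h
    refine hs ?_
    rcases p.2 with ⟨H, _, _, _, π, -, hp⟩
    rw [hp, TwoSidedIdeal.mem_ker] at h ⊢
    rwa [ha, map_mul, map_star, CStarRing.star_mul_self_eq_zero_iff] at h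
  obtain ⟨ε, hε, hεp⟩ : ∃ ε > 0, truncation ε a ∉ p.1 := by
    by_contra! hcon
    refine hap ?_
    have := p.2.isClosed.closure_subset_iff.2 (le_refl {b | b ∈ p.1})
    refine this (Metric.mem_closure_iff.2 fun ε hε => ⟨truncation (ε / 2) a,
      hcon _ (half_pos hε), ?_⟩)
    rw [dist_eq_norm]
    exact (norm_sub_truncation_le ha0 (half_pos hε)).trans_lt (half_lt_self hε)
  -- For such h, if s belonged to h·q, then q would contain an element within ε of a, and hence the
  -- truncation of a. The open condition that this truncation is not in q excludes that near p.
  have hN : ∀ᶠ h in 𝓝 g, ‖a - star (β h⁻¹ s) * β h⁻¹ s‖ < ε := by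
    have hcont : Continuous fun h : G => ‖a - star (β h⁻¹ s) * β h⁻¹ s‖ := by
      have : Continuous fun h : G => β h⁻¹ s := (β.continuous_apply s).comp continuous_inv
      fun_prop
    refine hcont.continuousAt.eventually_lt continuousAt_const ?_
    simpa [ha, hc] using hε
  filter_upwards [prod_mem_nhds hN ((isOpen_setOf_notMem (truncation ε a)).mem_nhds hεp)]
  rintro ⟨h, q⟩ ⟨hh, hq⟩
  refine Set.not_subset.2 ⟨s, hsS, fun hmem => ?_⟩
  change s ∈ (β.primAction.smul h q).1 at hmem
  rw [mem_primAction_smul] at hmem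
  exact hq (truncation_mem q.2 ha0 hε (q.1.mul_mem_left _ _ hmem) hh)

theorem isOpen_translate {U : Set (PrimSpace B)} (hU : IsOpen U) (g : G) :
    IsOpen (β.translate g U) := by
  have : β.translate g U = (fun p => β.primAction.smul g⁻¹ p) ⁻¹' U := by
    ext p; exact β.smul_mem_translate_iff
  rw [this]
  exact hU.preimage (β.continuous_primAction.comp (by fun_prop : Continuous fun p => (g⁻¹, p)))

/-- Compact families of translates of a relatively quasi-compact open set. -/
theorem exists_isOpen_translate_subset {U : Set (PrimSpace B)} (hU : IsOpen U)
    (hU' : IsRelQuasiCompact U) {C : Set G} (hC : IsCompact C) :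
    ∃ W : Set (PrimSpace B), IsOpen W ∧ IsRelQuasiCompact W ∧ ∀ g ∈ C, β.translate g U ⊆ W := by
  obtain ⟨K, hK, hUK⟩ := hU'
  refine ⟨⋃ g ∈ C, β.translate g U, isOpen_biUnion fun g _ => β.isOpen_translate hU g,
    ⟨_, (hC.prod hK).image β.continuous_primAction, ?_⟩, fun g hg =>
      Set.subset_biUnion_of_mem (u := fun g => β.translate g U) hg⟩
  rintro p hp
  obtain ⟨g, hg, q, hq, rfl⟩ := Set.mem_iUnion₂.1 hp
  exact ⟨(g, q), ⟨hg, hUK hq⟩, rfl⟩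

/-- If the action is spectrally proper, then only a relatively compact set of group elements moves
a relatively quasi-compact set back to another one. -/
theorem IsSpectrallyProper.exists_isCompact {β : GCStarAction G B} (hβ : β.IsSpectrallyProper)
    {U V : Set (PrimSpace B)} (hU : IsRelQuasiCompact U) (hV : IsRelQuasiCompact V) :
    ∃ C : Set G, IsCompact C ∧ ∀ g, (β.translate g U ∩ V).Nonempty → g ∈ C := by
  obtain ⟨K, hK, hUK⟩ := hU
  obtain ⟨L, hL, hVL⟩ := hV
  have main : ∀ x y : PrimSpace B, ∃ U ∈ 𝓝 x, ∃ V ∈ 𝓝 y, ∃ C : Set G, IsCompact C ∧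
      ∀ g, (β.translate g U ∩ V).Nonempty → g ∈ C := by
    intro x y
    obtain ⟨U, hU, V, hV, C, hC, h⟩ := hβ x y
    exact ⟨U, hU, V, hV, C, hC, fun g hg => h hg⟩
  -- Two rounds of finite subcovers: over L for fixed x, intersecting the neighbourhoods of x, and
  -- then over K.
  suffices ∀ x : PrimSpace B, ∃ U ∈ 𝓝 x, ∃ C : Set G, IsCompact C ∧
      ∀ g, (β.translate g U ∩ L).Nonempty → g ∈ C by
    choose U hU C hC h using this
    obtain ⟨t, -, ht⟩ := hK.elim_nhds_subcover U fun x _ => hU x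
    refine ⟨⋃ x ∈ t, C x, t.isCompact_biUnion fun x _ => hC x, ?_⟩
    rintro g ⟨_, ⟨q, hq, rfl⟩, hp⟩
    obtain ⟨x, hx, hqx⟩ := Set.mem_iUnion₂.1 (ht (hUK hq))
    exact Set.mem_iUnion₂.2 ⟨x, hx, h x g ⟨_, ⟨q, hqx, rfl⟩, hVL hp⟩⟩
  intro x
  choose U hU V hV C hC h using main x
  obtain ⟨t, -, ht⟩ := hL.elim_nhds_subcover V fun y _ => hV y
  refine ⟨⋂ y ∈ t, U y, (biInter_finset_mem t).2 fun y _ => hU y, ⋃ y ∈ t, C y,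
    t.isCompact_biUnion fun y _ => hC y, ?_⟩
  rintro g ⟨_, ⟨q, hq, rfl⟩, hp⟩
  obtain ⟨y, hy, hpy⟩ := Set.mem_iUnion₂.1 (ht hp)
  exact Set.mem_iUnion₂.2 ⟨y, hy, h y g ⟨_, ⟨q, Set.mem_iInter₂.1 hq y hy, rfl⟩, hpy⟩⟩

end GCStarAction

end PrimAction

/-! ### Hilbert modules, approximate units, and factorization through ideals. -/

section HilbertModule

variable {B E : Type*} [NonUnitalCStarAlgebra B] [PartialOrder B] [StarOrderedRing B]
  [NormedAddCommGroup E] [NormedSpace ℂ E] [SMul Bᵐᵒᵖ E] [CStarModule Bᵐᵒᵖ E]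

theorem hinner_add_right (x y z : E) : hinner B x (y + z) = hinner B x y + hinner B x z := by
  simp [hinner]

theorem hinner_add_left (x y z : E) : hinner B (x + y) z = hinner B x z + hinner B y z := by
  simp [hinner]

theorem hinner_sub_right (x y z : E) : hinner B x (y - z) = hinner B x y - hinner B x z := by
  simp [hinner]

theorem hinner_sub_left (x y z : E) : hinner B (x - y) z = hinner B x z - hinner B y z := by
  simp [hinner]

theorem hinner_zero_right (x : E) : hinner B x (0 : E) = 0 := by simp [hinner]

theorem hinner_zero_left (x : E) : hinner B (0 : E) x = 0 := by simp [hinner]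

theorem hinner_smul_right (z : ℂ) (x y : E) : hinner B x (z • y) = z • hinner B x y := by
  simp [hinner]

theorem hinner_smul_left (z : ℂ) (x y : E) : hinner B (z • x) y = star z • hinner B x y := by
  simp [hinner]

theorem hinner_rmul_right (x y : E) (b : B) : hinner B x (y <• b) = hinner B x y * b := by
  simp [hinner]

theorem star_hinner (x y : E) : star (hinner B x y) = hinner B y x := by
  have := congrArg MulOpposite.unop (CStarModule.star_inner (A := Bᵐᵒᵖ) x y)
  exact this

theorem hinner_rmul_left (x y : E) (b : B) : hinner B (x <• b) y = star b * hinner B x y := by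
  rw [← star_hinner, hinner_rmul_right, star_mul, star_hinner]

theorem hinner_self_nonneg (x : E) : 0 ≤ hinner B x x :=
  CStarModule.inner_self_nonneg (A := Bᵐᵒᵖ) (x := x)

theorem isSelfAdjoint_hinner_self (x : E) : IsSelfAdjoint (hinner B x x) := star_hinner x x

theorem norm_hinner_le (x y : E) : ‖hinner B x y‖ ≤ ‖x‖ * ‖y‖ :=
  CStarModule.norm_inner_le (A := Bᵐᵒᵖ) E

theorem norm_sq_eq_norm_hinner (x : E) : ‖x‖ ^ 2 = ‖hinner B x x‖ :=
  CStarModule.norm_sq_eq Bᵐᵒᵖ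

theorem norm_le_of_hinner_le {x : E} {c : ℝ} (hc : 0 ≤ c) (h : ‖hinner B x x‖ ≤ c ^ 2) :
    ‖x‖ ≤ c := by
  rw [← norm_sq_eq_norm_hinner] at h
  exact (sq_le_sq₀ (norm_nonneg _) hc).1 h

theorem eq_zero_of_hinner_self {x : E} (h : hinner B x x = 0) : x = 0 := by
  rw [← norm_eq_zero, ← sq_eq_zero_iff, norm_sq_eq_norm_hinner (B := B), h, norm_zero]

variable (B) in
theorem ext_hinner {x y : E} (h : ∀ z, hinner B z x = hinner B z y) : x = y := by
  rw [← sub_eq_zero]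
  exact eq_zero_of_hinner_self (B := B) (by rw [hinner_sub_right, h, sub_self])

theorem hinner_mul_hinner_le (x y : E) :
    hinner B y x * hinner B x y ≤ ‖x‖ ^ 2 • hinner B y y :=
  CStarModule.inner_mul_inner_swap_le (A := Bᵐᵒᵖ) (x := x) (y := y)

theorem add_rmul (x y : E) (b : B) : (x + y) <• b = x <• b + y <• b :=
  ext_hinner B fun z => by simp [hinner_rmul_right, hinner_add_right, add_mul]

theorem sub_rmul (x y : E) (b : B) : (x - y) <• b = x <• b - y <• b :=
  ext_hinner B fun z => by simp [hinner_rmul_right, hinner_sub_right, sub_mul]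

theorem rmul_add (x : E) (b c : B) : x <• (b + c) = x <• b + x <• c :=
  ext_hinner B fun z => by simp only [hinner_rmul_right, hinner_add_right, mul_add]

theorem rmul_sub (x : E) (b c : B) : x <• (b - c) = x <• b - x <• c :=
  ext_hinner B fun z => by simp only [hinner_rmul_right, hinner_sub_right, mul_sub]

theorem rmul_rmul (x : E) (b c : B) : x <• b <• c = x <• (b * c) :=
  ext_hinner B fun z => by simp only [hinner_rmul_right, mul_assoc]

theorem smul_rmul (z : ℂ) (x : E) (b : B) : (z • x) <• b = z • (x <• b) :=
  ext_hinner B fun w => by simp only [hinner_rmul_right, hinner_smul_right, smul_mul_assoc]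

theorem rmul_smul (z : ℂ) (x : E) (b : B) : x <• (z • b) = z • (x <• b) :=
  ext_hinner B fun w => by simp only [hinner_rmul_right, hinner_smul_right, mul_smul_comm]

theorem norm_rmul_le (x : E) (b : B) : ‖x <• b‖ ≤ ‖x‖ * ‖b‖ := by
  refine norm_le_of_hinner_le (B := B) (by positivity) ?_
  rw [hinner_rmul_left, hinner_rmul_right]
  calc ‖star b * (hinner B x x * b)‖ ≤ ‖b‖ * (‖hinner B x x‖ * ‖b‖) := by
        refine (norm_mul_le _ _).trans ?_
        rw [norm_star]
        gcongr
        exact norm_mul_le _ _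
    _ = (‖x‖ * ‖b‖) ^ 2 := by rw [← norm_sq_eq_norm_hinner]; ring

/-- The inner product as a continuous linear map in the second variable. -/
noncomputable def hinnerL (B : Type*) {E : Type*} [NonUnitalCStarAlgebra B] [PartialOrder B]
    [StarOrderedRing B] [NormedAddCommGroup E] [NormedSpace ℂ E] [SMul Bᵐᵒᵖ E]
    [CStarModule Bᵐᵒᵖ E] (x : E) : E →L[ℂ] B :=
  LinearMap.mkContinuous
    { toFun := hinner B x
      map_add' := hinner_add_right x
      map_smul' := fun z y => hinner_smul_right z x y } ‖x‖ (norm_hinner_le x)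

@[simp]
theorem hinnerL_apply (x y : E) : hinnerL B x y = hinner B x y := rfl

variable (B E) in
/-- The right module structure as a bilinear map. -/
noncomputable def rmulL : E →L[ℂ] B →L[ℂ] E :=
  LinearMap.mkContinuous₂ (LinearMap.mk₂ ℂ (fun x (b : B) => x <• b) add_rmul smul_rmul rmul_add
    rmul_smul) 1 fun x b => by simpa using norm_rmul_le x b

@[simp]
theorem rmulL_apply (x : E) (b : B) : rmulL B E x b = x <• b := rfl

@[fun_prop]
theorem Continuous.rmul {X : Type*} [TopologicalSpace X] {f : X → E} {g : X → B}
    (hf : Continuous f) (hg : Continuous g) : Continuous fun t => f t <• g t :=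
  ((rmulL B E).continuous.comp hf).clm_apply hg

@[fun_prop]
theorem Continuous.hinner {X : Type*} [TopologicalSpace X] {f g : X → E}
    (hf : Continuous f) (hg : Continuous g) : Continuous fun t => hinner B (f t) (g t) :=
  MulOpposite.continuous_unop.comp
    ((CStarModule.continuous_inner (A := Bᵐᵒᵖ)).comp (hf.prodMk hg))

theorem rmul_zero (x : E) : x <• (0 : B) = 0 := (rmulL B E x).map_zero

/-- An approximate unit of `B` acts as an approximate unit on `E`. -/
theorem tendsto_rmul_approximateUnit (x : E) :
    Tendsto (fun e : B => x <• e) (CStarAlgebra.approximateUnit B) (𝓝 x) := by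
  have hu := CStarAlgebra.increasingApproximateUnit B
  set a := hinner B x x with ha
  have h1 : Tendsto (fun e : B => ‖a * e - a‖ + ‖a * e - a‖) (CStarAlgebra.approximateUnit B)
      (𝓝 0) := by
    have : Tendsto (fun e : B => ‖a * e - a‖) (CStarAlgebra.approximateUnit B) (𝓝 ‖a - a‖) :=
      ((hu.tendsto_mul_left a).sub_const a).norm
    rw [sub_self, norm_zero] at this
    simpa using this.add this
  rw [tendsto_iff_norm_sub_tendsto_zero]
  have h2 : Tendsto (fun e : B => √(‖a * e - a‖ + ‖a * e - a‖)) (CStarAlgebra.approximateUnit B)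
      (𝓝 0) := by
    simpa using h1.sqrt
  refine tendsto_of_tendsto_of_tendsto_of_le_of_le' tendsto_const_nhds h2
    (Eventually.of_forall fun _ => norm_nonneg _) ?_
  filter_upwards [hu.eventually_star_eq, hu.eventually_norm] with e he he1
  refine Real.le_sqrt_of_sq_le ?_
  rw [norm_sq_eq_norm_hinner (B := B)]
  have : hinner B (x <• e - x) (x <• e - x) = star e * (a * e - a) - (a * e - a) := by
    simp only [hinner_sub_left, hinner_sub_right, hinner_rmul_left, hinner_rmul_right, ← ha]
    rw [mul_sub, sub_mul, mul_assoc]; abel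
  rw [this]
  refine (norm_sub_le _ _).trans (add_le_add_left ?_ _)
  refine (norm_mul_le _ _).trans ?_
  rw [norm_star]
  exact mul_le_of_le_one_left (norm_nonneg _) he1

theorem eventually_norm_mul_sub_lt {Q : Set B} (hQ : IsCompact Q) {ε : ℝ} (hε : 0 < ε) :
    ∀ᶠ e in CStarAlgebra.approximateUnit B, ∀ c ∈ Q, ‖c * e - c‖ < ε := by
  have hu := CStarAlgebra.increasingApproximateUnit B
  obtain ⟨t, -, htf, ht⟩ := hQ.finite_cover_balls (show 0 < ε / 3 by positivity)
  have h1 : ∀ᶠ e in CStarAlgebra.approximateUnit B, ∀ c ∈ t, ‖c * e - c‖ < ε / 3 := by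
    rw [eventually_all_finite htf]
    intro c _
    have := (tendsto_iff_norm_sub_tendsto_zero.1 (hu.tendsto_mul_left c))
    exact this.eventually_lt_const (by positivity)
  filter_upwards [h1, hu.eventually_norm] with e he he1 c hc
  obtain ⟨d, hd, hcd⟩ := Set.mem_iUnion₂.1 (ht hc)
  rw [Metric.mem_ball, dist_eq_norm] at hcd
  calc ‖c * e - c‖ = ‖(c - d) * e + (d * e - d) - (c - d)‖ := by
        congr 1; rw [sub_mul]; abel
    _ ≤ ‖c - d‖ * ‖e‖ + ‖d * e - d‖ + ‖c - d‖ := by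
        refine (norm_sub_le _ _).trans (add_le_add_left ((norm_add_le _ _).trans ?_) _)
        gcongr
        exact norm_mul_le _ _
    _ ≤ ‖c - d‖ * 1 + ‖d * e - d‖ + ‖c - d‖ := by gcongr
    _ < ε := by linarith [he d hd]

/-- Elements of `B_cs` that act approximately as units. -/
theorem exists_compactPart_approx (x : E) {Q : Set B} (hQ : IsCompact Q) {ε : ℝ} (hε : 0 < ε) :
    ∃ b ∈ compactPart B, ‖b‖ ≤ 2 ∧ ‖x <• b - x‖ < ε ∧ ∀ c ∈ Q, ‖c * b - c‖ < ε := by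
  have hu := CStarAlgebra.increasingApproximateUnit B
  have : (CStarAlgebra.approximateUnit B).NeBot := hu.neBot
  have h1 : ∀ᶠ e in CStarAlgebra.approximateUnit B, ‖x <• e - x‖ < ε / 2 :=
    (tendsto_iff_norm_sub_tendsto_zero.1 (tendsto_rmul_approximateUnit x)).eventually_lt_const
      (by positivity)
  obtain ⟨e, he, hx, hQe⟩ := (hu.eventually_norm.and (h1.and
    (eventually_norm_mul_sub_lt hQ (half_pos hε)))).exists
  obtain ⟨R, hR⟩ := hQ.isBounded.exists_norm_le
  -- The approximate unit e is replaced by a nearby b ∈ B_cs. The replacement error stays below ε/2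
  -- after multiplication by ‖x‖ or by the norm of an element of Q; distance below 1 ensures ‖b‖ ≤
  -- 2.
  have hpos : 0 < ε / 2 / (‖x‖ + |R| + 1) := by positivity
  obtain ⟨b, hb, hbe⟩ := Metric.mem_closure_iff.1 (dense_compactPart e) (min 1 _)
    (lt_min one_pos hpos)
  rw [dist_eq_norm, norm_sub_rev] at hbe
  have hb1 := hbe.trans_le (min_le_left _ _)
  have hb2 := hbe.trans_le (min_le_right _ _)
  rw [lt_div_iff₀ (by positivity)] at hb2
  have hbn := norm_nonneg (b - e)
  refine ⟨b, hb, ?_, ?_, fun c hc => ?_⟩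
  · calc ‖b‖ = ‖(b - e) + e‖ := by rw [sub_add_cancel]
      _ ≤ ‖b - e‖ + ‖e‖ := norm_add_le _ _
      _ ≤ 2 := by linarith
  · calc ‖x <• b - x‖ = ‖x <• (b - e) + (x <• e - x)‖ := by rw [rmul_sub]; congr 1; abel
      _ ≤ ‖x‖ * ‖b - e‖ + ‖x <• e - x‖ :=
          (norm_add_le _ _).trans (add_le_add_left (norm_rmul_le _ _) _)
      _ < ε := by nlinarith [abs_nonneg R, norm_nonneg x]
  · have hcR : ‖c‖ ≤ |R| := (hR c hc).trans (le_abs_self R)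
    calc ‖c * b - c‖ = ‖c * (b - e) + (c * e - c)‖ := by rw [mul_sub]; congr 1; abel
      _ ≤ |R| * ‖b - e‖ + ‖c * e - c‖ := by
          refine (norm_add_le _ _).trans (add_le_add_left ((norm_mul_le _ _).trans ?_) _)
          gcongr
      _ < ε := by nlinarith [hQe c hc, norm_nonneg x]

/-- The submodule `E · B_U`. -/
def moduleIdeal (B : Type*) {E : Type*} [NonUnitalCStarAlgebra B] [PartialOrder B]
    [StarOrderedRing B] [NormedAddCommGroup E] [NormedSpace ℂ E] [SMul Bᵐᵒᵖ E]
    [CStarModule Bᵐᵒᵖ E] (U : Set (PrimSpace B)) : Submodule ℂ E where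
  carrier := {x | ∀ y, hinner B y x ∈ idealOf U}
  add_mem' hx hy z := by
    rw [hinner_add_right]; exact (idealOfSubmodule U).add_mem (hx z) (hy z)
  zero_mem' z := by rw [hinner_zero_right]; exact (idealOfSubmodule U).zero_mem
  smul_mem' c x hx z := by
    rw [hinner_smul_right]; exact (idealOfSubmodule U).smul_mem c (hx z)

theorem mem_moduleIdeal {U : Set (PrimSpace B)} {x : E} :
    x ∈ moduleIdeal B U ↔ ∀ y, hinner B y x ∈ idealOf U := Iff.rfl

theorem isClosed_moduleIdeal (U : Set (PrimSpace B)) :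
    IsClosed ((moduleIdeal B U : Submodule ℂ E) : Set E) := by
  have : ((moduleIdeal B U : Submodule ℂ E) : Set E) = ⋂ y, {x | hinner B y x ∈ idealOf U} := by
    ext x; simp [mem_moduleIdeal]
  rw [this]
  exact isClosed_iInter fun y => (isClosed_idealOf U).preimage (hinnerL B y).continuous

theorem moduleIdeal_mono {U V : Set (PrimSpace B)} (h : U ⊆ V) :
    (moduleIdeal B U : Submodule ℂ E) ≤ moduleIdeal B V :=
  fun _ hx y => idealOf_mono h (hx y)

theorem rmul_mem_moduleIdeal {U : Set (PrimSpace B)} (x : E) {b : B} (hb : b ∈ idealOf U) :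
    x <• b ∈ (moduleIdeal B U : Submodule ℂ E) := fun y => by
  rw [hinner_rmul_right]; exact mul_mem_idealOf_left _ hb

variable [CompleteSpace E]

theorem hinner_rmul_cfcₙ_self (x : E) {f : ℝ → ℝ} (hf : Continuous f) (hf0 : f 0 = 0) :
    hinner B (x <• cfcₙ f (hinner B x x)) (x <• cfcₙ f (hinner B x x)) =
      cfcₙ (fun t => f t * (t * f t)) (hinner B x x) := by
  have hs : IsSelfAdjoint (cfcₙ f (hinner B x x)) := cfcₙ_predicate f _
  rw [hinner_rmul_left, hinner_rmul_right, hs.star_eq,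
    cfcₙ_mul f (fun t => t * f t) _ (by fun_prop) hf0 (by fun_prop) (by simp),
    cfcₙ_mul (fun t => t) f _ (by fun_prop) rfl (by fun_prop) hf0,
    cfcₙ_id' ℝ _ (isSelfAdjoint_hinner_self x)]

/-- The inner square of x·f(a), a = ⟨x|x⟩, is the function t f(t)² of a. The substitution t = s⁴
keeps fractional powers out of the estimates with fourth roots. -/
theorem norm_rmul_cfcₙ_le (x : E) {f : ℝ → ℝ} (hf : Continuous f) (hf0 : f 0 = 0) {c : ℝ}
    (hc : 0 ≤ c) (h : ∀ s : ℝ, 0 ≤ s → |s ^ 2 * f (s ^ 4)| ≤ c) :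
    ‖x <• cfcₙ f (hinner B x x)‖ ≤ c := by
  refine norm_le_of_hinner_le (B := B) hc ?_
  rw [hinner_rmul_cfcₙ_self x hf hf0]
  refine norm_cfcₙ_le fun t ht => ?_
  have ht0 : 0 ≤ t := quasispectrum_nonneg_of_nonneg _ (hinner_self_nonneg x) t ht
  have hs4 : √√t ^ 4 = t := by
    rw [show √√t ^ 4 = (√√t ^ 2) ^ 2 by ring, Real.sq_sqrt (Real.sqrt_nonneg t), Real.sq_sqrt ht0]
  have := h √√t (Real.sqrt_nonneg _)
  rw [hs4] at this
  calc ‖f t * (t * f t)‖ = |√√t ^ 2 * f t| ^ 2 := by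
        rw [Real.norm_eq_abs, ← abs_pow]; congr 1
        rw [mul_pow, ← pow_mul, hs4]; ring
    _ ≤ c ^ 2 := by gcongr

theorem norm_sub_rmul_cfcₙ_le (x : E) {f : ℝ → ℝ} (hf : Continuous f) (hf0 : f 0 = 0) {c : ℝ}
    (hc : 0 ≤ c) (h : ∀ s : ℝ, 0 ≤ s → |s ^ 2 * (1 - f (s ^ 4))| ≤ c) :
    ‖x - x <• cfcₙ f (hinner B x x)‖ ≤ c := by
  refine norm_le_of_hinner_le (B := B) hc ?_
  set a := hinner B x x with ha
  have hsa : IsSelfAdjoint a := isSelfAdjoint_hinner_self x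
  have hs : IsSelfAdjoint (cfcₙ f a) := cfcₙ_predicate f _
  have e1 : a * cfcₙ f a = cfcₙ (fun t => t * f t) a := by
    rw [cfcₙ_mul (fun t => t) f _ (by fun_prop) rfl (by fun_prop) hf0, cfcₙ_id' ℝ a]
  have e3 : cfcₙ f a * a = cfcₙ (fun t => f t * t) a := by
    rw [cfcₙ_mul f (fun t => t) _ (by fun_prop) hf0 (by fun_prop) rfl, cfcₙ_id' ℝ a]
  have e2 : cfcₙ f a * (a * cfcₙ f a) = cfcₙ (fun t => f t * (t * f t)) a := by
    rw [e1, ← cfcₙ_mul f (fun t => t * f t) _ (by fun_prop) hf0 (by fun_prop) (by simp)]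
  have e : hinner B (x - x <• cfcₙ f a) (x - x <• cfcₙ f a) =
      cfcₙ (fun t => (t - f t * t) - (t * f t - f t * (t * f t))) a := by
    rw [cfcₙ_sub (fun t => t - f t * t) (fun t => t * f t - f t * (t * f t)) _ (by fun_prop)
      (by simp) (by fun_prop) (by simp), cfcₙ_sub (fun t => t) (fun t => f t * t) _ (by fun_prop)
      (by simp) (by fun_prop) (by simp), cfcₙ_sub (fun t => t * f t) (fun t => f t * (t * f t)) _
      (by fun_prop) (by simp) (by fun_prop) (by simp), ← e2, ← e1, ← e3, cfcₙ_id' ℝ a]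
    simp only [hinner_sub_left, hinner_sub_right, hinner_rmul_left, hinner_rmul_right, hs.star_eq,
      ← ha, sub_mul, mul_assoc]
  rw [e]
  refine norm_cfcₙ_le fun t ht => ?_
  have ht0 : 0 ≤ t := quasispectrum_nonneg_of_nonneg _ (hinner_self_nonneg x) t ht
  have hs4 : √√t ^ 4 = t := by
    rw [show √√t ^ 4 = (√√t ^ 2) ^ 2 by ring, Real.sq_sqrt (Real.sqrt_nonneg t), Real.sq_sqrt ht0]
  have := h √√t (Real.sqrt_nonneg _)
  rw [hs4] at this
  calc ‖(t - f t * t) - (t * f t - f t * (t * f t))‖ = |√√t ^ 2 * (1 - f t)| ^ 2 := by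
        rw [Real.norm_eq_abs, ← abs_pow]; congr 1
        rw [mul_pow, ← pow_mul, hs4]; ring
    _ ≤ c ^ 2 := by gcongr

/-- The approximate fourth root `t ↦ t^{3/4} / (τ⁴ + t)`. -/
noncomputable def approxRoot (τ t : ℝ) : ℝ := √√t ^ 3 / (τ ^ 4 + √√t ^ 4)

theorem continuous_approxRoot {τ : ℝ} (hτ : 0 < τ) : Continuous (approxRoot τ) := by
  unfold approxRoot
  refine Continuous.div (by fun_prop) (by fun_prop) fun t => ?_
  positivity

theorem sqrt_sqrt_pow_four {s : ℝ} (hs : 0 ≤ s) : √√(s ^ 4) = s := by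
  rw [show s ^ 4 = (s ^ 2) ^ 2 by ring, Real.sqrt_sq (by positivity), Real.sqrt_sq hs]

/-- Elements of `E` factorize through the ideal that contains their inner square. -/
theorem exists_rmul_eq_of_hinner_self_mem {U : Set (PrimSpace B)} {x : E}
    (hx : hinner B x x ∈ idealOf U) : ∃ y : E, ∃ b ∈ idealOf U, x = y <• b := by
  set a := hinner B x x with ha
  have hsa : IsSelfAdjoint a := isSelfAdjoint_hinner_self x
  let τ : ℕ → ℝ := fun n => 1 / ((n : ℝ) + 1)
  have hτ : ∀ n, 0 < τ n := fun n => by positivity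
  have hτ0 : Tendsto τ atTop (𝓝 0) := tendsto_one_div_add_atTop_nhds_zero_nat
  let f : ℕ → ℝ → ℝ := fun n => approxRoot (τ n)
  have hf : ∀ n, Continuous (f n) := fun n => continuous_approxRoot (hτ n)
  have hf0 : ∀ n, f n 0 = 0 := fun n => by simp [f, approxRoot]
  have hfs : ∀ n s, 0 ≤ s → f n (s ^ 4) = s ^ 3 / (τ n ^ 4 + s ^ 4) := fun n s hs => by
    simp only [f, approxRoot, sqrt_sqrt_pow_four hs]
  -- Formally y = x·a^{−1/4}, to be multiplied by a^{1/4}. The functions t^{3/4}/(τ⁴ + t) regularize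
  -- t^{−1/4} at the origin.
  let y : ℕ → E := fun n => x <• cfcₙ (f n) a
  have hC : CauchySeq y := by
    refine cauchySeq_of_le_tendsto_0 τ (fun n m N hn hm => ?_) hτ0
    rw [dist_eq_norm]
    have e : y n - y m = x <• cfcₙ (fun t => f n t - f m t) a := by
      rw [cfcₙ_sub (f n) (f m) a (by fun_prop) (hf0 n) (by fun_prop) (hf0 m), rmul_sub]
    rw [e]
    refine norm_rmul_cfcₙ_le x (by fun_prop) (by simp [hf0]) (hτ N).le fun s hs => ?_
    have key : ∀ u v w : ℝ, 0 < u → u ≤ w → 0 < v → v ≤ u →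
        |s ^ 2 * (s ^ 3 / (u ^ 4 + s ^ 4) - s ^ 3 / (v ^ 4 + s ^ 4))| ≤ w := by
      intro u v w hu huw hv hvu
      have h1 : 0 < u ^ 4 + s ^ 4 := by positivity
      have h2 : 0 < v ^ 4 + s ^ 4 := by positivity
      have h3 : v ^ 4 ≤ u ^ 4 := by gcongr
      -- The first factor is at most u because su³ ≤ u⁴ + s⁴; the second is at most 1.
      have e : s ^ 2 * (s ^ 3 / (u ^ 4 + s ^ 4) - s ^ 3 / (v ^ 4 + s ^ 4)) =
          - ((s * (u ^ 4 - v ^ 4) / (u ^ 4 + s ^ 4)) * (s ^ 4 / (v ^ 4 + s ^ 4))) := by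
        field_simp; ring
      have h4 : s ^ 4 / (v ^ 4 + s ^ 4) ≤ 1 := by
        rw [div_le_one h2]; nlinarith [pow_pos hv 4]
      have h5 : s * (u ^ 4 - v ^ 4) / (u ^ 4 + s ^ 4) ≤ u := by
        rw [div_le_iff₀ h1]
        have : s * u ^ 3 ≤ u ^ 4 + s ^ 4 := by
          rcases le_total s u with h | h
          · have : s * u ^ 3 ≤ u * u ^ 3 := by gcongr
            nlinarith [pow_nonneg hs 4]
          · have : s * u ^ 3 ≤ s * s ^ 3 := by gcongr
            nlinarith [pow_pos hu 4]
        nlinarith [mul_nonneg hs (pow_pos hv 4).le]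
      rw [e, abs_neg, abs_of_nonneg (mul_nonneg (div_nonneg (mul_nonneg hs (by linarith)) h1.le)
        (by positivity))]
      calc _ ≤ u * 1 := by
            refine mul_le_mul h5 h4 (by positivity) hu.le
        _ ≤ w := by linarith
    have hτN : ∀ k, N ≤ k → τ k ≤ τ N := fun k hk => by
      simp only [τ]
      gcongr
    rw [hfs n s hs, hfs m s hs]
    rcases le_total (τ m) (τ n) with h | h
    · exact key _ _ _ (hτ n) (hτN n hn) (hτ m) h
    · rw [← abs_neg, ← mul_neg, neg_sub]
      exact key _ _ _ (hτ m) (hτN m hm) (hτ n) h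
  obtain ⟨z, hz⟩ := cauchySeq_tendsto_of_complete hC
  set r : ℝ → ℝ := fun t => √√t with hr
  have hr0 : r 0 = 0 := by simp [hr]
  refine ⟨z, cfcₙ r a, cfcₙ_mem_idealOf hx hsa (by fun_prop) hr0, ?_⟩
  have h1 : Tendsto (fun n => y n <• cfcₙ r a) atTop (𝓝 (z <• cfcₙ r a)) :=
    ((rmulL B E).flip (cfcₙ r a)).continuous.continuousAt.tendsto.comp hz
  have h2 : Tendsto (fun n => y n <• cfcₙ r a) atTop (𝓝 x) := by
    have h3 : Tendsto (fun n => τ n ^ 2) atTop (𝓝 0) := by simpa using hτ0.pow 2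
    rw [tendsto_iff_norm_sub_tendsto_zero]
    refine squeeze_zero (fun _ => norm_nonneg _) (fun n => ?_) h3
    have e : y n <• cfcₙ r a = x <• cfcₙ (fun t => f n t * r t) a := by
      rw [cfcₙ_mul (f n) r a (by fun_prop) (hf0 n) (by fun_prop) hr0, rmul_rmul]
    rw [e, norm_sub_rev]
    refine norm_sub_rmul_cfcₙ_le x (by fun_prop) (by simp [hf0]) (by positivity) fun s hs => ?_
    have h1 : 0 < τ n ^ 4 + s ^ 4 := by have := hτ n; positivity
    -- By s²τ² ≤ s⁴ + τ⁴ the right-hand side is at most τ².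
    have e : s ^ 2 * (1 - f n (s ^ 4) * r (s ^ 4)) = s ^ 2 * τ n ^ 4 / (τ n ^ 4 + s ^ 4) := by
      rw [hfs n s hs, hr]
      simp only [sqrt_sqrt_pow_four hs]
      field_simp; ring
    rw [e, abs_of_nonneg (by positivity), div_le_iff₀ h1]
    nlinarith [sq_nonneg (τ n ^ 2 - s ^ 2), sq_nonneg (τ n), sq_nonneg (τ n * s),
      mul_nonneg (sq_nonneg (τ n)) (sq_nonneg (τ n ^ 2 - s ^ 2)),
      mul_nonneg (sq_nonneg (τ n)) (sq_nonneg (τ n * s)), pow_nonneg hs 4,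
      mul_nonneg (sq_nonneg (τ n)) (sq_nonneg (s ^ 2)),
      mul_nonneg (sq_nonneg (τ n)) (sq_nonneg (τ n ^ 2))]
  exact tendsto_nhds_unique h2 h1

/-- Products x·b are not visibly closed under addition. Membership in `moduleIdeal` is a linear
condition that is monotone in U, so this description makes E_cs a subspace. -/
theorem mem_moduleCompactPart_iff {x : E} : x ∈ moduleCompactPart B E ↔
    ∃ U : Set (PrimSpace B), IsOpen U ∧ IsRelQuasiCompact U ∧ x ∈ moduleIdeal B U := by
  constructor
  · rintro ⟨y, b, ⟨U, hU, hU', hb⟩, rfl⟩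
    exact ⟨U, hU, hU', rmul_mem_moduleIdeal y hb⟩
  · rintro ⟨U, hU, hU', hx⟩
    obtain ⟨y, b, hb, rfl⟩ := exists_rmul_eq_of_hinner_self_mem (hx x)
    exact ⟨y, b, ⟨U, hU, hU', hb⟩, rfl⟩

variable (B E) in
/-- `E_cs` as a linear subspace. -/
def moduleCompactPartSubmodule : Submodule ℂ E where
  carrier := moduleCompactPart B E
  add_mem' {x y} hx hy := by
    rw [mem_moduleCompactPart_iff] at *
    obtain ⟨U, hU, hU', hx⟩ := hx
    obtain ⟨V, hV, hV', hy⟩ := hy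
    exact ⟨U ∪ V, hU.union hV, hU'.union hV', Submodule.add_mem _
      (moduleIdeal_mono Set.subset_union_left hx) (moduleIdeal_mono Set.subset_union_right hy)⟩
  zero_mem' := ⟨0, 0, (compactPartSubmodule B).zero_mem, (rmul_zero 0).symm⟩
  smul_mem' z x := by
    rintro ⟨y, b, hb, rfl⟩
    exact ⟨z • y, b, hb, (smul_rmul z y b).symm⟩

theorem dense_moduleCompactPart : Dense (moduleCompactPart B E) := by
  intro x
  refine Metric.mem_closure_iff.2 fun ε hε => ?_
  obtain ⟨b, hb, -, h, -⟩ := exists_compactPart_approx (B := B) x isCompact_empty hε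
  exact ⟨_, ⟨x, b, hb, rfl⟩, by rwa [dist_comm, dist_eq_norm]⟩

end HilbertModule

/-! ### The Hilbert module structure on a completion. -/

section Completion

open UniformSpace

variable {B E : Type*} [NonUnitalCStarAlgebra B] [PartialOrder B] [StarOrderedRing B]
  [NormedAddCommGroup E] [NormedSpace ℂ E] [SMul Bᵐᵒᵖ E] [CStarModule Bᵐᵒᵖ E]

instance CStarModule.uniformContinuousConstSMul : UniformContinuousConstSMul Bᵐᵒᵖ E :=
  ⟨fun b => ((rmulL B E).flip b.unop).uniformContinuous⟩

theorem CStarModule.completion_inner_coe (a b : E) :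
    inner Bᵐᵒᵖ (a : Completion E) (b : Completion E) = inner Bᵐᵒᵖ a b :=
  (Completion.isDenseInducing_coe.prodMap Completion.isDenseInducing_coe).extend_eq
    (continuous_inner (A := Bᵐᵒᵖ)) (a, b)

/-- Extension of a jointly continuous biadditive map. With this continuity, the module axioms pass
to the completion by density. -/
theorem CStarModule.continuous_completion_inner :
    Continuous fun x : Completion E × Completion E => inner Bᵐᵒᵖ x.1 x.2 := by
  let inner' : E →+ E →+ Bᵐᵒᵖ :=
    { toFun := fun x => (innerₛₗ (A := Bᵐᵒᵖ) x).toAddMonoidHom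
      map_zero' := AddMonoidHom.ext fun x => inner_zero_left
      map_add' := fun x y => AddMonoidHom.ext fun z => inner_add_left }
  have : Continuous fun p : E × E => inner' p.1 p.2 := continuous_inner (A := Bᵐᵒᵖ)
  exact (Completion.isDenseInducing_toCompl E).extend_Z_bilin
    (Completion.isDenseInducing_toCompl E) this

theorem CStarModule.continuous_completion_inner' {X : Type*} [TopologicalSpace X]
    {f g : X → Completion E} (hf : Continuous f) (hg : Continuous g) :
    Continuous fun x => inner Bᵐᵒᵖ (f x) (g x) :=
  CStarModule.continuous_completion_inner.comp (hf.prodMk hg)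

theorem CStarModule.completion_inner_op_smul_right (a : Bᵐᵒᵖ) (x y : Completion E) :
    inner Bᵐᵒᵖ x (a • y) = a * inner Bᵐᵒᵖ x y := by
  refine Completion.induction_on₂ (p := fun x y => inner Bᵐᵒᵖ x (a • y) = a * inner Bᵐᵒᵖ x y) x y
    (isClosed_eq ?_ ?_) fun b c => ?_
  · exact continuous_completion_inner' continuous_fst
      ((uniformContinuous_const_smul a).continuous.comp continuous_snd)
  · exact (continuous_completion_inner (B := B) (E := E)).const_mul a
  · rw [← Completion.coe_smul, completion_inner_coe, completion_inner_coe, inner_op_smul_right]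

theorem CStarModule.completion_inner_smul_right (z : ℂ) (x y : Completion E) :
    inner Bᵐᵒᵖ x (z • y) = z • inner Bᵐᵒᵖ x y := by
  refine Completion.induction_on₂ (p := fun x y => inner Bᵐᵒᵖ x (z • y) = z • inner Bᵐᵒᵖ x y) x y
    (isClosed_eq ?_ ?_) fun b c => ?_
  · exact continuous_completion_inner' continuous_fst (continuous_snd.const_smul z)
  · exact (continuous_completion_inner (B := B) (E := E)).const_smul z
  · rw [← Completion.coe_smul, completion_inner_coe, completion_inner_coe,
      inner_smul_right_complex]

theorem CStarModule.completion_norm_eq (x : Completion E) : ‖x‖ = √‖inner Bᵐᵒᵖ x x‖ := by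
  refine Completion.induction_on (p := fun x : Completion E => ‖x‖ = √‖inner Bᵐᵒᵖ x x‖) x
    (isClosed_eq continuous_norm ?_) fun a => ?_
  · exact (continuous_completion_inner' continuous_id continuous_id).norm.sqrt
  · rw [completion_inner_coe, Completion.norm_coe]
    exact norm_eq_sqrt_norm_inner_self a

/-- The completion of a pre-Hilbert module. -/
noncomputable instance CStarModule.completion : CStarModule Bᵐᵒᵖ (Completion E) where
  inner_add_right {x y z} := Completion.induction_on₃ x y z
    (isClosed_eq (continuous_completion_inner' (by fun_prop) (by fun_prop))
      ((continuous_completion_inner' (by fun_prop) (by fun_prop)).add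
        (continuous_completion_inner' (by fun_prop) (by fun_prop)))) fun a b c => by
      simp only [← Completion.coe_add, completion_inner_coe, inner_add_right]
  inner_self_nonneg {x} := Completion.induction_on x
    (isClosed_le continuous_const (continuous_completion_inner' (by fun_prop) (by fun_prop)))
    fun a => by rw [completion_inner_coe]; exact inner_self_nonneg
  inner_self {x} := by
    rw [← norm_eq_zero (a := x), completion_norm_eq (B := B), Real.sqrt_eq_zero (norm_nonneg _),
      norm_eq_zero]
  inner_op_smul_right {a x y} := completion_inner_op_smul_right a x y
  inner_smul_right_complex {z x y} := completion_inner_smul_right z x y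
  star_inner x y := Completion.induction_on₂ x y
    (isClosed_eq (continuous_completion_inner' (by fun_prop) (by fun_prop)).star
      (continuous_completion_inner' (by fun_prop) (by fun_prop))) fun b c => by
      simp only [completion_inner_coe, star_inner]
  norm_eq_sqrt_norm_inner_self := completion_norm_eq

theorem hinner_coe (a b : E) : hinner B (a : Completion E) (b : Completion E) = hinner B a b :=
  congrArg MulOpposite.unop (CStarModule.completion_inner_coe a b)

end Completion

/-! ### Square-integrable functions through weak pairings. -/

section L2

variable {G : Type*} [Group G] [TopologicalSpace G] [IsTopologicalGroup G]
  [MeasurableSpace G] [BorelSpace G] (μ : Measure G) [μ.IsHaarMeasure]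
  {B : Type*} [NonUnitalCStarAlgebra B] [PartialOrder B] [StarOrderedRing B]

theorem hinner_toL2 (f h : C_c(G, B)) :
    hinner B (toL2 μ f) (toL2 μ h) = ∫ g, star (f g) * h g ∂μ :=
  hinner_coe (E := PreL2 μ B) (show PreL2 μ B from f) (show PreL2 μ B from h)

/-- `toL2` as a linear map. -/
noncomputable def toL2Linear : C_c(G, B) →ₗ[ℂ] L2 μ B where
  toFun := toL2 μ
  map_add' f h := UniformSpace.Completion.coe_add (show PreL2 μ B from f) (show PreL2 μ B from h)
  map_smul' z f := UniformSpace.Completion.coe_smul z (show PreL2 μ B from f)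

theorem toL2_add (f h : C_c(G, B)) : toL2 μ (f + h) = toL2 μ f + toL2 μ h :=
  (toL2Linear μ).map_add f h

theorem toL2_sub (f h : C_c(G, B)) : toL2 μ (f - h) = toL2 μ f - toL2 μ h :=
  (toL2Linear μ).map_sub f h

theorem toL2_smul (z : ℂ) (f : C_c(G, B)) : toL2 μ (z • f) = z • toL2 μ f :=
  (toL2Linear μ).map_smul z f

theorem denseRange_toL2 : DenseRange (toL2 μ : C_c(G, B) → L2 μ B) :=
  UniformSpace.Completion.denseRange_coe (α := PreL2 μ B)

theorem integrable_star_mul_continuousMap (f : C_c(G, B)) (h : C(G, B)) :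
    Integrable (fun g => star (f g) * h g) μ := by
  refine Continuous.integrable_of_hasCompactSupport (by fun_prop) ?_
  refine f.hasCompactSupport.mono fun g hg => ?_
  rw [Function.mem_support] at hg ⊢
  contrapose! hg
  simp [hg]

/-- The `L²` norm of a function supported in a compact set is controlled by the supremum norm. -/
theorem norm_toL2_le {f : C_c(G, B)} {K : Set G} (hK : IsCompact K) (hf : ∀ g ∉ K, f g = 0)
    {c : ℝ} (hc : ∀ g, ‖f g‖ ≤ c) : ‖toL2 μ f‖ ≤ c * √(μ.real K) := by
  have hc0 : 0 ≤ c := (norm_nonneg _).trans (hc 1)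
  refine norm_le_of_hinner_le (B := B) (by positivity) ?_
  rw [hinner_toL2, mul_pow, Real.sq_sqrt measureReal_nonneg]
  have h1 : ∫ g, star (f g) * f g ∂μ = ∫ g in K, star (f g) * f g ∂μ := by
    refine (setIntegral_eq_integral_of_forall_compl_eq_zero fun g hg => ?_).symm
    simp [hf g hg]
  rw [h1]
  refine norm_setIntegral_le_of_norm_le_const hK.measure_lt_top fun g _ => ?_
  rw [CStarRing.norm_star_mul_self, sq]
  exact mul_le_mul (hc g) (hc g) (norm_nonneg _) hc0

theorem norm_toL2_le_norm_toL2 {f h : C_c(G, B)}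
    (hfh : ∀ g, star (f g) * f g ≤ star (h g) * h g) : ‖toL2 μ f‖ ≤ ‖toL2 μ h‖ := by
  refine norm_le_of_hinner_le (B := B) (norm_nonneg _) ?_
  rw [norm_sq_eq_norm_hinner (B := B), hinner_toL2, hinner_toL2]
  refine CStarAlgebra.norm_le_norm_of_nonneg_of_le
    (integral_nonneg fun g => star_mul_self_nonneg _) ?_
  exact integral_mono (PreL2.integrable_star_mul μ f f) (PreL2.integrable_star_mul μ h h) hfh

@[simp]
theorem cutoff_apply (χ : C_c(G, ℝ)) (f : C(G, B)) (g : G) : cutoff χ f g = χ g • f g := rfl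

theorem eventually_cutoffFilter {K : Set G} (hK : IsCompact K) {ε : ℝ} (hε : 0 < ε) :
    ∀ᶠ χ in cutoffFilter G, (∀ g, χ g ∈ Set.Icc (0 : ℝ) 1) ∧ ∀ g ∈ K, |χ g - 1| < ε := by
  refine Filter.Eventually.and (mem_inf_of_right (mem_principal_self _)) (mem_inf_of_left ?_)
  refine mem_comap.2 ⟨{f | ∀ g ∈ K, |f g - 1| < ε}, ?_, fun χ h => h⟩
  have h1 := ContinuousMap.tendsto_iff_forall_isCompact_tendstoUniformlyOn.1
    (tendsto_id (x := 𝓝 (1 : C(G, ℝ)))) K hK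
  have h2 := Metric.tendstoUniformlyOn_iff.1 h1 ε hε
  filter_upwards [h2] with f hf g hg
  have := hf g hg
  rwa [dist_comm, Real.dist_eq] at this

/-- Urysohn functions that equal 1 on a prescribed compact set lie in every set of the filter;
without this, limits along it would not be unique. -/
theorem cutoffFilter_neBot [LocallyCompactSpace G] [T2Space G] : (cutoffFilter G).NeBot := by
  refine ⟨fun h => ?_⟩
  rw [cutoffFilter, ← disjoint_iff, Filter.disjoint_principal_right, mem_comap] at h
  obtain ⟨t, ht, h⟩ := h
  obtain ⟨⟨K, V⟩, ⟨hK, hV⟩, hKV⟩ := (nhds_basis_uniformity'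
    (ContinuousMap.hasBasis_compactConvergenceUniformity (α := G) (β := ℝ))).mem_iff.1 ht
  obtain ⟨f, hf1, -, hfc, hf01⟩ := exists_continuous_one_zero_of_isCompact hK isClosed_empty
    (Set.disjoint_empty K)
  refine h (a := ⟨f, hfc⟩) (hKV fun g hg => ?_) hf01
  have : f g = 1 := hf1 hg
  change ((1 : ℝ), f g) ∈ V
  rw [this]
  exact refl_mem_uniformity hV

/-- The cutoffs of a continuous function converge to `F` in `L²` if the function pairs with
compactly supported functions in the same way as `F`. -/
theorem tendsto_cutoff {h : C(G, B)} {F : L2 μ B}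
    (hF : ∀ f : C_c(G, B), hinner B (toL2 μ f) F = ∫ g, star (f g) * h g ∂μ) :
    Tendsto (fun χ => toL2 μ (cutoff χ h)) (cutoffFilter G) (𝓝 F) := by
  rw [Metric.tendsto_nhds]
  intro ε hε
  obtain ⟨_, ⟨f₀, rfl⟩, hf₀⟩ := Metric.mem_closure_iff.1 (denseRange_toL2 μ F) (ε / 4)
    (by positivity)
  rw [dist_eq_norm] at hf₀
  obtain ⟨M, hM⟩ := f₀.hasCompactSupport.exists_bound_of_continuous f₀.continuous
  have hM0 : 0 ≤ M := (norm_nonneg _).trans (hM 1)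
  have hK : IsCompact (tsupport f₀) := f₀.hasCompactSupport
  set N := M * √(μ.real (tsupport f₀)) with hN
  have hN0 : 0 ≤ N := by positivity
  filter_upwards [eventually_cutoffFilter hK (show 0 < ε / (4 * (N + 1)) by positivity)]
  rintro χ ⟨h01, hχ⟩
  have h1 : ‖toL2 μ (cutoff χ (f₀ : C(G, B))) - toL2 μ f₀‖ ≤ ε / 4 := by
    rw [← toL2_sub]
    have e : ∀ g, (cutoff χ (f₀ : C(G, B)) - f₀) g = (χ g - 1) • f₀ g := fun g => by
      rw [sub_smul, one_smul]; rfl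
    refine (norm_toL2_le μ hK (c := ε / (4 * (N + 1)) * M) (fun g hg => ?_) fun g => ?_).trans ?_
    · rw [e, image_eq_zero_of_notMem_tsupport hg, smul_zero]
    · rw [e, norm_smul, Real.norm_eq_abs]
      by_cases hg : g ∈ tsupport f₀
      · exact mul_le_mul (hχ g hg).le (hM g) (norm_nonneg _) (by positivity)
      · rw [image_eq_zero_of_notMem_tsupport hg, norm_zero, mul_zero]
        positivity
    · rw [mul_assoc, ← hN, div_mul_eq_mul_div, div_le_div_iff₀ (by positivity) (by positivity)]
      nlinarith
  -- For c = χ(h − f₀) one has ⟨c|c⟩ = ⟨χc|F − f₀⟩, and ‖χc‖ ≤ ‖c‖ because 0 ≤ χ ≤ 1. So ‖c‖ is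
  -- controlled by ‖F − f₀‖, with no a priori bound on the cutoffs of h.
  set k : C(G, B) := h - (f₀ : C(G, B)) with hk
  set c : C_c(G, B) := cutoff χ k with hc
  have h2 : ‖toL2 μ c‖ ≤ ε / 4 := by
    have e1 : hinner B (toL2 μ c) (toL2 μ c) =
        hinner B (toL2 μ (cutoff χ (c : C(G, B)))) (F - toL2 μ f₀) := by
      rw [hinner_sub_right, hF, hinner_toL2, hinner_toL2, ← integral_sub
        (integrable_star_mul_continuousMap μ _ _) (PreL2.integrable_star_mul μ _ _)]
      refine integral_congr_ae (Eventually.of_forall fun g => ?_)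
      change star (χ g • k g) * (χ g • k g) = star (χ g • (χ g • k g)) * h g -
        star (χ g • (χ g • k g)) * f₀ g
      rw [← mul_sub, star_smul, star_smul, star_smul, star_trivial, smul_mul_assoc, smul_mul_assoc,
        smul_mul_assoc, mul_smul_comm]
      rfl
    have e2 : ‖toL2 μ (cutoff χ (c : C(G, B)))‖ ≤ ‖toL2 μ c‖ := by
      refine norm_toL2_le_norm_toL2 μ fun g => ?_
      change star (χ g • c g) * (χ g • c g) ≤ _
      rw [star_smul, star_trivial, smul_mul_assoc, mul_smul_comm, smul_smul]
      refine smul_le_of_le_one_left (star_mul_self_nonneg (c g)) ?_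
      exact mul_le_one₀ (h01 g).2 (h01 g).1 (h01 g).2
    have e3 : ‖toL2 μ c‖ ^ 2 ≤ ‖toL2 μ c‖ * (ε / 4) := by
      rw [norm_sq_eq_norm_hinner (B := B), e1]
      refine (norm_hinner_le _ _).trans ?_
      gcongr
    rcases eq_or_lt_of_le (norm_nonneg (toL2 μ c)) with h0 | h0
    · rw [← h0]; positivity
    · rw [sq] at e3
      exact le_of_mul_le_mul_left e3 h0
  have e : toL2 μ (cutoff χ h) - F =
      toL2 μ c + (toL2 μ (cutoff χ (f₀ : C(G, B))) - toL2 μ f₀) - (F - toL2 μ f₀) := by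
    have : cutoff χ h = c + cutoff χ (f₀ : C(G, B)) := by
      ext g
      change χ g • h g = χ g • (h g - f₀ g) + χ g • f₀ g
      rw [← smul_add, sub_add_cancel]
    rw [this, toL2_add]
    abel
  rw [dist_eq_norm, e]
  calc _ ≤ ‖toL2 μ c‖ + ‖toL2 μ (cutoff χ (f₀ : C(G, B))) - toL2 μ f₀‖ + ‖F - toL2 μ f₀‖ :=
        (norm_sub_le _ _).trans (add_le_add_left (norm_add_le _ _) _)
    _ < ε := by linarith

variable [LocallyCompactSpace G] [T2Space G]

theorem hinner_toL2_of_tendsto_cutoff {h : C(G, B)} {F : L2 μ B}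
    (hF : Tendsto (fun χ => toL2 μ (cutoff χ h)) (cutoffFilter G) (𝓝 F)) (f : C_c(G, B)) :
    hinner B (toL2 μ f) F = ∫ g, star (f g) * h g ∂μ := by
  have := cutoffFilter_neBot (G := G)
  have h1 : Tendsto (fun χ => hinner B (toL2 μ f) (toL2 μ (cutoff χ h))) (cutoffFilter G)
      (𝓝 (hinner B (toL2 μ f) F)) :=
    ((hinnerL B (toL2 μ f)).continuous.tendsto F).comp hF
  refine tendsto_nhds_unique h1 ?_
  have hK : IsCompact (tsupport f) := f.hasCompactSupport
  have hint := integrable_star_mul_continuousMap μ f h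
  rw [Metric.tendsto_nhds]
  intro ε hε
  set N := ∫ g, ‖star (f g) * h g‖ ∂μ with hN
  have hN0 : 0 ≤ N := integral_nonneg fun g => norm_nonneg _
  filter_upwards [eventually_cutoffFilter hK (show 0 < ε / (2 * (N + 1)) by positivity)]
  rintro χ ⟨-, hχ⟩
  rw [dist_eq_norm, hinner_toL2, ← integral_sub (PreL2.integrable_star_mul μ _ _) hint]
  calc ‖∫ g, (star (f g) * cutoff χ h g - star (f g) * h g) ∂μ‖
      ≤ ∫ g, ε / (2 * (N + 1)) * ‖star (f g) * h g‖ ∂μ := by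
        refine norm_integral_le_of_norm_le (hint.norm.const_mul _)
          (Eventually.of_forall fun g => ?_)
        rw [cutoff_apply, mul_smul_comm]
        by_cases hg : g ∈ tsupport f
        · calc ‖χ g • (star (f g) * h g) - star (f g) * h g‖
              = |χ g - 1| * ‖star (f g) * h g‖ := by
                rw [← Real.norm_eq_abs, ← norm_smul, sub_smul, one_smul]
            _ ≤ _ := by gcongr; exact (hχ g hg).le
        · simp [image_eq_zero_of_notMem_tsupport hg]
    _ = ε / (2 * (N + 1)) * N := integral_const_mul _ _
    _ < ε := by
        rw [div_mul_eq_mul_div, div_lt_iff₀ (by positivity)]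
        nlinarith

/-- Convergence of cutoffs is equivalent to the existence of a vector with the right pairings. All
later questions of square-integrability use this weak form. -/
theorem isSquareIntegrable_iff {h : C(G, B)} : IsSquareIntegrable μ h ↔
    ∃ F : L2 μ B, ∀ f : C_c(G, B), hinner B (toL2 μ f) F = ∫ g, star (f g) * h g ∂μ :=
  ⟨fun ⟨F, hF⟩ => ⟨F, hinner_toL2_of_tendsto_cutoff μ hF⟩, fun ⟨F, hF⟩ => ⟨F, tendsto_cutoff μ hF⟩⟩

theorem l2Limit_eq {h : C(G, B)} {F : L2 μ B}
    (hF : ∀ f : C_c(G, B), hinner B (toL2 μ f) F = ∫ g, star (f g) * h g ∂μ) :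
    l2Limit μ h = F := by
  have := cutoffFilter_neBot (G := G)
  exact (tendsto_cutoff μ hF).limUnder_eq

theorem hinner_toL2_l2Limit {h : C(G, B)} (hh : IsSquareIntegrable μ h) (f : C_c(G, B)) :
    hinner B (toL2 μ f) (l2Limit μ h) = ∫ g, star (f g) * h g ∂μ := by
  obtain ⟨F, hF⟩ := (isSquareIntegrable_iff μ).1 hh
  rw [l2Limit_eq μ hF, hF]

end L2

/-! ### Continuous kernels with compact support. -/

section ParametricIntegral

variable {G : Type*} [TopologicalSpace G] [R1Space G]
  [MeasurableSpace G] [BorelSpace G] (μ : Measure G) [IsFiniteMeasureOnCompacts μ]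
  {V : Type*} [NormedAddCommGroup V] [NormedSpace ℝ V]

/-- Prepares Fubini for compactly supported continuous kernels, where G need not be σ-finite. -/
theorem HasCompactSupport.of_prod {Φ : G → G → V} {K L : Set G} (hK : IsCompact K)
    (hL : IsCompact L) (h1 : ∀ g ∉ K, ∀ h, Φ g h = 0) (h2 : ∀ g, ∀ h ∉ L, Φ g h = 0) :
    HasCompactSupport Φ.uncurry := by
  refine HasCompactSupport.intro (hK.prod hL) ?_
  rintro ⟨g, h⟩ hgh
  by_cases hg : g ∈ K
  · exact h2 g h fun hh => hgh ⟨hg, hh⟩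
  · exact h1 g hg h

theorem Continuous.integral_of_hasCompactSupport {Φ : G → G → V} (hΦ : Continuous Φ.uncurry)
    {L : Set G} (hL : IsCompact L) (h2 : ∀ g, ∀ h ∉ L, Φ g h = 0) :
    Continuous fun g => ∫ h, Φ g h ∂μ := by
  rw [← continuousOn_univ]
  exact continuousOn_integral_of_compact_support (f := Φ) hL hΦ.continuousOn
    fun g h _ hh => h2 g h hh

end ParametricIntegral

/-! ### The operators ρ_K and the reduced crossed product. -/

section Rho

variable {G : Type*} [Group G] [TopologicalSpace G] [IsTopologicalGroup G]
  [MeasurableSpace G] [BorelSpace G] (μ : Measure G) [μ.IsHaarMeasure]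
  {B : Type*} [NonUnitalCStarAlgebra B]
  (β : GCStarAction G B)

namespace GCStarAction

@[fun_prop]
theorem continuous_apply₂ {X : Type*} [TopologicalSpace X] {u : X → G} {v : X → B}
    (hu : Continuous u) (hv : Continuous v) : Continuous fun x => β (u x) (v x) :=
  β.continuous_uncurry.comp (hu.prodMk hv)

/-- The automorphism `β_g` as a continuous linear map. -/
noncomputable def toCLM (g : G) : B →L[ℂ] B where
  toFun := β g
  map_add' := map_add _
  map_smul' z b := map_smul (β g) z b
  cont := by fun_prop

@[simp]
theorem toCLM_apply (g : G) (b : B) : β.toCLM g b = β g b := rfl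

theorem apply_integral {X : Type*} [MeasurableSpace X] (ν : Measure X) (g : G) {f : X → B}
    (hf : Integrable f ν) : β g (∫ x, f x ∂ν) = ∫ x, β g (f x) ∂ν :=
  ((β.toCLM g).integral_comp_comm hf).symm

/-- The involution `K⋆(g) = β_g(K(g⁻¹))⋆` of the crossedConvolution algebra. -/
noncomputable def involution (K : C_c(G, B)) : C_c(G, B) where
  toFun g := β g (star (K g⁻¹))
  continuous_toFun := by fun_prop
  hasCompactSupport' := by
    refine (K.hasCompactSupport.comp_homeomorph (Homeomorph.inv G)).mono fun g hg => ?_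
    rw [Function.mem_support] at hg ⊢
    contrapose! hg
    change K g⁻¹ = 0 at hg
    rw [hg, star_zero, map_zero]

/-- The function `g ↦ β_g(K(g⁻¹))`. -/
noncomputable def reflect (K : C_c(G, B)) : C_c(G, B) where
  toFun g := β g (K g⁻¹)
  continuous_toFun := by fun_prop
  hasCompactSupport' := by
    refine (K.hasCompactSupport.comp_homeomorph (Homeomorph.inv G)).mono fun g hg => ?_
    rw [Function.mem_support] at hg ⊢
    contrapose! hg
    change K g⁻¹ = 0 at hg
    rw [hg, map_zero]

theorem involution_apply (K : C_c(G, B)) (g : G) : β.involution K g = β g (star (K g⁻¹)) := rfl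

theorem reflect_apply (K : C_c(G, B)) (g : G) : β.reflect K g = β g (K g⁻¹) := rfl

end GCStarAction

theorem rho_apply (K f : C_c(G, B)) (g : G) :
    rho μ β K f g = ∫ h, β g (K (g⁻¹ * h)) * f h ∂μ := rfl

theorem integrable_rho (K f : C_c(G, B)) (g : G) :
    Integrable (fun h => β g (K (g⁻¹ * h)) * f h) μ :=
  Continuous.integrable_of_hasCompactSupport (by fun_prop) f.hasCompactSupport.mul_left

theorem rho_add_right (K f h : C_c(G, B)) : rho μ β K (f + h) = rho μ β K f + rho μ β K h := by
  ext g
  change ∫ k, β g (K (g⁻¹ * k)) * (f k + h k) ∂μ = _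
  simp_rw [mul_add]
  exact integral_add (integrable_rho μ β K f g) (integrable_rho μ β K h g)

theorem rho_smul_right (z : ℂ) (K f : C_c(G, B)) : rho μ β K (z • f) = z • rho μ β K f := by
  ext g
  change ∫ k, β g (K (g⁻¹ * k)) * (z • f k) ∂μ = z • ∫ k, β g (K (g⁻¹ * k)) * f k ∂μ
  simp_rw [mul_smul_comm]
  exact integral_smul z _

theorem rho_add_left (K L f : C_c(G, B)) : rho μ β (K + L) f = rho μ β K f + rho μ β L f := by
  ext g
  change ∫ k, β g (K (g⁻¹ * k) + L (g⁻¹ * k)) * f k ∂μ = _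
  simp_rw [map_add, add_mul]
  exact integral_add (integrable_rho μ β K f g) (integrable_rho μ β L f g)

theorem rho_smul_left (z : ℂ) (K f : C_c(G, B)) : rho μ β (z • K) f = z • rho μ β K f := by
  ext g
  change ∫ k, β g (z • K (g⁻¹ * k)) * f k ∂μ = z • ∫ k, β g (K (g⁻¹ * k)) * f k ∂μ
  simp_rw [map_smul, smul_mul_assoc]
  exact integral_smul z _

/-- The kernel of `ρ_K`, for a fixed row. -/
noncomputable def rhoRow (K : C_c(G, B)) (g : G) : C_c(G, B) where
  toFun h := β g (K (g⁻¹ * h))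
  continuous_toFun := by fun_prop
  hasCompactSupport' := by
    refine (K.hasCompactSupport.comp_homeomorph (Homeomorph.mulLeft g⁻¹)).mono fun h hh => ?_
    rw [Function.mem_support] at hh ⊢
    contrapose! hh
    change K (g⁻¹ * h) = 0 at hh
    rw [hh, map_zero]

variable [PartialOrder B] [StarOrderedRing B]

/-- The kernel of ρ_K is β_g(K(g⁻¹h)); interchanging g and h and taking adjoints yields the kernel
of the involution. No modular function appears since both variables are integrated against left Haar
measure. -/
theorem hinner_rho_left (K f h : C_c(G, B)) :
    hinner B (toL2 μ (rho μ β K f)) (toL2 μ h) =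
      hinner B (toL2 μ f) (toL2 μ (rho μ β (β.involution K) h)) := by
  rw [hinner_toL2, hinner_toL2]
  have e1 : ∀ g, star (rho μ β K f g) * h g =
      ∫ k, star (f k) * star (β g (K (g⁻¹ * k))) * h g ∂μ := by
    intro g
    have hi := integrable_rho μ β K f g
    have e2 : star (rho μ β K f g) = ∫ k, star (f k) * star (β g (K (g⁻¹ * k))) ∂μ := by
      rw [rho_apply]
      refine ((starL' ℝ : B ≃L[ℝ] B).integral_comp_comm _).symm.trans ?_
      exact integral_congr_ae (Eventually.of_forall fun k => by simp)
    rw [e2]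
    refine (((ContinuousLinearMap.mul ℂ B).flip (h g)).integral_comp_comm
      (φ := fun k => star (f k) * star (β g (K (g⁻¹ * k)))) ?_).symm
    exact Continuous.integrable_of_hasCompactSupport (by fun_prop)
      (f.hasCompactSupport.comp_left (g := star) (star_zero B)).mul_right
  have e2 : ∀ k, star (f k) * rho μ β (β.involution K) h k =
      ∫ g, star (f k) * star (β g (K (g⁻¹ * k))) * h g ∂μ := by
    intro k
    rw [rho_apply]
    refine ((ContinuousLinearMap.mul ℂ B (star (f k))).integral_comp_comm
      (integrable_rho μ β (β.involution K) h k)).symm.trans ?_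
    refine integral_congr_ae (Eventually.of_forall fun g => ?_)
    simp only [ContinuousLinearMap.mul_apply', GCStarAction.involution_apply]
    rw [← β.mul_apply, mul_inv_cancel_left, mul_assoc, mul_inv_rev, inv_inv, map_star (β g)]
  simp_rw [e1, e2]
  refine integral_integral_swap_of_hasCompactSupport ?_ ?_
  · have : Continuous fun x : G × G => star (f x.2) * star (β x.1 (K (x.1⁻¹ * x.2))) * h x.1 := by
      fun_prop
    exact this
  · refine HasCompactSupport.of_prod h.hasCompactSupport f.hasCompactSupport
      (fun g hg k => ?_) fun g k hk => ?_
    · rw [image_eq_zero_of_notMem_tsupport hg, mul_zero]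
    · rw [image_eq_zero_of_notMem_tsupport hk, star_zero, zero_mul, zero_mul]

/-- The norm of this function is √‖a x‖, which tends to 0 at the zeros of a. -/
theorem continuous_inv_sqrt_norm_smul {X : Type*} [TopologicalSpace X] {a : X → B}
    (ha : Continuous a) : Continuous fun x => (√‖a x‖)⁻¹ • a x := by
  rw [continuous_iff_continuousAt]
  intro x
  by_cases hx : a x = 0
  · rw [ContinuousAt, hx, smul_zero]
    refine squeeze_zero_norm (a := fun y => √‖a y‖) (fun y => ?_) ?_
    · rw [norm_smul, norm_inv, Real.norm_of_nonneg (Real.sqrt_nonneg _)]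
      nth_rewrite 2 [← Real.mul_self_sqrt (norm_nonneg (a y))]
      rcases eq_or_ne (√‖a y‖) 0 with h | h
      · simp [h]
      · rw [inv_mul_cancel_left₀ h]
    · have : Continuous fun y => √‖a y‖ := Real.continuous_sqrt.comp ha.norm
      simpa [hx] using this.tendsto x
  · have h : ContinuousAt (fun x => (√‖a x‖)⁻¹) x :=
      (Real.continuous_sqrt.comp ha.norm).continuousAt.inv₀
        (Real.sqrt_pos.2 (norm_pos_iff.2 hx)).ne'
    exact h.smul ha.continuousAt

/-- A weighted Cauchy–Schwarz inequality for integrals. -/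
theorem star_integral_mul_integral_le (a f : C_c(G, B)) :
    star (∫ g, a g * f g ∂μ) * ∫ g, a g * f g ∂μ ≤
      (∫ g, ‖a g‖ ∂μ) • ∫ g, ‖a g‖ • (star (f g) * f g) ∂μ := by
  -- Splits af as (‖a‖^{−1/2}a)(‖a‖^{1/2}f) and applies Cauchy–Schwarz in L²(G, B). Where a
  -- vanishes, so does the first factor, by the convention 0⁻¹ = 0.
  let x : C_c(G, B) :=
    { toFun := fun g => star ((√‖a g‖)⁻¹ • a g)
      continuous_toFun := (continuous_inv_sqrt_norm_smul a.continuous).star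
      hasCompactSupport' := a.hasCompactSupport.mono fun g hg => by
        rw [Function.mem_support] at hg ⊢
        contrapose! hg
        rw [hg, smul_zero, star_zero] }
  let y : C_c(G, B) :=
    { toFun := fun g => √‖a g‖ • f g
      continuous_toFun := by fun_prop
      hasCompactSupport' := f.hasCompactSupport.smul_left }
  have e1 : hinner B (toL2 μ x) (toL2 μ y) = ∫ g, a g * f g ∂μ := by
    rw [hinner_toL2]
    refine integral_congr_ae (Eventually.of_forall fun g => ?_)
    change star (star ((√‖a g‖)⁻¹ • a g)) * (√‖a g‖ • f g) = _
    rw [star_star, smul_mul_assoc, mul_smul_comm, smul_smul]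
    by_cases hg : a g = 0
    · simp [hg]
    · rw [inv_mul_cancel₀ (Real.sqrt_pos.2 (norm_pos_iff.2 hg)).ne', one_smul]
  have e2 : hinner B (toL2 μ y) (toL2 μ y) = ∫ g, ‖a g‖ • (star (f g) * f g) ∂μ := by
    rw [hinner_toL2]
    refine integral_congr_ae (Eventually.of_forall fun g => ?_)
    change star (√‖a g‖ • f g) * (√‖a g‖ • f g) = _
    rw [star_smul, star_trivial, smul_mul_assoc, mul_smul_comm, smul_smul,
      Real.mul_self_sqrt (norm_nonneg _)]
  have e3 : ‖toL2 μ x‖ ^ 2 ≤ ∫ g, ‖a g‖ ∂μ := by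
    rw [norm_sq_eq_norm_hinner (B := B), hinner_toL2]
    refine norm_integral_le_of_norm_le
      (a.continuous.norm.integrable_of_hasCompactSupport a.hasCompactSupport.norm)
      (Eventually.of_forall fun g => ?_)
    change ‖star (star ((√‖a g‖)⁻¹ • a g)) * star ((√‖a g‖)⁻¹ • a g)‖ ≤ _
    rw [CStarRing.norm_star_mul_self, norm_star, norm_smul, norm_inv,
      Real.norm_of_nonneg (Real.sqrt_nonneg _)]
    by_cases hg : a g = 0
    · simp [hg]
    · have h1 := Real.sqrt_pos.2 (norm_pos_iff.2 hg)
      have h2 := Real.mul_self_sqrt (norm_nonneg (a g))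
      rw [inv_mul_eq_div, ← sq]
      nth_rewrite 1 [← h2]
      rw [mul_div_assoc, div_self h1.ne', mul_one, sq, h2]
  have key := hinner_mul_hinner_le (B := B) (toL2 μ x) (toL2 μ y)
  rw [← star_hinner (toL2 μ x), e1, e2] at key
  refine key.trans (smul_le_smul_of_nonneg_right e3 (integral_nonneg fun g => ?_))
  exact smul_nonneg (norm_nonneg _) (star_mul_self_nonneg _)

/-- The bound `(∫ ‖K(g)‖ dg · ∫ ‖K(g⁻¹)‖ dg)^{1/2}` for the norm of `ρ_K`. -/
noncomputable def rhoBound (K : C_c(G, B)) : ℝ := √((∫ g, ‖K g‖ ∂μ) * ∫ g, ‖K g⁻¹‖ ∂μ)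

/-- Schur's test: the rows of ‖K(g⁻¹h)‖ have integral ∫ ‖K(g)‖ dg and the columns ∫ ‖K(g⁻¹)‖ dg,
both by left invariance. The row bound enters through the weighted Cauchy–Schwarz inequality, the
column bound after Fubini. -/
theorem norm_toL2_rho_le (K f : C_c(G, B)) :
    ‖toL2 μ (rho μ β K f)‖ ≤ rhoBound μ K * ‖toL2 μ f‖ := by
  have hc1 : 0 ≤ ∫ g, ‖K g‖ ∂μ := integral_nonneg fun g => norm_nonneg _
  have hc2 : 0 ≤ ∫ g, ‖K g⁻¹‖ ∂μ := integral_nonneg fun g => norm_nonneg _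
  refine norm_le_of_hinner_le (B := B) (by unfold rhoBound; positivity) ?_
  set F : G → B := fun h => star (f h) * f h with hF
  set Φ : G → G → B := fun g h => ‖K (g⁻¹ * h)‖ • F h with hΦ
  have hΦc : Continuous Φ.uncurry := by
    have : Continuous fun x : G × G => ‖K (x.1⁻¹ * x.2)‖ • F x.2 := by fun_prop
    exact this
  have hL : ∀ g, ∀ h ∉ tsupport f, Φ g h = 0 := fun g h hh => by
    simp [hΦ, hF, image_eq_zero_of_notMem_tsupport hh]
  have hS : ∀ g ∉ (fun x : G × G => x.1 * x.2⁻¹) '' (tsupport f ×ˢ tsupport K), ∀ h,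
      Φ g h = 0 := by
    intro g hg h
    by_cases hh : h ∈ tsupport f
    · have : g⁻¹ * h ∉ tsupport K := fun h' => hg ⟨(h, g⁻¹ * h), ⟨hh, h'⟩, by simp⟩
      simp [hΦ, image_eq_zero_of_notMem_tsupport this]
    · exact hL g h hh
  have hSc : IsCompact ((fun x : G × G => x.1 * x.2⁻¹) '' (tsupport f ×ˢ tsupport K)) :=
    (f.hasCompactSupport.isCompact.prod K.hasCompactSupport.isCompact).image (by fun_prop)
  have hint : Integrable (fun g => ∫ h, Φ g h ∂μ) μ := by
    refine (Continuous.integral_of_hasCompactSupport μ hΦc f.hasCompactSupport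
      hL).integrable_of_hasCompactSupport (HasCompactSupport.intro hSc fun g hg => ?_)
    simp [hS g hg]
  have e1 : ∀ g, star (rho μ β K f g) * rho μ β K f g ≤
      (∫ g, ‖K g‖ ∂μ) • ∫ h, Φ g h ∂μ := by
    intro g
    have := star_integral_mul_integral_le μ (rhoRow β K g) f
    have e : ∀ h, ‖rhoRow β K g h‖ = ‖K (g⁻¹ * h)‖ := fun h => β.norm_apply g _
    simp only [e] at this
    rwa [integral_mul_left_eq_self (fun h => ‖K h‖) g⁻¹] at this
  have e2 : ∫ g, ∫ h, Φ g h ∂μ ∂μ = (∫ g, ‖K g⁻¹‖ ∂μ) • ∫ h, F h ∂μ := by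
    rw [integral_integral_swap_of_hasCompactSupport hΦc
      (HasCompactSupport.of_prod hSc f.hasCompactSupport hS hL), ← integral_smul]
    refine integral_congr_ae (Eventually.of_forall fun h => ?_)
    simp only [hΦ]
    rw [integral_smul_const]
    congr 1
    rw [← integral_mul_left_eq_self _ h]
    simp
  rw [hinner_toL2, mul_pow, norm_sq_eq_norm_hinner (B := B), hinner_toL2, rhoBound,
    Real.sq_sqrt (mul_nonneg hc1 hc2)]
  calc ‖∫ g, star (rho μ β K f g) * rho μ β K f g ∂μ‖
      ≤ ‖∫ g, (∫ g, ‖K g‖ ∂μ) • ∫ h, Φ g h ∂μ ∂μ‖ := by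
        refine CStarAlgebra.norm_le_norm_of_nonneg_of_le
          (integral_nonneg fun g => star_mul_self_nonneg _) ?_
        exact integral_mono (PreL2.integrable_star_mul μ _ _) (hint.smul (∫ g, ‖K g‖ ∂μ)) e1
    _ = _ := by
        rw [integral_smul, e2, smul_smul, norm_smul, Real.norm_of_nonneg (mul_nonneg hc1 hc2)]

/-- The operator `ρ_K` on `L²(G, B)`. -/
noncomputable def rhoOp (K : C_c(G, B)) : L2 μ B →L[ℂ] L2 μ B :=
  let T : PreL2 μ B →ₗ[ℂ] L2 μ B :=
    { toFun := fun f => toL2 μ (rho μ β K f)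
      map_add' := fun f h => (congrArg (toL2 μ) (rho_add_right μ β K f h)).trans (toL2_add μ _ _)
      map_smul' := fun z f =>
        (congrArg (toL2 μ) (rho_smul_right μ β z K f)).trans (toL2_smul μ _ _) }
  (T.mkContinuous (rhoBound μ K) fun f => by
    refine (norm_toL2_rho_le μ β K f).trans_eq ?_
    exact congrArg _ (UniformSpace.Completion.norm_coe (show PreL2 μ B from f))).extend
    (UniformSpace.Completion.toComplL (𝕜 := ℂ) (E := PreL2 μ B))

theorem rhoOp_toL2 (K f : C_c(G, B)) : rhoOp μ β K (toL2 μ f) = toL2 μ (rho μ β K f) :=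
  ContinuousLinearMap.extend_eq _ UniformSpace.Completion.denseRange_coe
    (UniformSpace.Completion.isUniformInducing_coe _) (show PreL2 μ B from f)

theorem L2_clm_ext {W : Type*} [TopologicalSpace W] [AddCommMonoid W] [Module ℂ W] [T2Space W]
    {S T : L2 μ B →L[ℂ] W} (h : ∀ f : C_c(G, B), S (toL2 μ f) = T (toL2 μ f)) : S = T :=
  ContinuousLinearMap.ext fun x => (denseRange_toL2 μ).induction_on x
    (isClosed_eq S.continuous T.continuous) h

theorem norm_rhoOp_le (K : C_c(G, B)) : ‖rhoOp μ β K‖ ≤ rhoBound μ K := by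
  refine ContinuousLinearMap.opNorm_le_bound _ (Real.sqrt_nonneg _) fun x => ?_
  refine (denseRange_toL2 μ).induction_on x (isClosed_le (by fun_prop) (by fun_prop)) fun f => ?_
  rw [rhoOp_toL2]
  exact norm_toL2_rho_le μ β K f

theorem hinner_rhoOp_left (K : C_c(G, B)) (x y : L2 μ B) :
    hinner B (rhoOp μ β K x) y = hinner B x (rhoOp μ β (β.involution K) y) := by
  refine (denseRange_toL2 μ).induction_on₂ (p := fun x y => hinner B (rhoOp μ β K x) y =
    hinner B x (rhoOp μ β (β.involution K) y)) (isClosed_eq ?_ ?_) (fun f h => ?_) x y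
  · exact ((rhoOp μ β K).continuous.comp continuous_fst).hinner continuous_snd
  · exact continuous_fst.hinner ((rhoOp μ β _).continuous.comp continuous_snd)
  · rw [rhoOp_toL2, rhoOp_toL2, hinner_rho_left]

theorem rhoOp_add (K L : C_c(G, B)) : rhoOp μ β (K + L) = rhoOp μ β K + rhoOp μ β L :=
  L2_clm_ext μ fun f => by
    rw [add_apply, rhoOp_toL2, rhoOp_toL2, rhoOp_toL2, rho_add_left, toL2_add]

theorem rhoOp_smul (z : ℂ) (K : C_c(G, B)) : rhoOp μ β (z • K) = z • rhoOp μ β K :=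
  L2_clm_ext μ fun f => by
    rw [smul_apply, rhoOp_toL2, rhoOp_toL2, rho_smul_left, toL2_smul]

theorem rhoOp_sub (K L : C_c(G, B)) : rhoOp μ β (K - L) = rhoOp μ β K - rhoOp μ β L := by
  rw [sub_eq_add_neg, ← neg_one_smul ℂ L, rhoOp_add, rhoOp_smul, neg_one_smul, sub_eq_add_neg]

/-- The convolution `K ∗ L`. -/
noncomputable def crossedConvolution (K L : C_c(G, B)) : C_c(G, B) :=
  β.reflect (rho μ β K (β.reflect L))

theorem crossedConvolution_apply (K L : C_c(G, B)) (x : G) :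
    crossedConvolution μ β K L x = ∫ k, K (x * k) * β (x * k) (L k⁻¹) ∂μ := by
  rw [crossedConvolution, GCStarAction.reflect_apply, rho_apply,
    β.apply_integral μ x (integrable_rho μ β K (β.reflect L) x⁻¹)]
  refine integral_congr_ae (Eventually.of_forall fun k => ?_)
  simp only [map_mul (β x), β.apply_apply_inv, inv_inv, GCStarAction.reflect_apply, β.mul_apply]

theorem rho_crossedConvolution (K L f : C_c(G, B)) :
    rho μ β (crossedConvolution μ β K L) f = rho μ β K (rho μ β L f) := by
  ext g
  have e1 : ∀ h, β g (crossedConvolution μ β K L (g⁻¹ * h)) * f h =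
      ∫ k, β g (K (g⁻¹ * k)) * (β k (L (k⁻¹ * h)) * f h) ∂μ := by
    intro h
    have hi : Integrable (fun k => K (g⁻¹ * h * k) * β (g⁻¹ * h * k) (L k⁻¹)) μ := by
      refine Continuous.integrable_of_hasCompactSupport (by fun_prop) ?_
      refine (K.hasCompactSupport.comp_homeomorph (Homeomorph.mulLeft (g⁻¹ * h))).mono
        fun k hk => ?_
      rw [Function.mem_support] at hk ⊢
      contrapose! hk
      change K (g⁻¹ * h * k) = 0 at hk
      rw [hk, zero_mul]
    rw [crossedConvolution_apply, β.apply_integral μ g hi]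
    have hi' : Integrable (fun k => β g (K (g⁻¹ * h * k) * β (g⁻¹ * h * k) (L k⁻¹))) μ :=
      (β.toCLM g).integrable_comp hi
    rw [← integral_mul_left_eq_self (fun k => β g (K (g⁻¹ * k)) * (β k (L (k⁻¹ * h)) * f h)) h]
    refine (((ContinuousLinearMap.mul ℂ B).flip (f h)).integral_comp_comm hi').symm.trans ?_
    refine integral_congr_ae (Eventually.of_forall fun k => ?_)
    simp only [ContinuousLinearMap.flip_apply, ContinuousLinearMap.mul_apply']
    rw [map_mul (β g), ← β.mul_apply g, mul_assoc (β g _), mul_assoc g⁻¹ h k, mul_inv_cancel_left,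
      mul_inv_rev, inv_mul_cancel_right]
  have e2 : ∀ k, β g (K (g⁻¹ * k)) * rho μ β L f k =
      ∫ h, β g (K (g⁻¹ * k)) * (β k (L (k⁻¹ * h)) * f h) ∂μ := fun k =>
    ((ContinuousLinearMap.mul ℂ B (β g (K (g⁻¹ * k)))).integral_comp_comm
      (integrable_rho μ β L f k)).symm
  rw [rho_apply, rho_apply]
  simp_rw [e1, e2]
  refine integral_integral_swap_of_hasCompactSupport
    (f := fun h k => β g (K (g⁻¹ * k)) * (β k (L (k⁻¹ * h)) * f h)) ?_ ?_
  · have : Continuous fun x : G × G =>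
        β g (K (g⁻¹ * x.2)) * (β x.2 (L (x.2⁻¹ * x.1)) * f x.1) := by fun_prop
    exact this
  · refine HasCompactSupport.of_prod f.hasCompactSupport (rhoRow β K g).hasCompactSupport
      (fun h hh k => ?_) fun h k hk => ?_
    · rw [image_eq_zero_of_notMem_tsupport hh, mul_zero, mul_zero]
    · have : rhoRow β K g k = 0 := image_eq_zero_of_notMem_tsupport hk
      have : β g (K (g⁻¹ * k)) = 0 := this
      rw [this, zero_mul]

theorem rhoOp_crossedConvolution (K L : C_c(G, B)) :
    rhoOp μ β (crossedConvolution μ β K L) = rhoOp μ β K ∘L rhoOp μ β L :=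
  L2_clm_ext μ fun f => by
    rw [ContinuousLinearMap.comp_apply, rhoOp_toL2, rhoOp_toL2, rhoOp_toL2, rho_crossedConvolution]

theorem reducedCrossedProduct_eq :
    reducedCrossedProduct μ β = closure (Set.range (rhoOp μ β)) := by
  unfold reducedCrossedProduct
  congr 1
  ext T
  constructor
  · rintro ⟨K, hK⟩
    exact ⟨K, L2_clm_ext μ fun f => by rw [rhoOp_toL2, hK]⟩
  · rintro ⟨K, rfl⟩
    exact ⟨K, rhoOp_toL2 μ β K⟩

variable {μ β}

theorem rhoOp_mem (K : C_c(G, B)) : rhoOp μ β K ∈ reducedCrossedProduct μ β := by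
  rw [reducedCrossedProduct_eq]
  exact subset_closure ⟨K, rfl⟩

theorem reducedCrossedProduct.add_mem {S T : L2 μ B →L[ℂ] L2 μ B}
    (hS : S ∈ reducedCrossedProduct μ β) (hT : T ∈ reducedCrossedProduct μ β) :
    S + T ∈ reducedCrossedProduct μ β := by
  rw [reducedCrossedProduct_eq] at *
  refine map_mem_closure₂ continuous_add hS hT ?_
  rintro _ ⟨K, rfl⟩ _ ⟨L, rfl⟩
  exact ⟨K + L, rhoOp_add μ β K L⟩

theorem reducedCrossedProduct.smul_mem (z : ℂ) {S : L2 μ B →L[ℂ] L2 μ B}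
    (hS : S ∈ reducedCrossedProduct μ β) : z • S ∈ reducedCrossedProduct μ β := by
  rw [reducedCrossedProduct_eq] at *
  refine map_mem_closure (continuous_const_smul z) hS ?_
  rintro _ ⟨K, rfl⟩
  exact ⟨z • K, rhoOp_smul μ β z K⟩

theorem reducedCrossedProduct.comp_rhoOp_mem (L : C_c(G, B)) {S : L2 μ B →L[ℂ] L2 μ B}
    (hS : S ∈ reducedCrossedProduct μ β) : S ∘L rhoOp μ β L ∈ reducedCrossedProduct μ β := by
  rw [reducedCrossedProduct_eq] at *
  refine map_mem_closure (f := fun S => S ∘L rhoOp μ β L)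
    (ContinuousLinearMap.precomp _ (rhoOp μ β L)).continuous hS ?_
  rintro _ ⟨K, rfl⟩
  exact ⟨crossedConvolution μ β K L, rhoOp_crossedConvolution μ β K L⟩

theorem norm_le_of_adjoint {S T : L2 μ B →L[ℂ] L2 μ B}
    (h : ∀ x y, hinner B (T x) y = hinner B x (S y)) : ‖S‖ ≤ ‖T‖ := by
  refine ContinuousLinearMap.opNorm_le_bound _ (norm_nonneg _) fun y => ?_
  have h1 : ‖S y‖ ^ 2 ≤ ‖S y‖ * (‖T‖ * ‖y‖) := by
    rw [norm_sq_eq_norm_hinner (B := B), ← h]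
    calc _ ≤ ‖T (S y)‖ * ‖y‖ := norm_hinner_le _ _
      _ ≤ ‖T‖ * ‖S y‖ * ‖y‖ := by gcongr; exact T.le_opNorm _
      _ = _ := by ring
  rcases eq_or_lt_of_le (norm_nonneg (S y)) with h0 | h0
  · rw [← h0]; positivity
  · rw [sq] at h1
    exact le_of_mul_le_mul_left h1 h0

/-- If ρ_K approximates T, then the operator of the involution of K approximates S equally well. -/
theorem reducedCrossedProduct.adjoint_mem {S T : L2 μ B →L[ℂ] L2 μ B}
    (hT : T ∈ reducedCrossedProduct μ β) (h : ∀ x y, hinner B (T x) y = hinner B x (S y)) :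
    S ∈ reducedCrossedProduct μ β := by
  rw [reducedCrossedProduct_eq, Metric.mem_closure_iff] at *
  intro ε hε
  obtain ⟨_, ⟨K, rfl⟩, hK⟩ := hT ε hε
  refine ⟨_, ⟨β.involution K, rfl⟩, lt_of_le_of_lt ?_ hK⟩
  rw [dist_eq_norm, dist_eq_norm]
  refine norm_le_of_adjoint fun x y => ?_
  rw [sub_apply, sub_apply, hinner_sub_left, hinner_sub_right, h, hinner_rhoOp_left]

end Rho

/-! ### Ket and bra operators of square-integrable elements. -/

namespace HilbertGAction

variable {G B E : Type*} [Group G] [TopologicalSpace G] [IsTopologicalGroup G]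
  [MeasurableSpace G] [BorelSpace G] [NonUnitalCStarAlgebra B] [PartialOrder B]
  [StarOrderedRing B] [NormedAddCommGroup E] [NormedSpace ℂ E] [SMul Bᵐᵒᵖ E] [CStarModule Bᵐᵒᵖ E]
  {β : GCStarAction G B} (γ : HilbertGAction β E)

theorem norm_apply (g : G) (x : E) : ‖γ g x‖ = ‖x‖ := by
  have h : ‖γ g x‖ ^ 2 = ‖x‖ ^ 2 := by
    rw [norm_sq_eq_norm_hinner (B := B), norm_sq_eq_norm_hinner (B := B), γ.hinner_map,
      β.norm_apply]
  exact (pow_left_inj₀ (norm_nonneg _) (norm_nonneg _) two_ne_zero).1 h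

/-- The operator `γ_g` as a continuous linear map. -/
noncomputable def toCLM (g : G) : E →L[ℂ] E :=
  (γ g).mkContinuous 1 fun x => by rw [γ.norm_apply, one_mul]

@[simp]
theorem toCLM_apply (g : G) (x : E) : γ.toCLM g x = γ g x := rfl

theorem continuous_uncurry : Continuous fun x : G × E => γ x.1 x.2 := by
  rw [continuous_iff_continuousAt]
  rintro ⟨g, b⟩
  rw [ContinuousAt, tendsto_iff_norm_sub_tendsto_zero]
  have h1 : Tendsto (fun x : G × E => ‖x.2 - b‖ + ‖γ x.1 b - γ g b‖) (𝓝 (g, b)) (𝓝 0) := by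
    have : Continuous fun x : G × E => ‖x.2 - b‖ + ‖γ x.1 b - γ g b‖ := by
      have h' : Continuous fun x : G × E => γ x.1 b :=
        (γ.continuous_apply b).comp (continuous_fst (X := G) (Y := E))
      fun_prop
    simpa using this.tendsto (g, b)
  refine squeeze_zero (fun _ => norm_nonneg _) (fun x => ?_) h1
  calc ‖γ x.1 x.2 - γ g b‖ = ‖γ x.1 (x.2 - b) + (γ x.1 b - γ g b)‖ := by
        rw [map_sub]; congr 1; abel
    _ ≤ ‖γ x.1 (x.2 - b)‖ + ‖γ x.1 b - γ g b‖ := norm_add_le _ _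
    _ = _ := by rw [γ.norm_apply]

@[fun_prop]
theorem continuous_apply₂ {X : Type*} [TopologicalSpace X] {u : X → G} {v : X → E}
    (hu : Continuous u) (hv : Continuous v) : Continuous fun x => γ (u x) (v x) :=
  γ.continuous_uncurry.comp (hu.prodMk hv)

theorem mul_apply (g h : G) (x : E) : γ (g * h) x = γ g (γ h x) :=
  congrArg (fun T : Module.End ℂ E => T x) (γ.toHom.map_mul g h)

theorem one_apply (x : E) : γ 1 x = x :=
  congrArg (fun T : Module.End ℂ E => T x) γ.toHom.map_one

theorem apply_apply_inv (g : G) (x : E) : γ g (γ g⁻¹ x) = x := by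
  rw [← γ.mul_apply, mul_inv_cancel, γ.one_apply]

theorem hinner_apply_right (g : G) (x y : E) :
    hinner B x (γ g y) = β g (hinner B (γ g⁻¹ x) y) := by
  rw [← γ.hinner_map, γ.apply_apply_inv]

theorem bra_apply (ξ η : E) (g : G) : γ.bra ξ η g = hinner B (γ g ξ) η := rfl

variable (μ : Measure G) [μ.IsHaarMeasure]

theorem integrable_ket (ξ : E) (f : C_c(G, B)) : Integrable (fun g => γ g ξ <• f g) μ := by
  refine Continuous.integrable_of_hasCompactSupport (by fun_prop) ?_
  refine f.hasCompactSupport.mono fun g hg => ?_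
  rw [Function.mem_support] at hg ⊢
  contrapose! hg
  rw [hg, rmul_zero]

theorem integrable_conv (ξ : E) (K : C_c(G, B)) :
    Integrable (fun g => γ g (ξ <• K g⁻¹)) μ := by
  refine Continuous.integrable_of_hasCompactSupport (by fun_prop) ?_
  refine (K.hasCompactSupport.comp_homeomorph (Homeomorph.inv G)).mono fun g hg => ?_
  rw [Function.mem_support] at hg ⊢
  contrapose! hg
  change K g⁻¹ = 0 at hg
  rw [hg, rmul_zero, map_zero]

variable [CompleteSpace E]

theorem hinner_ket_right (ξ η : E) (f : C_c(G, B)) :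
    hinner B η (γ.ket μ ξ f) = ∫ g, hinner B η (γ g ξ) * f g ∂μ := by
  refine ((hinnerL B η).integral_comp_comm (γ.integrable_ket μ ξ f)).symm.trans ?_
  refine integral_congr_ae (Eventually.of_forall fun g => ?_)
  exact hinner_rmul_right _ _ _

theorem hinner_ket_left (ξ η : E) (f : C_c(G, B)) :
    hinner B (γ.ket μ ξ f) η = ∫ g, star (f g) * γ.bra ξ η g ∂μ := by
  rw [← star_hinner, hinner_ket_right]
  refine ((starL' ℝ : B ≃L[ℝ] B).integral_comp_comm _).symm.trans ?_
  refine integral_congr_ae (Eventually.of_forall fun g => ?_)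
  simp [bra_apply, star_hinner]

theorem ket_add_right (ξ : E) (f h : C_c(G, B)) :
    γ.ket μ ξ (f + h) = γ.ket μ ξ f + γ.ket μ ξ h := by
  change ∫ g, γ g ξ <• (f g + h g) ∂μ = _
  simp_rw [rmul_add]
  exact integral_add (γ.integrable_ket μ ξ f) (γ.integrable_ket μ ξ h)

theorem ket_smul_right (z : ℂ) (ξ : E) (f : C_c(G, B)) :
    γ.ket μ ξ (z • f) = z • γ.ket μ ξ f := by
  change ∫ g, γ g ξ <• (z • f g) ∂μ = _
  simp_rw [rmul_smul]
  exact integral_smul z _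

theorem ket_add_left (ξ η : E) (f : C_c(G, B)) :
    γ.ket μ (ξ + η) f = γ.ket μ ξ f + γ.ket μ η f := by
  change ∫ g, γ g (ξ + η) <• f g ∂μ = _
  simp_rw [map_add, add_rmul]
  exact integral_add (γ.integrable_ket μ ξ f) (γ.integrable_ket μ η f)

theorem ket_smul_left (z : ℂ) (ξ : E) (f : C_c(G, B)) :
    γ.ket μ (z • ξ) f = z • γ.ket μ ξ f := by
  change ∫ g, γ g (z • ξ) <• f g ∂μ = _
  simp_rw [map_smul, smul_rmul]
  exact integral_smul z _

/-- This identity |ξ∗K⟩⟩ = |ξ⟩⟩ρ_K is what the form of the convolution is made for. It follows by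
Fubini and a left translation. -/
theorem ket_conv (ξ : E) (K f : C_c(G, B)) :
    γ.ket μ (γ.conv μ ξ K) f = γ.ket μ ξ (rho μ β K f) := by
  have e1 : ∀ h, γ h (γ.conv μ ξ K) <• f h =
      ∫ g, γ g ξ <• (β g (K (g⁻¹ * h)) * f h) ∂μ := by
    intro h
    have hi : Integrable (fun g => γ h (γ g (ξ <• K g⁻¹))) μ :=
      (γ.toCLM h).integrable_comp (γ.integrable_conv μ ξ K)
    have e : γ h (γ.conv μ ξ K) = ∫ g, γ h (γ g (ξ <• K g⁻¹)) ∂μ :=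
      ((γ.toCLM h).integral_comp_comm (γ.integrable_conv μ ξ K)).symm
    rw [e, ← integral_mul_left_eq_self (fun g => γ g ξ <• (β g (K (g⁻¹ * h)) * f h)) h]
    refine (((rmulL B E).flip (f h)).integral_comp_comm hi).symm.trans ?_
    refine integral_congr_ae (Eventually.of_forall fun g => ?_)
    simp only [ContinuousLinearMap.flip_apply, rmulL_apply]
    rw [← γ.mul_apply, γ.map_smul_right, rmul_rmul, mul_inv_rev, inv_mul_cancel_right]
  have e2 : ∀ g, γ g ξ <• rho μ β K f g =
      ∫ h, γ g ξ <• (β g (K (g⁻¹ * h)) * f h) ∂μ := fun g =>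
    ((rmulL B E (γ g ξ)).integral_comp_comm (integrable_rho μ β K f g)).symm
  unfold ket
  simp_rw [e1, e2]
  refine integral_integral_swap_of_hasCompactSupport
    (f := fun h g => γ g ξ <• (β g (K (g⁻¹ * h)) * f h)) ?_ ?_
  · have : Continuous fun x : G × G => γ x.2 ξ <• (β x.2 (K (x.2⁻¹ * x.1)) * f x.1) := by
      fun_prop
    exact this
  · refine HasCompactSupport.of_prod f.hasCompactSupport
      ((f.hasCompactSupport.isCompact.prod K.hasCompactSupport.isCompact).image
        (f := fun x : G × G => x.1 * x.2⁻¹) (by fun_prop)) (fun h hh g => ?_) fun h g hg => ?_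
    · rw [image_eq_zero_of_notMem_tsupport hh, mul_zero, rmul_zero]
    · by_cases hh : h ∈ tsupport f
      · have : g⁻¹ * h ∉ tsupport K := fun h' => hg ⟨(h, g⁻¹ * h), ⟨hh, h'⟩, by simp⟩
        rw [image_eq_zero_of_notMem_tsupport this, map_zero, zero_mul, rmul_zero]
      · rw [image_eq_zero_of_notMem_tsupport hh, mul_zero, rmul_zero]

theorem exists_ketOp_of_norm_le {ξ : E} {C : ℝ}
    (h : ∀ f : C_c(G, B), ‖γ.ket μ ξ f‖ ≤ C * ‖toL2 μ f‖) :
    ∃ T : L2 μ B →L[ℂ] E, ∀ f : C_c(G, B), T (toL2 μ f) = γ.ket μ ξ f := by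
  let T : PreL2 μ B →ₗ[ℂ] E :=
    { toFun := fun f => γ.ket μ ξ f
      map_add' := γ.ket_add_right μ ξ
      map_smul' := fun z => γ.ket_smul_right μ z ξ }
  refine ⟨(T.mkContinuous C fun f => (h f).trans_eq ?_).extend
    (UniformSpace.Completion.toComplL (𝕜 := ℂ) (E := PreL2 μ B)), fun f => ?_⟩
  · exact congrArg _ (UniformSpace.Completion.norm_coe (show PreL2 μ B from f))
  · exact ContinuousLinearMap.extend_eq _ UniformSpace.Completion.denseRange_coe
      (UniformSpace.Completion.isUniformInducing_coe _) (show PreL2 μ B from f)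

theorem ketOp_toL2_of_norm_le {ξ : E} {C : ℝ}
    (h : ∀ f : C_c(G, B), ‖γ.ket μ ξ f‖ ≤ C * ‖toL2 μ f‖) (f : C_c(G, B)) :
    γ.ketOp μ ξ (toL2 μ f) = γ.ket μ ξ f := by
  have h' := γ.exists_ketOp_of_norm_le μ h
  rw [ketOp, dif_pos h']
  exact h'.choose_spec f

variable {γ μ} in
theorem ketOp_eq {ξ : E} {T : L2 μ B →L[ℂ] E}
    (hT : ∀ f : C_c(G, B), T (toL2 μ f) = γ.ket μ ξ f) : γ.ketOp μ ξ = T := by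
  have h' : ∃ T : L2 μ B →L[ℂ] E, ∀ f : C_c(G, B), T (toL2 μ f) = γ.ket μ ξ f := ⟨T, hT⟩
  rw [ketOp, dif_pos h']
  exact L2_clm_ext μ fun f => (h'.choose_spec f).trans (hT f).symm

variable [LocallyCompactSpace G] [T2Space G]

theorem mem_squareIntegrable_iff {ξ : E} : ξ ∈ γ.squareIntegrable μ ↔
    ∀ η, ∃ F : L2 μ B, ∀ f : C_c(G, B), hinner B (toL2 μ f) F = hinner B (γ.ket μ ξ f) η := by
  simp only [squareIntegrable, Set.mem_ofPred_eq, isSquareIntegrable_iff, hinner_ket_left]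

variable {γ μ} in
theorem braOp_eq {ξ η : E} {F : L2 μ B}
    (h : ∀ f : C_c(G, B), hinner B (toL2 μ f) F = hinner B (γ.ket μ ξ f) η) :
    γ.braOp μ ξ η = F :=
  l2Limit_eq μ fun f => (h f).trans (γ.hinner_ket_left μ ξ η f)

variable {γ μ}

theorem hinner_toL2_braOp {ξ : E} (hξ : ξ ∈ γ.squareIntegrable μ) (η : E) (f : C_c(G, B)) :
    hinner B (toL2 μ f) (γ.braOp μ ξ η) = hinner B (γ.ket μ ξ f) η := by
  rw [hinner_ket_left]
  exact hinner_toL2_l2Limit μ (hξ η) f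

/-- The bounded operator `⟨⟨ξ|` for square-integrable `ξ`. -/
noncomputable def braCLM {ξ : E} (hξ : ξ ∈ γ.squareIntegrable μ) : E →L[ℂ] L2 μ B :=
  let T : E →ₗ[ℂ] L2 μ B :=
    { toFun := γ.braOp μ ξ
      map_add' := fun x y => braOp_eq fun f => by
        rw [hinner_add_right, hinner_add_right, hinner_toL2_braOp hξ, hinner_toL2_braOp hξ]
      map_smul' := fun z x => braOp_eq fun f => by
        rw [RingHom.id_apply, hinner_smul_right, hinner_smul_right, hinner_toL2_braOp hξ] }
  { T with
    -- Closed graph theorem: pairings with C_c(G, B) are continuous on both sides and determine the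
    -- limit.
    cont := T.continuous_of_seq_closed_graph fun u x y hu hTu => by
      refine (braOp_eq fun f => ?_).symm
      refine tendsto_nhds_unique (((hinnerL B (toL2 μ f)).continuous.tendsto y).comp hTu)
        ((((hinnerL B (γ.ket μ ξ f)).continuous.tendsto x).comp hu).congr fun n => ?_)
      exact (hinner_toL2_braOp hξ (u n) f).symm }

@[simp]
theorem braCLM_apply {ξ : E} (hξ : ξ ∈ γ.squareIntegrable μ) (η : E) :
    braCLM hξ η = γ.braOp μ ξ η := rfl

/-- The square of the left side is the norm of ⟨f|⟨⟨ξ|(|ξ⟩⟩f)⟩. Hence `ketOp` is the true extension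
on E_si and not its default value 0. -/
theorem norm_ket_le {ξ : E} (hξ : ξ ∈ γ.squareIntegrable μ) (f : C_c(G, B)) :
    ‖γ.ket μ ξ f‖ ≤ ‖braCLM hξ‖ * ‖toL2 μ f‖ := by
  have h1 : ‖γ.ket μ ξ f‖ * ‖γ.ket μ ξ f‖ ≤ ‖γ.ket μ ξ f‖ * (‖braCLM hξ‖ * ‖toL2 μ f‖) := by
    rw [← sq, norm_sq_eq_norm_hinner (B := B), ← hinner_toL2_braOp hξ]
    calc _ ≤ ‖toL2 μ f‖ * ‖braCLM hξ (γ.ket μ ξ f)‖ := norm_hinner_le _ _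
      _ ≤ ‖toL2 μ f‖ * (‖braCLM hξ‖ * ‖γ.ket μ ξ f‖) := by
          gcongr; exact (braCLM hξ).le_opNorm _
      _ = _ := by ring
  rcases eq_or_lt_of_le (norm_nonneg (γ.ket μ ξ f)) with h0 | h0
  · rw [← h0]; positivity
  · exact le_of_mul_le_mul_left h1 h0

theorem ketOp_toL2 {ξ : E} (hξ : ξ ∈ γ.squareIntegrable μ) (f : C_c(G, B)) :
    γ.ketOp μ ξ (toL2 μ f) = γ.ket μ ξ f :=
  γ.ketOp_toL2_of_norm_le μ (norm_ket_le hξ) f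

theorem hinner_ketOp_left {ξ : E} (hξ : ξ ∈ γ.squareIntegrable μ) (F : L2 μ B) (η : E) :
    hinner B (γ.ketOp μ ξ F) η = hinner B F (γ.braOp μ ξ η) := by
  refine (denseRange_toL2 μ).induction_on F (isClosed_eq ?_ ?_) fun f => ?_
  · exact (γ.ketOp μ ξ).continuous.hinner continuous_const
  · exact continuous_id.hinner continuous_const
  · rw [ketOp_toL2 hξ, hinner_toL2_braOp hξ]

variable (γ μ) in
/-- `E_si` as a linear subspace. -/
def squareIntegrableSubmodule : Submodule ℂ E where
  carrier := γ.squareIntegrable μ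
  add_mem' {x y} hx hy := by
    rw [mem_squareIntegrable_iff] at *
    intro η
    obtain ⟨F, hF⟩ := hx η
    obtain ⟨F', hF'⟩ := hy η
    exact ⟨F + F', fun f => by rw [ket_add_left, hinner_add_left, hinner_add_right, hF, hF']⟩
  zero_mem' := by
    rw [mem_squareIntegrable_iff]
    refine fun η => ⟨0, fun f => ?_⟩
    rw [← zero_smul ℂ (0 : E), ket_smul_left, zero_smul, hinner_zero_left, hinner_zero_right]
  smul_mem' z x hx := by
    rw [mem_squareIntegrable_iff] at *
    intro η
    obtain ⟨F, hF⟩ := hx η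
    exact ⟨star z • F, fun f => by rw [ket_smul_left, hinner_smul_left, hinner_smul_right, hF]⟩

theorem add_mem_squareIntegrable {ξ η : E} (hξ : ξ ∈ γ.squareIntegrable μ)
    (hη : η ∈ γ.squareIntegrable μ) : ξ + η ∈ γ.squareIntegrable μ :=
  (γ.squareIntegrableSubmodule μ).add_mem hξ hη

theorem smul_mem_squareIntegrable (z : ℂ) {ξ : E} (hξ : ξ ∈ γ.squareIntegrable μ) :
    z • ξ ∈ γ.squareIntegrable μ :=
  (γ.squareIntegrableSubmodule μ).smul_mem z hξ

theorem ketOp_add {ξ η : E} (hξ : ξ ∈ γ.squareIntegrable μ) (hη : η ∈ γ.squareIntegrable μ) :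
    γ.ketOp μ (ξ + η) = γ.ketOp μ ξ + γ.ketOp μ η :=
  ketOp_eq fun f => by rw [add_apply, ketOp_toL2 hξ, ketOp_toL2 hη, ket_add_left]

theorem ketOp_smul (z : ℂ) {ξ : E} (hξ : ξ ∈ γ.squareIntegrable μ) :
    γ.ketOp μ (z • ξ) = z • γ.ketOp μ ξ :=
  ketOp_eq fun f => by rw [smul_apply, ketOp_toL2 hξ, ket_smul_left]

theorem ketOp_sub {ξ η : E} (hξ : ξ ∈ γ.squareIntegrable μ) (hη : η ∈ γ.squareIntegrable μ) :
    γ.ketOp μ (ξ - η) = γ.ketOp μ ξ - γ.ketOp μ η := by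
  rw [sub_eq_add_neg, ← neg_one_smul ℂ η, ketOp_add hξ (smul_mem_squareIntegrable _ hη),
    ketOp_smul _ hη, neg_one_smul, sub_eq_add_neg]

theorem conv_mem_squareIntegrable {ξ : E} (hξ : ξ ∈ γ.squareIntegrable μ) (K : C_c(G, B)) :
    γ.conv μ ξ K ∈ γ.squareIntegrable μ := by
  rw [mem_squareIntegrable_iff]
  refine fun η => ⟨rhoOp μ β (β.involution K) (γ.braOp μ ξ η), fun f => ?_⟩
  rw [← hinner_rhoOp_left, rhoOp_toL2, hinner_toL2_braOp hξ, ket_conv]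

theorem ketOp_conv {ξ : E} (hξ : ξ ∈ γ.squareIntegrable μ) (K : C_c(G, B)) :
    γ.ketOp μ (γ.conv μ ξ K) = γ.ketOp μ ξ ∘L rhoOp μ β K :=
  ketOp_eq fun f => by
    rw [ContinuousLinearMap.comp_apply, rhoOp_toL2, ketOp_toL2 hξ, ket_conv]

/-- Square-integrability may be tested on a dense subset once the ket operator is bounded. -/
theorem mem_squareIntegrable_of_dense {ξ : E} {C : ℝ} {D : Set E} (hD : Dense D)
    (hC : ∀ f : C_c(G, B), ‖γ.ket μ ξ f‖ ≤ C * ‖toL2 μ f‖)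
    (h : ∀ η ∈ D, ∃ F : L2 μ B, ∀ f : C_c(G, B),
      hinner B (toL2 μ f) F = hinner B (γ.ket μ ξ f) η) : ξ ∈ γ.squareIntegrable μ := by
  rw [mem_squareIntegrable_iff]
  intro η
  obtain ⟨u, huD, hu⟩ := mem_closure_iff_seq_limit.1 (hD η)
  choose F hF using fun n => h (u n) (huD n)
  set T := γ.ketOp μ ξ
  have hT := γ.ketOp_toL2_of_norm_le μ hC
  have hpair : ∀ n (X : L2 μ B), hinner B X (F n) = hinner B (T X) (u n) := by
    intro n X
    refine (denseRange_toL2 μ).induction_on X (isClosed_eq ?_ ?_) fun f => ?_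
    · exact continuous_id.hinner continuous_const
    · exact T.continuous.hinner continuous_const
    · rw [hF, hT]
  -- F is a partial adjoint of T on D, so it inherits the norm bound; this makes F n a Cauchy
  -- sequence.
  have hbound : ∀ n m, ‖F n - F m‖ ≤ ‖T‖ * ‖u n - u m‖ := by
    intro n m
    set X := F n - F m
    have h1 : ‖X‖ * ‖X‖ ≤ ‖X‖ * (‖T‖ * ‖u n - u m‖) := by
      rw [← sq, norm_sq_eq_norm_hinner (B := B)]
      nth_rewrite 2 [show X = F n - F m from rfl]
      rw [hinner_sub_right, hpair, hpair, ← hinner_sub_right]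
      calc _ ≤ ‖T X‖ * ‖u n - u m‖ := norm_hinner_le _ _
        _ ≤ ‖T‖ * ‖X‖ * ‖u n - u m‖ := by gcongr; exact T.le_opNorm _
        _ = _ := by ring
    rcases eq_or_lt_of_le (norm_nonneg X) with h0 | h0
    · rw [← h0]; positivity
    · exact le_of_mul_le_mul_left h1 h0
  have hcau : CauchySeq F := by
    rw [cauchySeq_iff_tendsto_dist_atTop_0]
    have := (cauchySeq_iff_tendsto_dist_atTop_0.1 hu.cauchySeq).const_mul ‖T‖
    rw [mul_zero] at this
    refine squeeze_zero (fun _ => dist_nonneg) (fun n => ?_) this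
    rw [dist_eq_norm, dist_eq_norm]
    exact hbound _ _
  obtain ⟨X, hX⟩ := cauchySeq_tendsto_of_complete hcau
  refine ⟨X, fun f => tendsto_nhds_unique (((hinnerL B (toL2 μ f)).continuous.tendsto X).comp hX)
    ((((hinnerL B (γ.ket μ ξ f)).continuous.tendsto η).comp hu).congr fun n => ?_)⟩
  exact (hF n f).symm

/-- The bounded operator `⟨⟨ξ|η⟩⟩`. -/
noncomputable def braketOp {ξ : E} (hξ : ξ ∈ γ.squareIntegrable μ) (η : E) :
    L2 μ B →L[ℂ] L2 μ B := braCLM hξ ∘L γ.ketOp μ η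

theorem braketMemReduced_iff {ξ : E} (hξ : ξ ∈ γ.squareIntegrable μ) (η : E) :
    γ.BraketMemReduced μ ξ η ↔ braketOp hξ η ∈ reducedCrossedProduct μ β := by
  constructor
  · rintro ⟨T, hT, h⟩
    rwa [show braketOp hξ η = T from ContinuousLinearMap.ext fun F => (h F).symm]
  · exact fun h => ⟨_, h, fun F => rfl⟩

theorem hinner_braketOp_left {ξ η : E} (hξ : ξ ∈ γ.squareIntegrable μ)
    (hη : η ∈ γ.squareIntegrable μ) (x y : L2 μ B) :
    hinner B (braketOp hξ η x) y = hinner B x (braketOp hη ξ y) := by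
  have h1 : hinner B (braketOp hξ η x) y = hinner B (γ.ketOp μ η x) (γ.ketOp μ ξ y) := by
    rw [← star_hinner, ← star_hinner (γ.ketOp μ ξ y), hinner_ketOp_left hξ]
    rfl
  rw [h1, hinner_ketOp_left hη]
  rfl

end HilbertGAction

/-! ### Compactly supported symbols on E_cs. -/

theorem rhoBound_le {G B : Type*} [Group G] [TopologicalSpace G] [IsTopologicalGroup G]
    [MeasurableSpace G] [BorelSpace G] (μ : Measure G) [μ.IsHaarMeasure]
    [NonUnitalCStarAlgebra B] {K : C_c(G, B)} {C : Set G} (hC : IsCompact C)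
    (hK : ∀ g ∉ C, K g = 0) {c : ℝ} (hc : ∀ g, ‖K g‖ ≤ c) :
    rhoBound μ K ≤ c * √(μ.real C * μ.real C⁻¹) := by
  have hc0 : 0 ≤ c := (norm_nonneg _).trans (hc 1)
  have h1 : ∀ {u : G → B} {S : Set G}, IsCompact S → (∀ g ∉ S, u g = 0) → (∀ g, ‖u g‖ ≤ c) →
      ∫ g, ‖u g‖ ∂μ ≤ c * μ.real S := by
    intro u S hS hu huc
    have e : ∫ g, ‖u g‖ ∂μ = ∫ g in S, ‖u g‖ ∂μ :=
      (setIntegral_eq_integral_of_forall_compl_eq_zero fun g hg => by simp [hu g hg]).symm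
    rw [e]
    refine (le_abs_self _).trans ?_
    rw [← Real.norm_eq_abs]
    exact norm_setIntegral_le_of_norm_le_const hS.measure_lt_top fun g _ => by
      rw [norm_norm]; exact huc g
  have h2 := h1 hC hK hc
  have h3 := h1 (u := fun g => K g⁻¹) hC.inv (fun g hg => hK _ (by simpa using hg))
    fun g => hc _
  rw [rhoBound, ← Real.sqrt_sq hc0, ← Real.sqrt_mul (sq_nonneg c)]
  refine Real.sqrt_le_sqrt ?_
  calc _ ≤ (c * μ.real C) * (c * μ.real C⁻¹) :=
        mul_le_mul h2 h3 (integral_nonneg fun g => norm_nonneg _)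
          (mul_nonneg hc0 measureReal_nonneg)
    _ = _ := by ring

section Ideal

variable {B E : Type*} [NonUnitalCStarAlgebra B] [PartialOrder B] [StarOrderedRing B]
  [NormedAddCommGroup E] [NormedSpace ℂ E] [SMul Bᵐᵒᵖ E] [CStarModule Bᵐᵒᵖ E]

theorem hinner_eq_zero_of_disjoint {U V : Set (PrimSpace B)} (h : U ∩ V = ∅) {ξ η : E}
    (hξ : ξ ∈ (moduleIdeal B U : Submodule ℂ E)) (hη : η ∈ (moduleIdeal B V : Submodule ℂ E)) :
    hinner B ξ η = 0 := by
  refine eq_zero_of_mem_idealOf_of_disjoint h ?_ (hη ξ)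
  rw [← star_hinner]
  exact star_mem_idealOf (hξ η)

end Ideal

namespace HilbertGAction

variable {G B E : Type*} [Group G] [TopologicalSpace G] [IsTopologicalGroup G]
  [MeasurableSpace G] [BorelSpace G] [NonUnitalCStarAlgebra B] [PartialOrder B]
  [StarOrderedRing B] [NormedAddCommGroup E] [NormedSpace ℂ E] [SMul Bᵐᵒᵖ E] [CStarModule Bᵐᵒᵖ E]
  {β : GCStarAction G B} (γ : HilbertGAction β E)

theorem apply_mem_moduleIdeal {U : Set (PrimSpace B)} {x : E}
    (hx : x ∈ (moduleIdeal B U : Submodule ℂ E)) (g : G) :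
    γ g x ∈ (moduleIdeal B (β.translate g U) : Submodule ℂ E) := fun y => by
  rw [hinner_apply_right]
  exact β.apply_mem_idealOf_translate (hx _) g

/-- Translation moves E·B_V into E·B_{gV}, which is orthogonal to E·B_U unless gV meets U.
Everything that depends on spectral properness passes through this lemma. That C does not depend on
ξ and η is needed for `exists_siNorm_le`. -/
theorem exists_isCompact_symbol_eq_zero (hβ : β.IsSpectrallyProper) {U V : Set (PrimSpace B)}
    (hU : IsRelQuasiCompact U) (hV : IsRelQuasiCompact V) :
    ∃ C : Set G, IsCompact C ∧ ∀ ξ ∈ (moduleIdeal B U : Submodule ℂ E),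
      ∀ η ∈ (moduleIdeal B V : Submodule ℂ E), ∀ g ∉ C, γ.symbol ξ η g = 0 := by
  obtain ⟨C, hC, h⟩ := hβ.exists_isCompact hV hU
  refine ⟨C, hC, fun ξ hξ η hη g hg => ?_⟩
  refine hinner_eq_zero_of_disjoint ?_ hξ (γ.apply_mem_moduleIdeal hη g)
  rw [Set.inter_comm]
  exact Set.not_nonempty_iff_eq_empty.1 fun hne => hg (h g hne)

theorem continuous_symbol (ξ η : E) : Continuous (γ.symbol ξ η) := by
  unfold symbol
  fun_prop

variable [T2Space G]

theorem exists_eq_symbol {ξ η : E} {C : Set G} (hC : IsCompact C)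
    (h : ∀ g ∉ C, γ.symbol ξ η g = 0) : ∃ K : C_c(G, B), ⇑K = γ.symbol ξ η :=
  ⟨⟨⟨γ.symbol ξ η, γ.continuous_symbol ξ η⟩, HasCompactSupport.intro hC h⟩, rfl⟩

variable [CompleteSpace E]

theorem exists_symbol (hβ : β.IsSpectrallyProper) {ξ η : E} (hξ : ξ ∈ moduleCompactPart B E)
    (hη : η ∈ moduleCompactPart B E) : ∃ K : C_c(G, B), ⇑K = γ.symbol ξ η := by
  obtain ⟨U, -, hU, hξ⟩ := mem_moduleCompactPart_iff.1 hξ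
  obtain ⟨V, -, hV, hη⟩ := mem_moduleCompactPart_iff.1 hη
  obtain ⟨C, hC, h⟩ := γ.exists_isCompact_symbol_eq_zero hβ hU hV
  exact γ.exists_eq_symbol hC (h ξ hξ η hη)

variable (μ : Measure G) [μ.IsHaarMeasure]

theorem bra_ket {ξ η : E} {K : C_c(G, B)} (hK : ⇑K = γ.symbol ξ η) (f : C_c(G, B)) (g : G) :
    γ.bra ξ (γ.ket μ η f) g = rho μ β K f g := by
  rw [bra_apply, hinner_ket_right, rho_apply]
  refine integral_congr_ae (Eventually.of_forall fun k => ?_)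
  simp only [hK, symbol]
  rw [← γ.hinner_map, ← γ.mul_apply, mul_inv_cancel_left]

theorem hinner_ket_ket {ξ η : E} {K : C_c(G, B)} (hK : ⇑K = γ.symbol ξ η) (f h : C_c(G, B)) :
    hinner B (γ.ket μ ξ f) (γ.ket μ η h) = hinner B (toL2 μ f) (toL2 μ (rho μ β K h)) := by
  rw [hinner_ket_left, hinner_toL2]
  simp_rw [γ.bra_ket μ hK]

/-- The inner square of |ξ⟩⟩f is ⟨f|ρ_K f⟩, so boundedness of ρ_K bounds |ξ⟩⟩ before ξ is known to
be square-integrable. -/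
theorem norm_ket_le_of_symbol {ξ : E} {K : C_c(G, B)} (hK : ⇑K = γ.symbol ξ ξ) (f : C_c(G, B)) :
    ‖γ.ket μ ξ f‖ ≤ √(rhoBound μ K) * ‖toL2 μ f‖ := by
  refine norm_le_of_hinner_le (B := B) (by positivity) ?_
  rw [γ.hinner_ket_ket μ hK, mul_pow, Real.sq_sqrt (show 0 ≤ rhoBound μ K from Real.sqrt_nonneg _)]
  calc _ ≤ ‖toL2 μ f‖ * ‖toL2 μ (rho μ β K f)‖ := norm_hinner_le _ _
    _ ≤ ‖toL2 μ f‖ * (rhoBound μ K * ‖toL2 μ f‖) := by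
        gcongr; exact norm_toL2_rho_le μ β K f
    _ = _ := by ring

variable [LocallyCompactSpace G]

/-- For η in the dense subspace E_cs, the function g ↦ ⟨γ_g ξ|η⟩ is the adjoint of a symbol and has
compact support. Boundedness of |ξ⟩⟩ extends square-integrability to all η. -/
theorem moduleCompactPart_subset_squareIntegrable (hβ : β.IsSpectrallyProper) :
    moduleCompactPart B E ⊆ γ.squareIntegrable μ := by
  intro ξ hξ
  obtain ⟨K, hK⟩ := γ.exists_symbol hβ hξ hξ
  refine mem_squareIntegrable_of_dense (dense_moduleCompactPart (B := B)) (γ.norm_ket_le_of_symbol μ hK)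
    fun η hη => ?_
  obtain ⟨L, hL⟩ := γ.exists_symbol hβ hη hξ
  let F : C_c(G, B) :=
    ⟨⟨fun g => star (L g), by fun_prop⟩, L.hasCompactSupport.comp_left (g := star) (star_zero B)⟩
  refine ⟨toL2 μ F, fun f => ?_⟩
  rw [hinner_toL2, hinner_ket_left]
  refine integral_congr_ae (Eventually.of_forall fun g => ?_)
  change star (f g) * star (L g) = star (f g) * hinner B (γ g ξ) η
  rw [hL, symbol, star_hinner]

variable {μ}

theorem braket_toL2 {ξ η : E} (hη : η ∈ γ.squareIntegrable μ)
    {K : C_c(G, B)} (hK : ⇑K = γ.symbol ξ η) (f : C_c(G, B)) :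
    γ.braket μ ξ η (toL2 μ f) = toL2 μ (rho μ β K f) := by
  rw [braket, ketOp_toL2 hη]
  exact braOp_eq fun h => (γ.hinner_ket_ket μ hK h f).symm

theorem braketMemReduced_of_symbol {ξ η : E} (hξ : ξ ∈ γ.squareIntegrable μ)
    (hη : η ∈ γ.squareIntegrable μ) {K : C_c(G, B)} (hK : ⇑K = γ.symbol ξ η) :
    γ.BraketMemReduced μ ξ η := by
  rw [braketMemReduced_iff hξ]
  refine subset_closure ⟨K, fun f => ?_⟩
  exact γ.braket_toL2 hη hK f

variable (μ)

theorem isRelativelyContinuous_moduleCompactPart (hβ : β.IsSpectrallyProper) :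
    γ.IsRelativelyContinuous μ (moduleCompactPart B E) := by
  have h := γ.moduleCompactPart_subset_squareIntegrable μ hβ
  refine ⟨h, fun ξ hξ η hη => ?_⟩
  obtain ⟨K, hK⟩ := γ.exists_symbol hβ hξ hη
  exact γ.braketMemReduced_of_symbol (h hξ) (h hη) hK

/-- On `E · B_U` the norm `‖·‖_si` is equivalent to the norm of `E`. -/
theorem exists_siNorm_le (hβ : β.IsSpectrallyProper) {U : Set (PrimSpace B)}
    (hU : IsRelQuasiCompact U) :
    ∃ C : ℝ, 0 < C ∧ ∀ ξ ∈ (moduleIdeal B U : Submodule ℂ E), γ.siNorm μ ξ ≤ C * ‖ξ‖ := by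
  obtain ⟨C, hC, h⟩ := γ.exists_isCompact_symbol_eq_zero hβ hU hU
  refine ⟨1 + √√(μ.real C * μ.real C⁻¹), by positivity, fun ξ hξ => ?_⟩
  obtain ⟨K, hK⟩ := γ.exists_eq_symbol hC (h ξ hξ ξ hξ)
  have h1 := γ.norm_ket_le_of_symbol μ hK
  have h2 : rhoBound μ K ≤ ‖ξ‖ ^ 2 * √(μ.real C * μ.real C⁻¹) := by
    refine rhoBound_le μ hC (fun g hg => by rw [hK]; exact h ξ hξ ξ hξ g hg) fun g => ?_
    rw [hK, sq]
    exact (norm_hinner_le _ _).trans_eq (by rw [γ.norm_apply])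
  have h3 : ‖γ.ketOp μ ξ‖ ≤ √√(μ.real C * μ.real C⁻¹) * ‖ξ‖ := by
    refine ContinuousLinearMap.opNorm_le_bound _ (by positivity) fun F => ?_
    refine (denseRange_toL2 μ).induction_on F (isClosed_le (by fun_prop) (by fun_prop))
      fun f => ?_
    rw [γ.ketOp_toL2_of_norm_le μ h1]
    refine (h1 f).trans (mul_le_mul_of_nonneg_right ?_ (norm_nonneg _))
    refine (Real.sqrt_le_sqrt h2).trans_eq ?_
    rw [Real.sqrt_mul (sq_nonneg _), Real.sqrt_sq (norm_nonneg _), mul_comm]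
  rw [siNorm, add_mul, one_mul]
  gcongr

end HilbertGAction

/-- The integral vanishes in the normed quotient by S. -/
theorem Submodule.integral_mem_of_forall_mem {X V : Type*} [MeasurableSpace X] {ν : Measure X}
    [NormedAddCommGroup V] [NormedSpace ℂ V] [CompleteSpace V] {S : Submodule ℂ V}
    (hS : IsClosed (S : Set V)) {f : X → V} (hf : ∀ x, f x ∈ S) : ∫ x, f x ∂ν ∈ S := by
  by_cases hi : Integrable f ν
  · rw [← Submodule.Quotient.mk_eq_zero]
    have := hS
    refine (S.mkQL.integral_comp_comm hi).symm.trans ?_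
    simp only [Submodule.mkQL_apply, Submodule.mkQ_apply]
    simp [fun x => (Submodule.Quotient.mk_eq_zero S).2 (hf x)]
  · rw [integral_undef hi]
    exact S.zero_mem

/-! ### Symmetric bump functions and approximate units. -/

section Bump

variable {G : Type*} [Group G] [TopologicalSpace G] [IsTopologicalGroup G]
  [MeasurableSpace G] [BorelSpace G] (μ : Measure G) [μ.IsHaarMeasure]

/-- A symmetric probability density supported in `V`. -/
structure IsBump (V : Set G) (φ : C_c(G, ℝ)) : Prop where
  nonneg : ∀ g, 0 ≤ φ g
  symm : ∀ g, φ g⁻¹ = φ g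
  integral_eq_one : ∫ g, φ g ∂μ = 1
  eq_zero : ∀ g ∉ V, φ g = 0

variable {μ} in
theorem IsBump.mono {V W : Set G} {φ : C_c(G, ℝ)} (h : IsBump μ V φ) (hVW : V ⊆ W) :
    IsBump μ W φ :=
  ⟨h.nonneg, h.symm, h.integral_eq_one, fun g hg => h.eq_zero g fun h' => hg (hVW h')⟩

theorem exists_isBump [LocallyCompactSpace G] [T2Space G] {V : Set G} (hV : V ∈ 𝓝 (1 : G)) :
    ∃ φ : C_c(G, ℝ), IsBump μ V φ := by
  obtain ⟨f, hf1, hf2, hf3, hf4⟩ := exists_continuousMap_one_of_isCompact_subset_isOpen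
    (K := {(1 : G)}) (V := interior V ∩ (interior V)⁻¹) isCompact_singleton
    (isOpen_interior.inter isOpen_interior.inv)
    (by simpa using mem_interior_iff_mem_nhds.2 hV)
  have hc : HasCompactSupport f := hf2
  have hc' : HasCompactSupport fun g => f g⁻¹ := hc.comp_homeomorph (Homeomorph.inv G)
  let ψ : G → ℝ := fun g => f g + f g⁻¹
  have hψ : Continuous ψ := by fun_prop
  have hψc : HasCompactSupport ψ := HasCompactSupport.add hc hc'
  have hψ0 : ∀ g, 0 ≤ ψ g := fun g => add_nonneg (hf4 g).1 (hf4 g⁻¹).1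
  have hpos : 0 < ∫ g, ψ g ∂μ := by
    refine hψ.integral_pos_of_hasCompactSupport_nonneg_nonzero hψc hψ0 (x := 1) ?_
    have : f 1 = 1 := hf1 rfl
    simp [ψ, this]
  have hz : ∀ g, g ∉ V → f g = 0 ∧ f g⁻¹ = 0 := fun g hg =>
    ⟨image_eq_zero_of_notMem_tsupport fun h => hg (interior_subset (hf3 h).1),
      image_eq_zero_of_notMem_tsupport fun h => hg (interior_subset (by simpa using (hf3 h).2))⟩
  refine ⟨⟨⟨fun g => (∫ g, ψ g ∂μ)⁻¹ * ψ g, by fun_prop⟩, hψc.mul_left⟩, ?_, ?_, ?_, ?_⟩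
  · exact fun g => mul_nonneg (inv_nonneg.2 hpos.le) (hψ0 g)
  · intro g
    change (∫ g, ψ g ∂μ)⁻¹ * (f g⁻¹ + f g⁻¹⁻¹) = (∫ g, ψ g ∂μ)⁻¹ * (f g + f g⁻¹)
    rw [inv_inv, add_comm]
  · change ∫ g, (∫ g, ψ g ∂μ)⁻¹ * ψ g ∂μ = 1
    rw [integral_const_mul, inv_mul_cancel₀ hpos.ne']
  · intro g hg
    change (∫ g, ψ g ∂μ)⁻¹ * (f g + f g⁻¹) = 0
    rw [(hz g hg).1, (hz g hg).2, add_zero, mul_zero]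

variable {μ}

theorem IsBump.norm_integral_smul_sub_le {X : Type*} [NormedAddCommGroup X] [NormedSpace ℝ X]
    [CompleteSpace X] {V : Set G} {φ : C_c(G, ℝ)} (hφ : IsBump μ V φ) {u : G → X}
    (hu : Continuous u) {x : X} {c : ℝ} (h : ∀ g ∈ V, ‖u g - x‖ ≤ c) :
    ‖∫ g, φ g • u g ∂μ - x‖ ≤ c := by
  have hi : Integrable φ μ := φ.continuous.integrable_of_hasCompactSupport φ.hasCompactSupport
  have hiu : Integrable (fun g => φ g • u g) μ :=
    Continuous.integrable_of_hasCompactSupport (by fun_prop) φ.hasCompactSupport.smul_right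
  have e : ∫ g, φ g • u g ∂μ - x = ∫ g, φ g • (u g - x) ∂μ := by
    simp_rw [smul_sub]
    rw [integral_sub hiu (hi.smul_const x), integral_smul_const, hφ.integral_eq_one, one_smul]
  rw [e]
  calc _ ≤ ∫ g, φ g * c ∂μ := by
        refine norm_integral_le_of_norm_le (hi.mul_const c) (Eventually.of_forall fun g => ?_)
        rw [norm_smul, Real.norm_of_nonneg (hφ.nonneg g)]
        by_cases hg : g ∈ V
        · exact mul_le_mul_of_nonneg_left (h g hg) (hφ.nonneg g)
        · simp [hφ.eq_zero g hg]
    _ = c := by rw [integral_mul_const, hφ.integral_eq_one, one_mul]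

/-- The function `g ↦ φ(g) b`. -/
noncomputable def tensor {B : Type*} [NonUnitalCStarAlgebra B] (φ : C_c(G, ℝ)) (b : B) :
    C_c(G, B) :=
  ⟨⟨fun g => φ g • b, by fun_prop⟩, φ.hasCompactSupport.smul_right⟩

theorem tensor_apply {B : Type*} [NonUnitalCStarAlgebra B] (φ : C_c(G, ℝ)) (b : B) (g : G) :
    tensor φ b g = φ g • b := rfl

variable {B : Type*} [NonUnitalCStarAlgebra B] {β : GCStarAction G B}
  [PartialOrder B] [StarOrderedRing B]

/-- Symmetry of φ makes both integrals in `rhoBound` equal to ‖b‖, so that no modular function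
intervenes. -/
theorem IsBump.norm_rhoOp_tensor_le {V : Set G} {φ : C_c(G, ℝ)} (hφ : IsBump μ V φ) (b : B) :
    ‖rhoOp μ β (tensor φ b)‖ ≤ ‖b‖ := by
  refine (norm_rhoOp_le μ β _).trans ?_
  have e1 : ∀ g, ‖tensor φ b g‖ = φ g * ‖b‖ := fun g => by
    rw [tensor_apply, norm_smul, Real.norm_of_nonneg (hφ.nonneg g)]
  rw [rhoBound]
  simp_rw [e1, hφ.symm]
  rw [integral_mul_const, hφ.integral_eq_one, one_mul, Real.sqrt_mul_self (norm_nonneg _)]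

theorem IsBump.crossedConvolution_tensor {V : Set G} {φ : C_c(G, ℝ)} (hφ : IsBump μ V φ)
    (L : C_c(G, B)) (b : B) (x : G) :
    crossedConvolution μ β L (tensor φ b) x = ∫ k, φ k • (L (x * k) * β (x * k) b) ∂μ := by
  rw [crossedConvolution_apply]
  refine integral_congr_ae (Eventually.of_forall fun k => ?_)
  simp only [tensor_apply, hφ.symm]
  have : β (x * k) (φ k • b) = φ k • β (x * k) b := (β.toCLM (x * k)).map_smul_of_tower (φ k) b
  rw [this, mul_smul_comm]

/-- Approximate units for the reduced crossed product. -/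
theorem exists_norm_sub_comp_rhoOp_lt [LocallyCompactSpace G] [T2Space G]
    {T : L2 μ B →L[ℂ] L2 μ B} (hT : T ∈ reducedCrossedProduct μ β) {ε : ℝ} (hε : 0 < ε) :
    ∃ V ∈ 𝓝 (1 : G), ∃ Q : Set B, IsCompact Q ∧ ∃ δ > 0, ∀ φ, IsBump μ V φ →
      ∀ b : B, ‖b‖ ≤ 2 → (∀ c ∈ Q, ‖c * b - c‖ < δ) →
        ‖T - T ∘L rhoOp μ β (tensor φ b)‖ < ε := by
  rw [reducedCrossedProduct_eq, Metric.mem_closure_iff] at hT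
  obtain ⟨_, ⟨L, rfl⟩, hL⟩ := hT (ε / 6) (by positivity)
  rw [dist_eq_norm] at hL
  obtain ⟨D, hD, hD1⟩ := exists_compact_mem_nhds (1 : G)
  -- C contains the supports of L and of all its convolutions with bumps supported in D. Uniform
  -- estimates thus become operator norm estimates with a fixed constant.
  set C : Set G := (fun x : G × G => x.1 * x.2⁻¹) '' (tsupport L ×ˢ D) with hC
  have hCc : IsCompact C := (L.hasCompactSupport.isCompact.prod hD).image (by fun_prop)
  have hmemC : ∀ x, ∀ k ∈ D, x ∉ C → L (x * k) = 0 := fun x k hk hx => by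
    refine image_eq_zero_of_notMem_tsupport fun h => hx ⟨(x * k, k), ⟨h, hk⟩, by simp⟩
  set m := √(μ.real C * μ.real C⁻¹) + 1 with hm
  have hm1 : 0 < m := by positivity
  set δ := ε / (6 * m) with hδ
  have hδ0 : 0 < δ := by positivity
  have hunif : ∀ᶠ k in 𝓝 (1 : G), ∀ x ∈ C, ‖L (x * k) - L x‖ < δ := by
    refine hCc.eventually_forall_of_forall_eventually fun x _ => ?_
    have : Continuous fun z : G × G => ‖L (z.2 * z.1) - L z.2‖ := by fun_prop
    exact this.continuousAt.eventually_lt_const (by simpa using hδ0)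
  -- With this Q, the condition cb ≈ c for c ∈ Q says exactly that L(y)β_y(b) ≈ L(y), since β_y is
  -- isometric.
  refine ⟨_, inter_mem hD1 hunif, (fun y => β y⁻¹ (L y)) '' tsupport L,
    L.hasCompactSupport.isCompact.image (by fun_prop), δ, hδ0, fun φ hφ b hb hbQ => ?_⟩
  set ρ := rhoOp μ β (tensor φ b)
  have hρ : ‖ρ‖ ≤ 2 := (hφ.norm_rhoOp_tensor_le b).trans hb
  have hb1 : ∀ y, ‖L y * β y b - L y‖ ≤ δ := by
    intro y
    by_cases hy : y ∈ tsupport L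
    · have h1 := hbQ _ ⟨y, hy, rfl⟩
      rw [← β.norm_apply y, map_sub, map_mul (β y), β.apply_apply_inv] at h1
      exact h1.le
    · simp [image_eq_zero_of_notMem_tsupport hy, hδ0.le]
  have hconv : ∀ x, ∀ c : ℝ,
      (∀ k ∈ D ∩ {k | ∀ x ∈ C, ‖L (x * k) - L x‖ < δ}, ‖L (x * k) * β (x * k) b - L x‖ ≤ c) →
      ‖(L - crossedConvolution μ β L (tensor φ b)) x‖ ≤ c := by
    intro x c h
    change ‖L x - crossedConvolution μ β L (tensor φ b) x‖ ≤ c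
    rw [hφ.crossedConvolution_tensor, norm_sub_rev]
    exact hφ.norm_integral_smul_sub_le (by fun_prop) h
  have hout : ∀ x ∉ C, (L - crossedConvolution μ β L (tensor φ b)) x = 0 := by
    intro x hx
    refine norm_le_zero_iff.1 (hconv x 0 fun k hk => ?_)
    have h1 : L x = 0 := by
      have := hmemC x 1 (mem_of_mem_nhds hD1) hx
      rwa [mul_one] at this
    simp [hmemC x k hk.1 hx, h1]
  have hall : ∀ x, ‖(L - crossedConvolution μ β L (tensor φ b)) x‖ ≤ 2 * δ := by
    intro x
    by_cases hx : x ∈ C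
    · refine hconv x _ fun k hk => ?_
      calc ‖L (x * k) * β (x * k) b - L x‖
          = ‖(L (x * k) * β (x * k) b - L (x * k)) + (L (x * k) - L x)‖ := by
            congr 1; abel
        _ ≤ δ + δ := (norm_add_le _ _).trans (add_le_add (hb1 _) (hk.2 x hx).le)
        _ = 2 * δ := by ring
    · rw [hout x hx, norm_zero]; positivity
  have h2 : ‖rhoOp μ β L - rhoOp μ β L ∘L ρ‖ ≤ 2 * δ * m := by
    rw [← rhoOp_crossedConvolution, ← rhoOp_sub]
    refine (norm_rhoOp_le μ β _).trans ((rhoBound_le μ hCc hout hall).trans ?_)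
    gcongr
    exact (le_add_of_nonneg_right zero_le_one)
  have h3 : ‖(rhoOp μ β L - T) ∘L ρ‖ ≤ ε / 6 * 2 := by
    refine (ContinuousLinearMap.opNorm_comp_le _ _).trans ?_
    rw [norm_sub_rev]
    gcongr
  have e : T - T ∘L ρ = (T - rhoOp μ β L) + (rhoOp μ β L - rhoOp μ β L ∘L ρ) +
      (rhoOp μ β L - T) ∘L ρ := by
    rw [ContinuousLinearMap.sub_comp]; abel
  -- The three errors are below ε/6, at most ε/3 and at most ε/3.
  have e2 : 2 * δ * m = ε / 3 := by rw [hδ]; field_simp; norm_num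
  rw [e]
  refine lt_of_le_of_lt (norm_add₃_le) ?_
  linarith

end Bump

/-! ### Approximation of elements by E_cs in the norm ‖·‖_si. -/

namespace HilbertGAction

variable {G B E : Type*} [Group G] [TopologicalSpace G] [IsTopologicalGroup G]
  [MeasurableSpace G] [BorelSpace G] [NonUnitalCStarAlgebra B] [PartialOrder B]
  [StarOrderedRing B] [NormedAddCommGroup E] [NormedSpace ℂ E] [SMul Bᵐᵒᵖ E] [CStarModule Bᵐᵒᵖ E]
  {β : GCStarAction G B} {γ : HilbertGAction β E} {μ : Measure G} [μ.IsHaarMeasure]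

theorem conv_tensor {V : Set G} {φ : C_c(G, ℝ)} (hφ : IsBump μ V φ) (ξ : E) (b : B) :
    γ.conv μ ξ (tensor φ b) = ∫ g, φ g • γ g (ξ <• b) ∂μ := by
  refine integral_congr_ae (Eventually.of_forall fun g => ?_)
  simp only [tensor_apply, hφ.symm]
  have h1 : ξ <• (φ g • b) = φ g • (ξ <• b) := (rmulL B E ξ).map_smul_of_tower (φ g) b
  rw [h1]
  exact (γ.toCLM g).map_smul_of_tower (φ g) (ξ <• b)

variable [CompleteSpace E]

theorem norm_conv_tensor_sub_le {V : Set G} {φ : C_c(G, ℝ)} (hφ : IsBump μ V φ) {ξ x : E} {b : B}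
    {c : ℝ} (h : ∀ g ∈ V, ‖γ g (ξ <• b) - x‖ ≤ c) : ‖γ.conv μ ξ (tensor φ b) - x‖ ≤ c := by
  rw [conv_tensor hφ]
  exact hφ.norm_integral_smul_sub_le (by fun_prop) h

theorem conv_tensor_mem_moduleIdeal {V : Set G} {φ : C_c(G, ℝ)} (hφ : IsBump μ V φ)
    {U W : Set (PrimSpace B)} (hW : ∀ g ∈ V, β.translate g U ⊆ W) (ξ : E) {b : B}
    (hb : b ∈ idealOf U) : γ.conv μ ξ (tensor φ b) ∈ (moduleIdeal B W : Submodule ℂ E) := by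
  rw [conv_tensor hφ]
  refine Submodule.integral_mem_of_forall_mem (isClosed_moduleIdeal W) fun g => ?_
  by_cases hg : g ∈ V
  · exact Submodule.smul_of_tower_mem _ (φ g) (moduleIdeal_mono (hW g hg)
      (γ.apply_mem_moduleIdeal (rmul_mem_moduleIdeal ξ hb) g))
  · rw [hφ.eq_zero g hg, zero_smul]
    exact Submodule.zero_mem _

variable [LocallyCompactSpace G] [T2Space G]

/-- With T = ⟨⟨ξ|ξ⟩⟩ and y = x − ρ_K x, the inner square of |ξ⟩⟩y is ⟨y|Ty⟩, and Ty = (T − Tρ_K)x.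
So closeness of Tρ_K to T alone controls the ket norm. -/
theorem norm_ketOp_sub_conv_sq_le {ξ : E} (hξ : ξ ∈ γ.squareIntegrable μ) (K : C_c(G, B)) :
    ‖γ.ketOp μ (ξ - γ.conv μ ξ K)‖ ^ 2 ≤
      (1 + ‖rhoOp μ β K‖) * ‖braketOp hξ ξ - braketOp hξ ξ ∘L rhoOp μ β K‖ := by
  set c := (1 + ‖rhoOp μ β K‖) * ‖braketOp hξ ξ - braketOp hξ ξ ∘L rhoOp μ β K‖ with hc
  have hc0 : 0 ≤ c := by positivity
  rw [← Real.le_sqrt (norm_nonneg _) hc0]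
  refine ContinuousLinearMap.opNorm_le_bound _ (Real.sqrt_nonneg _) fun x => ?_
  rw [← Real.sqrt_sq (norm_nonneg x), ← Real.sqrt_mul hc0]
  refine Real.le_sqrt_of_sq_le ?_
  rw [ketOp_sub hξ (conv_mem_squareIntegrable hξ K), ketOp_conv hξ, sub_apply,
    ContinuousLinearMap.comp_apply, ← map_sub, norm_sq_eq_norm_hinner (B := B),
    hinner_ketOp_left hξ]
  set y := x - rhoOp μ β K x
  have h1 : ‖y‖ ≤ (1 + ‖rhoOp μ β K‖) * ‖x‖ := by
    rw [add_mul, one_mul]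
    exact (norm_sub_le _ _).trans (add_le_add_right ((rhoOp μ β K).le_opNorm x) _)
  have h2 : ‖γ.braOp μ ξ (γ.ketOp μ ξ y)‖ ≤
      ‖braketOp hξ ξ - braketOp hξ ξ ∘L rhoOp μ β K‖ * ‖x‖ := by
    have : γ.braOp μ ξ (γ.ketOp μ ξ y) =
        (braketOp hξ ξ - braketOp hξ ξ ∘L rhoOp μ β K) x :=
      map_sub (braketOp hξ ξ) x (rhoOp μ β K x)
    rw [this]
    exact ContinuousLinearMap.le_opNorm _ _
  calc _ ≤ ‖y‖ * ‖γ.braOp μ ξ (γ.ketOp μ ξ y)‖ := norm_hinner_le _ _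
    _ ≤ _ := mul_le_mul h1 h2 (norm_nonneg _) (by positivity)
    _ = _ := by rw [hc]; ring

theorem eventually_norm_apply_sub_lt (γ : HilbertGAction β E) (ξ : E) {ε : ℝ} (hε : 0 < ε) :
    ∀ᶠ g in 𝓝 (1 : G), ‖γ g ξ - ξ‖ < ε := by
  have : Continuous fun g => ‖γ g ξ - ξ‖ := by fun_prop
  refine this.continuousAt.eventually_lt_const ?_
  change ‖γ 1 ξ - ξ‖ < ε
  rwa [γ.one_apply, sub_self, norm_zero]

/-- Elements with `⟨⟨ξ|ξ⟩⟩ ∈ C⋆_r(G, B)` are approximated by elements of `E_cs`. -/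
theorem exists_conv_mem_moduleCompactPart {ξ : E} (hξ : ξ ∈ γ.squareIntegrable μ)
    (h : γ.BraketMemReduced μ ξ ξ) {ε : ℝ} (hε : 0 < ε) :
    ∃ K : C_c(G, B), γ.conv μ ξ K ∈ moduleCompactPart B E ∧
      γ.siNorm μ (ξ - γ.conv μ ξ K) < ε := by
  rw [braketMemReduced_iff hξ] at h
  -- The divisor 3 absorbs 1 + ‖ρ_K‖ ≤ 1 + 2; the square root then leaves a ket norm below ε/4.
  obtain ⟨V, hV, Q, hQ, δ, hδ, happ⟩ := exists_norm_sub_comp_rhoOp_lt h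
    (show 0 < (ε / 4) ^ 2 / 3 by positivity)
  obtain ⟨D, hD, hD1⟩ := exists_compact_mem_nhds (1 : G)
  obtain ⟨b, ⟨U, hU, hU', hbU⟩, hb, hbξ, hbQ⟩ := exists_compactPart_approx ξ hQ
    (lt_min hδ (show 0 < ε / 8 by positivity))
  obtain ⟨φ, hφ⟩ := exists_isBump μ (inter_mem (inter_mem hV hD1)
    (eventually_norm_apply_sub_lt γ ξ (show 0 < ε / 8 by positivity)))
  -- ξ∗K averages γ_g(ξ·b) over g ∈ D, and W absorbs all translates gU with g ∈ D.
  obtain ⟨W, hW, hW', hUW⟩ := β.exists_isOpen_translate_subset hU hU' hD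
  refine ⟨tensor φ b, mem_moduleCompactPart_iff.2 ⟨W, hW, hW', ?_⟩, ?_⟩
  · exact conv_tensor_mem_moduleIdeal hφ (fun g hg => hUW g hg.1.2) ξ hbU
  · have h1 : ‖ξ - γ.conv μ ξ (tensor φ b)‖ ≤ ε / 4 := by
      rw [norm_sub_rev]
      refine norm_conv_tensor_sub_le hφ fun g hg => ?_
      calc ‖γ g (ξ <• b) - ξ‖ = ‖γ g (ξ <• b - ξ) + (γ g ξ - ξ)‖ := by
            rw [map_sub]; congr 1; abel
        _ ≤ ‖ξ <• b - ξ‖ + ‖γ g ξ - ξ‖ := by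
            refine (norm_add_le _ _).trans_eq ?_
            rw [γ.norm_apply]
        _ ≤ ε / 8 + ε / 8 := add_le_add (hbξ.trans_le (min_le_right _ _)).le (le_of_lt hg.2)
        _ = ε / 4 := by ring
    have h2 := happ φ (hφ.mono fun g hg => hg.1.1) b hb
      fun c hc => (hbQ c hc).trans_le (min_le_left _ _)
    have h3 : ‖rhoOp μ β (tensor φ b)‖ ≤ 2 := (hφ.norm_rhoOp_tensor_le b).trans hb
    have h4 : ‖γ.ketOp μ (ξ - γ.conv μ ξ (tensor φ b))‖ < ε / 4 := by
      refine lt_of_pow_lt_pow_left₀ 2 (by positivity) ?_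
      refine (norm_ketOp_sub_conv_sq_le hξ _).trans_lt ?_
      calc _ ≤ 3 * ‖braketOp hξ ξ - braketOp hξ ξ ∘L rhoOp μ β (tensor φ b)‖ := by
            gcongr; linarith
        _ < _ := by linarith
    rw [siNorm]
    linarith

end HilbertGAction

/-! ### Complete subspaces and uniqueness. -/

namespace HilbertGAction

variable {G B E : Type*} [Group G] [TopologicalSpace G] [IsTopologicalGroup G]
  [MeasurableSpace G] [BorelSpace G] [NonUnitalCStarAlgebra B] [PartialOrder B]
  [StarOrderedRing B] [NormedAddCommGroup E] [NormedSpace ℂ E] [SMul Bᵐᵒᵖ E] [CStarModule Bᵐᵒᵖ E]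
  {β : GCStarAction G B} {γ : HilbertGAction β E} {μ : Measure G} [μ.IsHaarMeasure]
  [CompleteSpace E] [LocallyCompactSpace G] [T2Space G]

variable (γ μ) in
theorem isCompleteSubspace_squareIntegrable :
    γ.IsCompleteSubspace μ (γ.squareIntegrableSubmodule μ) :=
  ⟨subset_rfl, fun _ hξ _ => hξ, fun _ hξ K => conv_mem_squareIntegrable hξ K⟩

theorem subset_completion (R : Set E) : R ⊆ γ.completion μ R := fun _ hx =>
  Submodule.mem_sInf.2 fun _ hS => hS.2 hx

theorem completion_le {R : Set E} {S : Submodule ℂ E} (hS : γ.IsCompleteSubspace μ S)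
    (h : R ⊆ (S : Set E)) : γ.completion μ R ≤ S := sInf_le ⟨hS, h⟩

theorem completion_subset_squareIntegrable {R : Set E} (hR : R ⊆ γ.squareIntegrable μ) :
    (γ.completion μ R : Set E) ⊆ γ.squareIntegrable μ :=
  completion_le (γ.isCompleteSubspace_squareIntegrable μ) hR

/-- E_si is itself complete, so for R ⊆ E_si the intersection runs over a nonempty family and stays
inside E_si. -/
theorem isCompleteSubspace_completion {R : Set E} (hR : R ⊆ γ.squareIntegrable μ) :
    γ.IsCompleteSubspace μ (γ.completion μ R) := by
  refine ⟨completion_subset_squareIntegrable hR, fun ξ hξ h => ?_, fun ξ hξ K => ?_⟩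
  · refine Submodule.mem_sInf.2 fun S hS => hS.1.2.1 ξ hξ fun ε hε => ?_
    obtain ⟨η, hη, h⟩ := h ε hε
    exact ⟨η, completion_le hS.1 hS.2 hη, h⟩
  · exact Submodule.mem_sInf.2 fun S hS => hS.1.2.2 ξ (completion_le hS.1 hS.2 hξ) K

theorem braketMemReduced_swap {ξ η : E} (hξ : ξ ∈ γ.squareIntegrable μ)
    (hη : η ∈ γ.squareIntegrable μ) (h : γ.BraketMemReduced μ ξ η) :
    γ.BraketMemReduced μ η ξ := by
  rw [braketMemReduced_iff hξ] at h
  rw [braketMemReduced_iff hη]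
  exact reducedCrossedProduct.adjoint_mem h (hinner_braketOp_left hξ hη)

/-- The vectors `η ∈ E_si` with `⟨⟨ξ|η⟩⟩ ∈ C⋆_r(G, B)`. -/
def braketSubmodule {ξ : E} (hξ : ξ ∈ γ.squareIntegrable μ) : Submodule ℂ E where
  carrier := {η | η ∈ γ.squareIntegrable μ ∧ braketOp hξ η ∈ reducedCrossedProduct μ β}
  add_mem' {x y} hx hy := by
    refine ⟨add_mem_squareIntegrable hx.1 hy.1, ?_⟩
    rw [braketOp, ketOp_add hx.1 hy.1, ContinuousLinearMap.comp_add]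
    exact reducedCrossedProduct.add_mem hx.2 hy.2
  zero_mem' := by
    have h0 : (0 : E) ∈ γ.squareIntegrable μ := (γ.squareIntegrableSubmodule μ).zero_mem
    refine ⟨h0, ?_⟩
    have h1 := reducedCrossedProduct.smul_mem (0 : ℂ) (rhoOp_mem (μ := μ) (β := β) 0)
    rw [zero_smul] at h1
    rw [braketOp, ← zero_smul ℂ (0 : E), ketOp_smul 0 h0, zero_smul, ContinuousLinearMap.comp_zero]
    exact h1
  smul_mem' z x hx := by
    refine ⟨smul_mem_squareIntegrable z hx.1, ?_⟩
    rw [braketOp, ketOp_smul z hx.1, ContinuousLinearMap.comp_smul]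
    exact reducedCrossedProduct.smul_mem z hx.2

/-- For fixed ξ, the operator ⟨⟨ξ|η⟩⟩ depends continuously on η in ‖·‖_si and is multiplied on the
right by ρ_K when η is replaced by η∗K; the reduced crossed product is closed under both operations.
-/
theorem isCompleteSubspace_braketSubmodule {ξ : E} (hξ : ξ ∈ γ.squareIntegrable μ) :
    γ.IsCompleteSubspace μ (braketSubmodule hξ) := by
  refine ⟨fun η hη => hη.1, fun η hη h => ⟨hη, ?_⟩, fun η hη K =>
    ⟨conv_mem_squareIntegrable hη.1 K, ?_⟩⟩
  · refine (isClosed_closure (X := L2 μ B →L[ℂ] L2 μ B)).closure_subset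
      (Metric.mem_closure_iff.2 fun ε hε => ?_)
    obtain ⟨ζ, hζ, hlt⟩ := h (ε / (‖braCLM hξ‖ + 1)) (by positivity)
    refine ⟨_, hζ.2, ?_⟩
    rw [dist_eq_norm, braketOp, braketOp, ← ContinuousLinearMap.comp_sub, ← ketOp_sub hη hζ.1]
    rw [lt_div_iff₀ (by positivity)] at hlt
    refine lt_of_le_of_lt (ContinuousLinearMap.opNorm_comp_le _ _) (lt_of_le_of_lt ?_ hlt)
    rw [mul_comm, siNorm]
    gcongr
    · exact le_add_of_nonneg_left (norm_nonneg _)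
    · exact le_add_of_nonneg_right zero_le_one
  · rw [braketOp, ketOp_conv hη.1, ← ContinuousLinearMap.comp_assoc]
    exact reducedCrossedProduct.comp_rhoOp_mem K hη.2

/-- The completion of a relatively continuous subset is relatively continuous. -/
theorem IsRelativelyContinuous.completion {R : Set E} (hR : γ.IsRelativelyContinuous μ R) :
    γ.IsRelativelyContinuous μ (γ.completion μ R : Set E) := by
  have hsi := completion_subset_squareIntegrable hR.1
  -- One variable at a time: first η runs through the completion, then taking adjoints exchanges the
  -- roles.
  have h1 : ∀ ξ ∈ R, ∀ η ∈ γ.completion μ R, γ.BraketMemReduced μ ξ η := by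
    intro ξ hξ η hη
    have := completion_le (isCompleteSubspace_braketSubmodule (hR.1 hξ)) (fun ζ hζ =>
      ⟨hR.1 hζ, (braketMemReduced_iff (hR.1 hξ) ζ).1 (hR.2 ξ hξ ζ hζ)⟩) hη
    exact (braketMemReduced_iff (hR.1 hξ) η).2 this.2
  refine ⟨hsi, fun ξ hξ η hη => ?_⟩
  have := completion_le (isCompleteSubspace_braketSubmodule (hsi hξ)) (fun ζ hζ =>
    ⟨hR.1 hζ, (braketMemReduced_iff (hsi hξ) ζ).1
      (braketMemReduced_swap (hR.1 hζ) (hsi hξ) (h1 ζ hζ ξ hξ))⟩) hη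
  exact (braketMemReduced_iff (hsi hξ) η).2 this.2

theorem mem_of_braketMemReduced {R : Submodule ℂ E} (hR : γ.IsCompleteSubspace μ R)
    (hcs : moduleCompactPart B E ⊆ (R : Set E)) {ξ : E} (hξ : ξ ∈ γ.squareIntegrable μ)
    (h : γ.BraketMemReduced μ ξ ξ) : ξ ∈ R :=
  hR.2.1 ξ hξ fun _ hε =>
    let ⟨_, hK, hlt⟩ := exists_conv_mem_moduleCompactPart hξ h hε
    ⟨_, hcs hK, hlt⟩

/-- A complete subspace contains all elements of `E_cs` which it approximates within some
`E · B_W` with respect to the norm of `E`. -/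
theorem mem_of_forall_exists_mem_moduleIdeal (hβ : β.IsSpectrallyProper) {R : Submodule ℂ E}
    (hR : γ.IsCompleteSubspace μ R) {W : Set (PrimSpace B)} (hW : IsOpen W)
    (hW' : IsRelQuasiCompact W) {ξ : E} (hξ : ξ ∈ (moduleIdeal B W : Submodule ℂ E))
    (h : ∀ ε > 0, ∃ η ∈ R, η ∈ (moduleIdeal B W : Submodule ℂ E) ∧ ‖ξ - η‖ ≤ ε) : ξ ∈ R := by
  obtain ⟨C, hC, hCW⟩ := γ.exists_siNorm_le μ hβ hW'
  refine hR.2.1 ξ (γ.moduleCompactPart_subset_squareIntegrable μ hβ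
    (mem_moduleCompactPart_iff.2 ⟨W, hW, hW', hξ⟩)) fun ε hε => ?_
  obtain ⟨η, hη, hηW, hle⟩ := h (ε / (2 * C)) (by positivity)
  refine ⟨η, hη, (hCW _ (Submodule.sub_mem _ hξ hηW)).trans_lt ?_⟩
  calc C * ‖ξ - η‖ ≤ C * (ε / (2 * C)) := by gcongr
    _ = ε / 2 := by field_simp
    _ < ε := half_lt_self hε

/-- R is only known to be invariant under convolution. As φ concentrates at 1, ξ∗(φ ⊗ b) tends to
ξ·b in norm, and all these elements lie in a single E·B_W, where norm convergence is convergence in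
‖·‖_si. -/
theorem rmul_mem_of_isCompleteSubspace (hβ : β.IsSpectrallyProper) {R : Submodule ℂ E}
    (hR : γ.IsCompleteSubspace μ R) {ξ : E} (hξ : ξ ∈ R) {b : B} (hb : b ∈ compactPart B) :
    ξ <• b ∈ R := by
  obtain ⟨U, hU, hU', hbU⟩ := hb
  obtain ⟨D, hD, hD1⟩ := exists_compact_mem_nhds (1 : G)
  obtain ⟨W, hW, hW', hUW⟩ := β.exists_isOpen_translate_subset hU hU' hD
  refine mem_of_forall_exists_mem_moduleIdeal hβ hR hW hW' ?_ fun ε hε => ?_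
  · have := moduleIdeal_mono (hUW 1 (mem_of_mem_nhds hD1))
      (γ.apply_mem_moduleIdeal (rmul_mem_moduleIdeal ξ hbU) 1)
    rwa [γ.one_apply] at this
  · obtain ⟨φ, hφ⟩ := exists_isBump μ (inter_mem hD1 (eventually_norm_apply_sub_lt γ (ξ <• b) hε))
    refine ⟨_, hR.2.2 ξ hξ (tensor φ b),
      conv_tensor_mem_moduleIdeal hφ (fun g hg => hUW g hg.1) ξ hbU, ?_⟩
    rw [norm_sub_rev]
    exact norm_conv_tensor_sub_le hφ fun g hg => le_of_lt hg.2

/-- Density of R concerns only the norm of E. Multiplication by b ∈ B_U moves the approximation into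
E·B_U, where it is good enough for completeness. -/
theorem moduleCompactPart_subset_of_dense (hβ : β.IsSpectrallyProper) {R : Submodule ℂ E}
    (hR : γ.IsCompleteSubspace μ R) (hd : Dense (R : Set E)) :
    moduleCompactPart B E ⊆ (R : Set E) := by
  rintro _ ⟨x, b, hb, rfl⟩
  have hb' := hb
  obtain ⟨U, hU, hU', hbU⟩ := hb
  refine mem_of_forall_exists_mem_moduleIdeal hβ hR hU hU' (rmul_mem_moduleIdeal x hbU)
    fun ε hε => ?_
  obtain ⟨ξ, hξ, hlt⟩ := Metric.mem_closure_iff.1 (hd x) (ε / (‖b‖ + 1)) (by positivity)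
  refine ⟨_, rmul_mem_of_isCompleteSubspace hβ hR hξ hb', rmul_mem_moduleIdeal ξ hbU, ?_⟩
  rw [← sub_rmul]
  rw [dist_eq_norm, lt_div_iff₀ (by positivity)] at hlt
  calc _ ≤ ‖x - ξ‖ * ‖b‖ := norm_rmul_le _ _
    _ ≤ ‖x - ξ‖ * (‖b‖ + 1) := by gcongr; exact le_add_of_nonneg_right zero_le_one
    _ ≤ ε := hlt.le

end HilbertGAction

/-! ### Assembly of the theorem. -/

theorem mainTheorem3 {G B E : Type*}
    [Group G] [TopologicalSpace G] [IsTopologicalGroup G] [LocallyCompactSpace G] [T2Space G]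
    [MeasurableSpace G] [BorelSpace G] (μ : Measure G) [μ.IsHaarMeasure] [μ.Regular]
    [NonUnitalCStarAlgebra B] [PartialOrder B] [StarOrderedRing B]
    [NormedAddCommGroup E] [NormedSpace ℂ E] [SMul Bᵐᵒᵖ E] [CStarModule Bᵐᵒᵖ E] [CompleteSpace E]
    (β : GCStarAction G B) (hβ : β.IsSpectrallyProper) (γ : HilbertGAction β E) :
    -- `E_cs` is a dense, relatively continuous linear subspace
    (∃ S : Submodule ℂ E, (S : Set E) = moduleCompactPart B E) ∧
    Dense (moduleCompactPart B E) ∧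
    γ.IsRelativelyContinuous μ (moduleCompactPart B E) ∧
    -- `⟨⟨ξ|η⟩⟩ = ρ_K` with `K ∈ C_c(G, B)` for all `ξ, η ∈ E_cs`
    (∀ ξ ∈ moduleCompactPart B E, ∀ η ∈ moduleCompactPart B E, ∃ K : C_c(G, B),
      ⇑K = γ.symbol ξ η ∧ ∀ f, γ.braket μ ξ η (toL2 μ f) = toL2 μ (rho μ β K f)) ∧
    -- `E` is square-integrable
    Dense (γ.squareIntegrable μ) ∧
    -- the completion of `E_cs` is the only dense, complete, relatively continuous subspace
    (∀ R : Submodule ℂ E,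
      (Dense (R : Set E) ∧ γ.IsCompleteSubspace μ R ∧ γ.IsRelativelyContinuous μ (R : Set E)) ↔
        R = γ.completion μ (moduleCompactPart B E)) ∧
    (∀ ξ : E, ξ ∈ γ.completion μ (moduleCompactPart B E) ↔
      ξ ∈ γ.squareIntegrable μ ∧ γ.BraketMemReduced μ ξ ξ) ∧
    (∀ R : Set E, γ.IsRelativelyContinuous μ R →
      R ⊆ (γ.completion μ (moduleCompactPart B E) : Set E)) := by
  have hd : Dense (moduleCompactPart B E) := dense_moduleCompactPart
  have hrc := γ.isRelativelyContinuous_moduleCompactPart μ hβ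
  have hrc' := hrc.completion
  have hcomp := HilbertGAction.isCompleteSubspace_completion hrc.1
  have hsub := HilbertGAction.subset_completion (γ := γ) (μ := μ) (moduleCompactPart B E)
  have hmem : ∀ ξ : E, ξ ∈ γ.completion μ (moduleCompactPart B E) ↔
      ξ ∈ γ.squareIntegrable μ ∧ γ.BraketMemReduced μ ξ ξ := fun ξ =>
    ⟨fun h => ⟨hrc'.1 h, hrc'.2 ξ h ξ h⟩, fun h =>
      HilbertGAction.mem_of_braketMemReduced hcomp hsub h.1 h.2⟩
  refine ⟨⟨moduleCompactPartSubmodule B E, rfl⟩, hd, hrc, fun ξ hξ η hη => ?_, hd.mono hrc.1,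
    fun R => ⟨fun ⟨hRd, hRc, hRr⟩ => le_antisymm (fun ξ hξ => ?_) ?_, ?_⟩, hmem,
    fun R hR ξ hξ => (hmem ξ).2 ⟨hR.1 hξ, hR.2 ξ hξ ξ hξ⟩⟩
  · obtain ⟨K, hK⟩ := γ.exists_symbol hβ hξ hη
    exact ⟨K, hK, γ.braket_toL2 (hrc.1 hη) hK⟩
  · exact (hmem ξ).2 ⟨hRr.1 hξ, hRr.2 ξ hξ ξ hξ⟩
  · exact HilbertGAction.completion_le hRc
      (HilbertGAction.moduleCompactPart_subset_of_dense hβ hRc hRd)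
  · rintro rfl
    exact ⟨hd.mono hsub, hcomp, hrc'⟩
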